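/- Let $\mathbb T=\mathbb R/\mathbb Z$. Let $(f,V)$ be a weak solution on $(0,\infty)\times\mathbb T\times\mathbb R$ of the quasineutral Vlasov equation $$\partial_t f+v\,\partial_x f-\partial_xV\,\partial_v f=0,\qquad \int_{\mathbb R} f(t,x,v)\,dv=1 ,$$ that is: $f\ge 0$ is measurable with $\int_{\mathbb R} f(t,x,v)\,dv=1$ for a.e. $(t,x)$, the potential $V$ and the field $E=-\partial_xV$ (derivative in the sense of distributions) are locally integrable on $(0,\infty)\times\mathbb T$, and $$\int_0^\infty\!\!\int_{\mathbb T}\int_{\mathbb R} f\,(\partial_t\psi+v\,\partial_x\psi+E\,\partial_v\psi)\,dv\,dx\,dt=0\qquad\text{for all }\psi\in C_c^\infty((0,\infty)\times\mathbb T\times\mathbb R).$$ Assume that $E\in L^\infty((0,\infty);L^1(\mathbb T))$ and that there is a $C^1$ function $\bar v:[0,\infty)\times\mathbb T\to\mathbb R$ such that, for a.e. $(t,x)$, (i) $v\mapsto f(t,x,v)$ is nondecreasing on $\{v<\bar v(t,x)\}$, nonincreasing on $\{v>\bar v(t,x)\}$, and has a maximum at $v=\bar v(t,x)$; (ii) $f(t,x,2\bar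 v(t,x)-v)=f(t,x,v)$ for all $v\in\mathbb R$. Then $\bar v$ is constant on $[0,\infty)\times\mathbb T$, and there is a nondecreasing $\varphi:(-\infty,0]\to[0,\infty)$, independent of $t$ and $x$, with $$\int_{-\infty}^0\varphi(u)\,\frac{du}{\sqrt{-u}}=\frac1{\sqrt2}$$ such that $$f(t,x,v)=\varphi\Big(-\frac{|v-\bar v|^2}{2}\Big)$$ for a.e. $(t,x,v)\in(0,\infty)\times\mathbb T\times\mathbb R$, and moreover at every point $(t,x,v)\in[0,\infty)\times\mathbb T\times\mathbb R$ at which $f$ (as a function on $[0,\infty)\times\mathbb T\times\mathbb R$) is continuous; in particular everywhere if $f$ is continuous. -/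

import Mathlib

open MeasureTheory Set
open scoped ContDiff NNReal ENNReal

namespace QuasineutralVlasov

/-- The torus `𝕋 = ℝ / ℤ`, with Lebesgue (Haar probability) measure as `volume`. -/
abbrev Torus : Type := UnitAddCircle

/-- The space-time domain `(0, ∞) × 𝕋`. -/
def spaceTime : Set (ℝ × Torus) := Ioi 0 ×ˢ univ

/-- The domain `(0, ∞) × 𝕋 × ℝ` of the variables `(t, x, v)`. -/
def phaseSpaceTime : Set (ℝ × Torus × ℝ) := Ioi 0 ×ˢ univ

/-- Test functions in `C_c^∞((0, ∞) × 𝕋)`.  Smoothness on the torus is smoothness of the periodic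
lift. -/
structure IsSpaceTest (ψ : ℝ × Torus → ℝ) : Prop where
  smooth : ContDiff ℝ ∞ (fun p : ℝ × ℝ => ψ (p.1, (p.2 : Torus)))
  compact : HasCompactSupport ψ
  support : tsupport ψ ⊆ spaceTime

/-- Test functions in `C_c^∞((0, ∞) × 𝕋 × ℝ)`. -/
structure IsPhaseTest (ψ : ℝ × Torus × ℝ → ℝ) : Prop where
  smooth : ContDiff ℝ ∞ (fun p : ℝ × ℝ × ℝ => ψ (p.1, (p.2.1 : Torus), p.2.2))
  compact : HasCompactSupport ψ
  support : tsupport ψ ⊆ phaseSpaceTime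

/-- `∂ₓ ψ (t, x)` for a function on `ℝ × 𝕋`. -/
noncomputable def spaceDx (ψ : ℝ × Torus → ℝ) (p : ℝ × Torus) : ℝ :=
  deriv (fun y : ℝ => ψ (p.1, p.2 + (y : Torus))) 0

/-- `∂ₜ ψ (t, x, v)`. -/
noncomputable def phaseDt (ψ : ℝ × Torus × ℝ → ℝ) (p : ℝ × Torus × ℝ) : ℝ :=
  deriv (fun s : ℝ => ψ (s, p.2.1, p.2.2)) p.1

/-- `∂ₓ ψ (t, x, v)`. -/
noncomputable def phaseDx (ψ : ℝ × Torus × ℝ → ℝ) (p : ℝ × Torus × ℝ) : ℝ :=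
  deriv (fun y : ℝ => ψ (p.1, p.2.1 + (y : Torus), p.2.2)) 0

/-- `∂ᵥ ψ (t, x, v)`. -/
noncomputable def phaseDv (ψ : ℝ × Torus × ℝ → ℝ) (p : ℝ × Torus × ℝ) : ℝ :=
  deriv (fun w : ℝ => ψ (p.1, p.2.1, w)) p.2.2

/-- `E = -∂ₓ V` in the sense of distributions on `(0, ∞) × 𝕋`, both being locally integrable. -/
structure IsElectricField (V E : ℝ × Torus → ℝ) : Prop where
  potential_locInt : LocallyIntegrableOn V spaceTime volume
  field_locInt : LocallyIntegrableOn E spaceTime volume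
  weak_deriv : ∀ ψ : ℝ × Torus → ℝ, IsSpaceTest ψ →
    ∫ p in spaceTime, V p * spaceDx ψ p = ∫ p in spaceTime, E p * ψ p

/-- `f` is a weak solution, with potential `V` and electric field `E = -∂ₓ V`, of the quasineutral
Vlasov equation `∂ₜ f + v ∂ₓ f - ∂ₓ V ∂ᵥ f = 0`, `∫ f dv = 1` on `(0, ∞) × 𝕋 × ℝ`: it is
a nonnegative measurable distribution function with unit density that solves the transport
equation in the sense of distributions.  (All the integrands below are integrable, because
`f ≥ 0`, `∫ f dv = 1`, `E` is locally integrable and test functions have compact support.) -/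
structure IsWeakSolution (f : ℝ × Torus × ℝ → ℝ) (V E : ℝ × Torus → ℝ) : Prop where
  field : IsElectricField V E
  measurable : AEStronglyMeasurable f (volume.restrict phaseSpaceTime)
  nonneg : ∀ᵐ p ∂(volume.restrict phaseSpaceTime), 0 ≤ f p
  density : ∀ᵐ p ∂(volume.restrict spaceTime), ∫ v : ℝ, f (p.1, p.2, v) = 1
  transport : ∀ ψ : ℝ × Torus × ℝ → ℝ, IsPhaseTest ψ →
    ∫ p in phaseSpaceTime,
      f p * (phaseDt ψ p + p.2.2 * phaseDx ψ p + E (p.1, p.2.1) * phaseDv ψ p) = 0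

/-- `E ∈ L^∞((0, ∞); L¹(𝕋))`. -/
def MemLinftyL1 (E : ℝ × Torus → ℝ) : Prop :=
  AEStronglyMeasurable E (volume.restrict spaceTime) ∧
    ∃ C : ℝ≥0, ∀ᵐ t ∂(volume.restrict (Ioi (0 : ℝ))), ∫⁻ x : Torus, ‖E (t, x)‖ₑ ≤ C

/-- A function on `[0, ∞) × 𝕋` is `C¹` (up to `t = 0`). -/
def IsC1 (u : ℝ × Torus → ℝ) : Prop :=
  ContDiffOn ℝ 1 (fun p : ℝ × ℝ => u (p.1, (p.2 : Torus))) (Ici 0 ×ˢ univ)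

end QuasineutralVlasov

/-! The mean velocity is handled first. Because each velocity profile is symmetric about `vbar`, the
zeroth and first velocity moments of the Vlasov equation read `∂ₓ vbar = 0` and `d/dt ∫ vbar dx = ∫
E dx = 0`, the last integral vanishing because `E` is an `x`-derivative on the torus. Hence `vbar`
is a constant `c` (`IsWeakSolution.exists_mean_velocity_eq`).

With `w = v - c`, the function `f` is even in `w`. Testing against functions odd in `w` kills the
time derivative and leaves, for almost every fixed `t`, the stationary equation `∂ₓ g + E ∂ₛ g = 0`
for the profile `g` as a function of the kinetic energy `s = w² / 2`. Let `U = -∫ E` be the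
potential. The equation says that the profile depends only on the total energy `U(x) + s` along any
stretch where this energy stays above `U`.

If `U` were not constant, there would be `y, z` with `δ = U z - U y > 0` and `U ≤ U z` between them.
Then every particle present at `z` is found at `y` with its kinetic energy raised by `δ`, so that
`Γ_z(w)` is at most `Γ_y(√(w² + δ))`. Since `Γ_y` is nonincreasing, the density at `z` is at most
that at `y`, and equality would make `Γ_y` constant, hence zero by integrability. This contradicts
equal densities (`IsProfile.not_shift`), so `E = 0` (`IsStationary.field_eq_zero`).

The field is only integrable in `x` and `f` is only measurable, so profiles are replaced by averages
over thin smooth energy shells. These are Lipschitz in the energy with constants independent of the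
profile, and monotonicity brackets an average between nearby values of the profile. Constancy along
characteristics follows from an increment estimate quadratic in `∫ |E|` (`eq_of_sub_le_sq`). The
points `y, z` can be taken outside a given null set because `U` maps null sets to null sets
(`volume_image_primitive_eq_zero`, `exists_good_pair_of_ne`).

Once `E = 0`, all shell averages have zero weak derivatives in `t` and `x`, hence are constant. They
determine a monotone profile off a countable set, so `f` is almost everywhere one fixed function of
`|v - c|`. The normalisation of `φ` is the substitution `u = -w² / 2`, and monotonicity of `φ`
upgrades the identity to every point of continuity. -/

namespace QuasineutralVlasov

/-! ### Monotone profiles and their averages in the energy variable. -/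

/-- The average `∫_{w > 0} Γ(w) w κ(w² / 2) dw` of a profile against a function of the energy. -/
noncomputable def energyAverage (Γ κ : ℝ → ℝ) : ℝ :=
  ∫ w in Ioi (0 : ℝ), Γ w * (w * κ (w ^ 2 / 2))

/-- The right half of an even unimodal probability density. -/
structure IsProfile (Γ : ℝ → ℝ) : Prop where
  antitone : AntitoneOn Γ (Ioi 0)
  nonneg : ∀ w, 0 < w → 0 ≤ Γ w
  integrable : IntegrableOn Γ (Ioi 0)
  mass : ∫ w in Ioi (0 : ℝ), Γ w = 1 / 2

lemma abs_mul_energy_le {κ : ℝ → ℝ} {A R : ℝ} (hA : ∀ s, |κ s| ≤ A)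
    (hR : ∀ s, R < s → κ s = 0) {w : ℝ} (hw : 0 < w) :
    |w * κ (w ^ 2 / 2)| ≤ A * √(2 * R) := by
  have hA0 : 0 ≤ A := (abs_nonneg _).trans (hA 0)
  by_cases h : R < w ^ 2 / 2
  · rw [hR _ h]; simp; positivity
  · rw [abs_mul, abs_of_pos hw, mul_comm]
    have : w ≤ √(2 * R) := Real.le_sqrt_of_sq_le (by linarith)
    exact mul_le_mul (hA _) this hw.le hA0

lemma IsProfile.integrable_energy {Γ : ℝ → ℝ} (hΓ : IsProfile Γ) {κ : ℝ → ℝ}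
    (hκ : Continuous κ) {A R : ℝ} (hA : ∀ s, |κ s| ≤ A) (hR : ∀ s, R < s → κ s = 0) :
    IntegrableOn (fun w => Γ w * (w * κ (w ^ 2 / 2))) (Ioi 0) := by
  refine Integrable.mul_bdd (c := A * √(2 * R)) hΓ.integrable ?_ ?_
  · exact (by fun_prop : Continuous fun w : ℝ => w * κ (w ^ 2 / 2)).aestronglyMeasurable
  · filter_upwards [ae_restrict_mem measurableSet_Ioi] with w hw
    exact abs_mul_energy_le hA hR hw

lemma IsProfile.abs_energyAverage_le {Γ : ℝ → ℝ} (hΓ : IsProfile Γ) {κ : ℝ → ℝ}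
    {A R : ℝ} (hA : ∀ s, |κ s| ≤ A) (hR : ∀ s, R < s → κ s = 0) :
    |energyAverage Γ κ| ≤ A * √(2 * R) := by
  have hA0 : 0 ≤ A := (abs_nonneg _).trans (hA 0)
  have h1 : |energyAverage Γ κ| ≤ ∫ w in Ioi (0 : ℝ), Γ w * (A * √(2 * R)) := by
    refine norm_integral_le_of_norm_le (f := fun w => Γ w * (w * κ (w ^ 2 / 2)))
      (hΓ.integrable.mul_const _) ?_
    filter_upwards [ae_restrict_mem measurableSet_Ioi] with w hw
    rw [norm_mul, Real.norm_of_nonneg (hΓ.nonneg w hw)]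
    exact mul_le_mul_of_nonneg_left (abs_mul_energy_le hA hR hw) (hΓ.nonneg w hw)
  rw [integral_mul_const, hΓ.mass] at h1
  have : 0 ≤ A * √(2 * R) := by positivity
  linarith

/-- Substitution `s = w² / 2`, `ds = w dw`; the weight `w` in the averages is chosen for this. -/
lemma integral_mul_energy {κ : ℝ → ℝ} (hκ : Continuous κ) (hc : HasCompactSupport κ)
    (h0 : ∀ s, s < 0 → κ s = 0) :
    IntegrableOn (fun w => w * κ (w ^ 2 / 2)) (Ioi 0) ∧
      ∫ w in Ioi (0 : ℝ), w * κ (w ^ 2 / 2) = ∫ s, κ s := by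
  have hcont : Continuous fun w : ℝ => w * κ (w ^ 2 / 2) := by fun_prop
  have hcs : HasCompactSupport fun w : ℝ => w * κ (w ^ 2 / 2) := by
    obtain ⟨R, hR⟩ := hc.isCompact.isBounded.subset_closedBall 0
    refine HasCompactSupport.of_support_subset_isCompact
      (isCompact_closedBall (0 : ℝ) (√(2 * R))) ?_
    intro w hw
    have hk : κ (w ^ 2 / 2) ≠ 0 := fun h => hw (by simp [h])
    have := hR (subset_tsupport _ hk)
    rw [Metric.mem_closedBall, Real.dist_eq, sub_zero, abs_of_nonneg (by positivity)] at this
    rw [Metric.mem_closedBall, Real.dist_eq, sub_zero]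
    apply Real.abs_le_sqrt; linarith
  have hint := hcont.integrable_of_hasCompactSupport (μ := volume) hcs
  refine ⟨hint.integrableOn, ?_⟩
  have := integral_comp_mul_deriv_Ioi (f := fun w : ℝ => w ^ 2 / 2) (f' := fun w => w) (g := κ)
    (a := 0) (by fun_prop) ?_ ?_ hκ.continuousOn
    (hκ.integrable_of_hasCompactSupport hc).integrableOn ?_
  · simp only [Function.comp] at this
    simp_rw [mul_comm _ (κ _)]
    rw [this]
    norm_num
    rw [← integral_Ici_eq_integral_Ioi]
    refine setIntegral_eq_integral_of_forall_compl_eq_zero fun s hs => h0 s ?_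
    simpa using hs
  · exact (Filter.tendsto_pow_atTop (by norm_num)).atTop_div_const (by norm_num)
  · intro x _
    have := ((hasDerivAt_pow 2 x).div_const 2).hasDerivWithinAt (s := Ioi x)
    simpa using this
  · simpa [Function.comp_def, mul_comm] using hint.integrableOn

/-- Averages over the energy shell `[r, r + d]` lie between the values of the profile at the
ends. -/
lemma IsProfile.energyAverage_mem {Γ : ℝ → ℝ} (hΓ : IsProfile Γ) {κ : ℝ → ℝ}
    (hκ : Continuous κ) (h0 : ∀ s, 0 ≤ κ s) (h1 : ∫ s, κ s = 1) {r d : ℝ} (hr : 0 ≤ r)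
    (hd : 0 < d) (hs : ∀ s, κ s ≠ 0 → s ∈ Icc r (r + d)) :
    Γ √(2 * (r + d)) ≤ energyAverage Γ κ ∧ (0 < r → energyAverage Γ κ ≤ Γ √(2 * r)) := by
  have hc : HasCompactSupport κ :=
    HasCompactSupport.of_support_subset_isCompact isCompact_Icc hs
  obtain ⟨hi, hI⟩ := integral_mul_energy hκ hc (fun s hs' => by
    by_contra h; exact absurd (hs s h).1 (by linarith))
  obtain ⟨A, hA⟩ := hκ.bounded_above_of_compact_support hc
  have hG := hΓ.integrable_energy hκ hA (R := r + d) (fun s hs' => by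
    by_contra h; exact absurd (hs s h).2 (by linarith))
  have hz : ∀ w : ℝ, 0 < w → κ (w ^ 2 / 2) ≠ 0 → √(2 * r) ≤ w ∧ w ≤ √(2 * (r + d)) := by
    intro w hw hk
    have := hs _ hk
    exact ⟨Real.sqrt_le_iff.2 ⟨hw.le, by linarith [this.1]⟩,
      Real.le_sqrt_of_sq_le (by linarith [this.2])⟩
  constructor
  · calc Γ √(2 * (r + d)) = ∫ w in Ioi (0 : ℝ), Γ √(2 * (r + d)) * (w * κ (w ^ 2 / 2)) := by
          rw [integral_const_mul, hI, h1, mul_one]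
      _ ≤ _ := by
          refine setIntegral_mono_on (hi.const_mul _) hG measurableSet_Ioi fun w hw => ?_
          by_cases hk : κ (w ^ 2 / 2) = 0
          · simp [hk]
          · refine mul_le_mul_of_nonneg_right ?_ (mul_nonneg (le_of_lt hw) (h0 _))
            exact hΓ.antitone hw (mem_Ioi.2 (Real.sqrt_pos.2 (by linarith))) (hz w hw hk).2
  · intro hr0
    calc energyAverage Γ κ ≤ ∫ w in Ioi (0 : ℝ), Γ √(2 * r) * (w * κ (w ^ 2 / 2)) := by
          refine setIntegral_mono_on hG (hi.const_mul _) measurableSet_Ioi fun w hw => ?_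
          by_cases hk : κ (w ^ 2 / 2) = 0
          · simp [hk]
          · refine mul_le_mul_of_nonneg_right ?_ (mul_nonneg (le_of_lt hw) (h0 _))
            exact hΓ.antitone (mem_Ioi.2 (Real.sqrt_pos.2 (by linarith))) hw (hz w hw hk).1
      _ = _ := by rw [integral_const_mul, hI, h1, mul_one]

/-- Two profiles of equal mass cannot be strictly shifted in energy. -/
lemma IsProfile.not_shift {Γ Γ' : ℝ → ℝ} (hΓ : IsProfile Γ) (hΓ' : IsProfile Γ') {δ : ℝ}
    (hδ : 0 < δ) (h : ∀ w, 0 < w → Γ' w ≤ Γ √(w ^ 2 + δ)) : False := by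
  have hle : ∀ w : ℝ, 0 < w → w ≤ √(w ^ 2 + δ) := fun w _ =>
    Real.le_sqrt_of_sq_le (by linarith)
  have hle2 : ∀ w, w ∈ Ioi (0 : ℝ) → Γ' w ≤ Γ w := fun w hw =>
    (h w hw).trans (hΓ.antitone hw (lt_of_lt_of_le hw (hle w hw)) (hle w hw))
  have hzero : ∫ w in Ioi (0 : ℝ), (Γ w - Γ' w) = 0 := by
    rw [integral_sub hΓ.integrable hΓ'.integrable, hΓ.mass, hΓ'.mass, sub_self]
  have hae := (setIntegral_eq_zero_iff_of_nonneg_ae (μ := volume)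
    ((ae_restrict_mem measurableSet_Ioi).mono fun w hw => sub_nonneg.2 (hle2 w hw))
    (hΓ.integrable.sub hΓ'.integrable)).1 hzero
  -- Equal masses force `Γ = Γ'` almost everywhere. At such a point `w` slightly below `a`, with `w²
  -- + δ > a² + δ / 2`, the chain `Γ a ≤ Γ w = Γ' w ≤ Γ √(w² + δ) ≤ Γ √(a² + δ / 2)` closes up.
  have hstep : ∀ a, 0 < a → Γ √(a ^ 2 + δ / 2) = Γ a := by
    intro a ha
    have hlt : √(a ^ 2 - δ / 2) < a := by
      rw [Real.sqrt_lt' ha]; linarith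
    have hne : (volume.restrict (Ioi (0 : ℝ))) (Ioo (√(a ^ 2 - δ / 2)) a) ≠ 0 := by
      rw [Measure.restrict_apply measurableSet_Ioo, inter_eq_left.2
        (fun w hw => mem_Ioi.2 ((Real.sqrt_nonneg _).trans_lt hw.1))]
      simpa using hlt
    obtain ⟨w, hw, hw2⟩ := Measure.exists_mem_of_measure_ne_zero_of_ae hne
      (ae_restrict_of_ae hae)
    have hw0 : 0 < w := (Real.sqrt_nonneg _).trans_lt hw.1
    have h1 : Γ w - Γ' w = 0 := hw2
    have h2 : a ^ 2 - δ / 2 < w ^ 2 := (Real.sqrt_lt' hw0).1 hw.1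
    have h3 : √(a ^ 2 + δ / 2) ≤ √(w ^ 2 + δ) := Real.sqrt_le_sqrt (by linarith)
    have hp : 0 < √(a ^ 2 + δ / 2) := by positivity
    have h4 := hΓ.antitone (mem_Ioi.2 hp) (mem_Ioi.2 (hp.trans_le h3)) h3
    have h5 := hΓ.antitone (mem_Ioi.2 hw0) (mem_Ioi.2 ha) hw.2.le
    have h6 := hΓ.antitone (mem_Ioi.2 ha) (mem_Ioi.2 hp) (Real.le_sqrt_of_sq_le (by linarith))
    linarith [h w hw0]
  have hiter : ∀ a, 0 < a → ∀ n : ℕ, Γ √(a ^ 2 + n * (δ / 2)) = Γ a := by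
    intro a ha n
    induction n with
    | zero => simp [Real.sqrt_sq ha.le]
    | succ n ih =>
      have := hstep √(a ^ 2 + n * (δ / 2)) (by positivity)
      rw [Real.sq_sqrt (by positivity)] at this
      rw [← ih, ← this]
      congr 2; push_cast; ring
  have hconst : ∀ a b, 0 < a → a ≤ b → Γ b = Γ a := by
    intro a b ha hab
    obtain ⟨n, hn⟩ := exists_nat_gt ((b ^ 2) / (δ / 2))
    rw [div_lt_iff₀ (by linarith)] at hn
    refine le_antisymm (hΓ.antitone (mem_Ioi.2 ha) (mem_Ioi.2 (ha.trans_le hab)) hab) ?_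
    rw [← hiter a ha n]
    exact hΓ.antitone (mem_Ioi.2 (ha.trans_le hab)) (mem_Ioi.2 (by positivity))
      (Real.le_sqrt_of_sq_le (by nlinarith))
  -- A constant that is integrable on a half-line is zero, against the mass `1 / 2`.
  have hnull : ∀ a, a ∈ Ioi (0 : ℝ) → Γ a = 0 := by
    intro a ha
    have h1 : IntegrableOn (fun _ : ℝ => Γ a) (Ici a) :=
      (hΓ.integrable.mono_set (Ici_subset_Ioi.2 ha)).congr_fun
        (fun x hx => hconst a x ha (mem_Ici.1 hx)) measurableSet_Ici
    rw [integrableOn_const_iff] at h1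
    simpa using h1
  have := hΓ.mass
  rw [setIntegral_congr_fun measurableSet_Ioi hnull] at this
  norm_num at this

/-! ### Primitives of integrable functions: null images, quadratic increments, good pairs of points.
-/

lemma abs_integral_le_integral_abs_sub {E : ℝ → ℝ} (hE : Integrable E) (x y : ℝ) :
    |∫ s in x..y, E s| ≤ |(∫ s in (0 : ℝ)..y, |E s|) - (∫ s in (0 : ℝ)..x, |E s|)| := by
  rw [intervalIntegral.integral_interval_sub_left hE.abs.intervalIntegrable
    hE.abs.intervalIntegrable]
  exact intervalIntegral.norm_integral_le_abs_integral_norm (f := E)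

/-- An indefinite integral maps null sets to null sets. -/
lemma volume_image_primitive_eq_zero {E : ℝ → ℝ} (hE : Integrable E) {Z : Set ℝ}
    (hZ : volume Z = 0) : volume ((fun x => ∫ s in (0 : ℝ)..x, E s) '' Z) = 0 := by
  set U : ℝ → ℝ := fun x => ∫ s in (0 : ℝ)..x, E s with hU
  have hEa := hE.abs
  have hsub : ∀ a b : ℝ, (∫ s in (0 : ℝ)..b, |E s|) - ∫ s in (0 : ℝ)..a, |E s|
      = ∫ s in a..b, |E s| := fun a b =>
    intervalIntegral.integral_interval_sub_left hEa.intervalIntegrable hEa.intervalIntegrable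
  let ν : StieltjesFunction ℝ :=
    { toFun := fun x => ∫ s in (0 : ℝ)..x, |E s|
      mono' := fun a b hab => by
        have := intervalIntegral.integral_nonneg hab (μ := volume) (f := fun s => |E s|)
          fun s _ => abs_nonneg _
        have h2 := hsub a b
        linarith
      right_continuous' := fun x => by
        have := (intervalIntegral.continuous_primitive
          (fun a b => hEa.intervalIntegrable) 0).continuousAt (x := x)
        exact this.continuousWithinAt }
  have hν : ν.measure = volume.withDensity fun s => ENNReal.ofReal |E s| := by
    refine Measure.ext_of_Ioc _ _ fun a b hab => ?_
    rw [ν.measure_Ioc, withDensity_apply _ measurableSet_Ioc,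
      ← ofReal_integral_eq_lintegral_ofReal hEa.integrableOn
        (Filter.Eventually.of_forall fun _ => abs_nonneg _),
      ← intervalIntegral.integral_of_le hab.le, ← hsub]
  have hνZ : ν.outer Z = 0 := by
    have : ν.measure Z = 0 := by
      rw [hν]; exact withDensity_absolutelyContinuous _ _ hZ
    rwa [StieltjesFunction.measure] at this
  -- Working with outer measures avoids any measurability of the image. It suffices to compare on
  -- intervals: `U` sends `Ioc a b` into the interval centred at `U a` of radius `ν b - ν a`, whence
  -- the factor 2.
  have hle : OuterMeasure.comap U volume.toOuterMeasure ≤ (2 : ℝ≥0∞) • ν.outer := by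
    rw [StieltjesFunction.outer, OuterMeasure.smul_ofFunction (by simp),
      OuterMeasure.le_ofFunction]
    intro s
    rw [Pi.smul_apply, StieltjesFunction.length_eq, smul_eq_mul,
      ENNReal.mul_iInf_of_ne (by simp) (by simp)]
    refine le_iInf fun a => ?_
    rw [ENNReal.mul_iInf_of_ne (by simp) (by simp)]
    refine le_iInf fun b => ?_
    rw [ENNReal.mul_iInf_of_ne (by simp) (by simp)]
    refine le_iInf fun hs => ?_
    have hs' : s ⊆ Ioc a b := fun x hx => hs ⟨hx, fun h => not_isBot x h⟩
    rw [OuterMeasure.comap_apply]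
    have hsubset : U '' s ⊆ Icc (U a - (ν b - ν a)) (U a + (ν b - ν a)) := by
      rintro _ ⟨x, hx, rfl⟩
      have hx' := hs' hx
      have h1 := abs_integral_le_integral_abs_sub hE a x
      have h2 : U x - U a = ∫ s in a..x, E s :=
        intervalIntegral.integral_interval_sub_left hE.intervalIntegrable hE.intervalIntegrable
      rw [← h2] at h1
      have h3 : ν a ≤ ν x := ν.mono hx'.1.le
      have h4 : ν x ≤ ν b := ν.mono hx'.2
      have h5 : |U x - U a| ≤ |ν x - ν a| := h1
      rw [abs_of_nonneg (sub_nonneg.2 h3)] at h5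
      have := abs_le.1 h5
      constructor <;> linarith
    refine (measure_mono hsubset).trans ?_
    change volume (Icc _ _) ≤ _
    rw [Real.volume_Icc, ← ENNReal.ofReal_ofNat 2, ← ENNReal.ofReal_mul (by norm_num)]
    apply le_of_eq; congr 1; ring
  have := hle Z
  rw [smul_apply, hνZ, smul_zero] at this
  exact le_antisymm this bot_le

/-- The classical fact that quadratic increments force constancy, with increments measured by `ν`
rather than by length and only at points of `G`. The range of `ν` from `ν y` to `ν z` is cut into
`N` equal levels, each level is attained by the intermediate value theorem, and density moves the
point into `G`. Summing `N` terms of order `1 / N²` gives `O(1 / N)`. -/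
lemma eq_of_sub_le_sq {b ν : ℝ → ℝ} {G : Set ℝ} {C y z : ℝ} (hν : Continuous ν)
    (hG : Dense (G ∪ (uIcc y z)ᶜ)) (hy : y ∈ G) (hz : z ∈ G)
    (h : ∀ x ∈ G ∩ uIcc y z, ∀ x' ∈ G ∩ uIcc y z, |b x' - b x| ≤ C * (ν x' - ν x) ^ 2) :
    b y = b z := by
  by_cases hνe : ν y = ν z
  · have := h y ⟨hy, left_mem_uIcc⟩ z ⟨hz, right_mem_uIcc⟩
    rw [hνe] at this
    simp at this
    linarith [sub_eq_zero.1 this]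
  have hyz : y ≠ z := fun h => hνe (by rw [h])
  set T := |ν z - ν y| with hT
  have hTp : 0 < T := abs_pos.2 (sub_ne_zero.2 (Ne.symm hνe))
  have hC : 0 ≤ C := by
    have := (abs_nonneg _).trans (h y ⟨hy, left_mem_uIcc⟩ z ⟨hz, right_mem_uIcc⟩)
    have h2 : 0 < (ν z - ν y) ^ 2 := by
      have := sub_ne_zero.2 (Ne.symm hνe); positivity
    exact nonneg_of_mul_nonneg_left this h2
  have key : ∀ N : ℕ, 0 < N → |b z - b y| ≤ 9 * C * T ^ 2 / N := by
    intro N hN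
    have hNr : (0 : ℝ) < N := by exact_mod_cast hN
    have hpt : ∀ i : ℕ, i ≤ N → ∃ x ∈ G ∩ uIcc y z,
        |ν x - (ν y + i / N * (ν z - ν y))| < T / N ∧ (i = 0 → x = y) ∧ (i = N → x = z) := by
      intro i hi
      rcases Nat.eq_zero_or_pos i with rfl | hi0
      · exact ⟨y, ⟨hy, left_mem_uIcc⟩, by simp; positivity, fun _ => rfl, fun h => by omega⟩
      rcases hi.eq_or_lt with rfl | hiN
      · refine ⟨z, ⟨hz, right_mem_uIcc⟩, ?_, fun h => by omega, fun _ => rfl⟩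
        rw [div_self hNr.ne']; simp; positivity
      have hθ0 : (0 : ℝ) < i / N := by positivity
      have hθ1 : (i : ℝ) / N < 1 := by rw [div_lt_one hNr]; exact_mod_cast hiN
      set m := ν y + i / N * (ν z - ν y) with hm
      have hmem : m ∈ ν '' uIcc y z := by
        refine intermediate_value_uIcc hν.continuousOn ?_
        rw [mem_uIcc]
        rcases lt_or_gt_of_ne hνe with h' | h'
        · left; constructor <;> nlinarith
        · right; constructor <;> nlinarith
      obtain ⟨x₀, hx₀, hx₀m⟩ := hmem
      have hne1 : m ≠ ν y := by
        rw [hm]; intro h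
        have : (i : ℝ) / N * (ν z - ν y) = 0 := by linarith
        exact (mul_ne_zero hθ0.ne' (sub_ne_zero.2 (Ne.symm hνe))) this
      have hne2 : m ≠ ν z := by
        rw [hm]; intro h
        have : (1 - (i : ℝ) / N) * (ν z - ν y) = 0 := by linarith
        exact (mul_ne_zero (by linarith) (sub_ne_zero.2 (Ne.symm hνe))) this
      have hx₀' : x₀ ∈ Ioo (min y z) (max y z) := by
        rw [uIcc, mem_Icc] at hx₀
        refine ⟨lt_of_le_of_ne hx₀.1 ?_, lt_of_le_of_ne hx₀.2 ?_⟩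
        · rintro rfl; rcases min_choice y z with h | h <;> rw [h] at hx₀m <;> tauto
        · rintro rfl; rcases max_choice y z with h | h <;> rw [h] at hx₀m <;> tauto
      have hopen : IsOpen (Ioo (min y z) (max y z) ∩ ν ⁻¹' Metric.ball m (T / N)) :=
        isOpen_Ioo.inter (Metric.isOpen_ball.preimage hν)
      obtain ⟨x, hx, hxG⟩ := hG.inter_open_nonempty _ hopen
        ⟨x₀, hx₀', by simp [hx₀m]; positivity⟩
      have hxu : x ∈ uIcc y z := Ioo_subset_Icc_self hx.1
      refine ⟨x, ⟨hxG.resolve_right fun h => h hxu, hxu⟩, ?_, fun h => by omega,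
        fun h => by omega⟩
      simpa [Real.dist_eq] using hx.2
    choose! p hpG hpν hp0 hpN using hpt
    have hsum : |b (p N) - b (p 0)| ≤ ∑ i ∈ Finset.range N, |b (p (i + 1)) - b (p i)| := by
      rw [← Finset.sum_range_sub (fun i => b (p i))]
      exact Finset.abs_sum_le_sum_abs _ _
    rw [hp0 0 (Nat.zero_le _) rfl, hpN N le_rfl rfl] at hsum
    refine hsum.trans ?_
    -- The 3 counts one step `T / N` between consecutive levels and an error of at most `T / N` at
    -- each of the two chosen points.
    have hterm : ∀ i ∈ Finset.range N, |b (p (i + 1)) - b (p i)| ≤ C * (3 * T / N) ^ 2 := by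
      intro i hi
      have hi' : i < N := Finset.mem_range.1 hi
      refine (h _ (hpG i hi'.le) _ (hpG (i + 1) hi')).trans ?_
      refine mul_le_mul_of_nonneg_left ?_ hC
      rw [← sq_abs (ν _ - ν _)]
      refine pow_le_pow_left₀ (abs_nonneg _) ?_ 2
      have h1 := hpν i hi'.le
      have h2 := hpν (i + 1) hi'
      have h3 : |1 / N * (ν z - ν y)| = T / N := by
        rw [abs_mul, abs_of_pos (by positivity)]; ring
      have h4 : ν (p (i + 1)) - ν (p i)
          = (ν (p (i + 1)) - (ν y + (i + 1 : ℕ) / N * (ν z - ν y)))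
            - (ν (p i) - (ν y + i / N * (ν z - ν y))) + 1 / N * (ν z - ν y) := by
        push_cast; ring
      rw [h4]
      refine (abs_add_le _ _).trans ?_
      have h5 := abs_sub (ν (p (i + 1)) - (ν y + (i + 1 : ℕ) / N * (ν z - ν y)))
        (ν (p i) - (ν y + i / N * (ν z - ν y)))
      have h6 : 3 * T / N = T / N + T / N + T / N := by ring
      linarith
    refine (Finset.sum_le_sum hterm).trans (le_of_eq ?_)
    rw [Finset.sum_const, Finset.card_range, nsmul_eq_mul]
    field_simp; norm_num
  by_contra hne
  have hpos : 0 < |b z - b y| := abs_pos.2 (sub_ne_zero.2 (Ne.symm hne))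
  obtain ⟨N, hN⟩ := exists_nat_gt (9 * C * T ^ 2 / |b z - b y|)
  have hN0 : 0 < N := by
    have : (0 : ℝ) < N := lt_of_le_of_lt (by positivity) hN
    exact_mod_cast this
  have := key N hN0
  rw [div_lt_iff₀ hpos] at hN
  rw [le_div_iff₀ (by exact_mod_cast hN0)] at this
  linarith

/-- If a continuous function maps the complement of `G` to a null set and is larger at `b` than at
`a`, it has two points of `G` with `U y < U z` and `U ≤ U z` in between. -/
lemma exists_good_pair_of_lt {U : ℝ → ℝ} (hU : Continuous U) {G : Set ℝ} {a b : ℝ} (hab : a < b)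
    (hnull : volume (U '' (Icc a b \ G)) = 0) (hlt : U a < U b) :
    ∃ y ∈ G ∩ Icc a b, ∃ z ∈ G ∩ Icc a b, U y < U z ∧ ∀ x ∈ uIcc y z, U x ≤ U z := by
  -- First hitting point of the level `u`: before it, `U` stays below `u`.
  have hfirst : ∀ u ∈ Ioo (U a) (U b), ∃ x ∈ Icc a b, U x = u ∧ ∀ x' ∈ Icc a b, x' < x →
      U x' < u := by
    intro u hu
    have hc : IsCompact (Icc a b ∩ U ⁻¹' Ici u) :=
      isCompact_Icc.inter_right (isClosed_Ici.preimage hU)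
    obtain ⟨x, hx, hmin⟩ := hc.exists_isLeast ⟨b, ⟨hab.le, le_rfl⟩, hu.2.le⟩
    refine ⟨x, hx.1, ?_, fun x' hx' hlt' => ?_⟩
    · obtain ⟨x', hx', hx'u⟩ := intermediate_value_Icc hx.1.1 hU.continuousOn
        (show u ∈ Icc (U a) (U x) from ⟨hu.1.le, hx.2⟩)
      have : x ≤ x' := hmin ⟨⟨hx'.1, hx'.2.trans hx.1.2⟩, hx'u.ge⟩
      rw [le_antisymm this hx'.2, hx'u]
    · by_contra hcon
      exact absurd (hmin ⟨hx', not_lt.1 hcon⟩) (not_le.2 hlt')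
  -- An interval of levels is not contained in the null image of the bad points, so some level has
  -- only good preimages, in particular a good first hitting point.
  have hgood : ∀ p q : ℝ, U a ≤ p → p < q → q ≤ U b →
      ∃ x ∈ G ∩ Icc a b, U x ∈ Ioo p q ∧ ∀ x' ∈ Icc a b, x' < x → U x' < U x := by
    intro p q hp hpq hq
    obtain ⟨u, hu, hun⟩ : ∃ u ∈ Ioo p q, u ∉ U '' (Icc a b \ G) := by
      by_contra hcon
      push Not at hcon
      have := measure_mono_null hcon hnull
      simp at this
      linarith
    obtain ⟨x, hx, hxu, hmin⟩ := hfirst u ⟨hp.trans_lt hu.1, hu.2.trans_le hq⟩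
    refine ⟨x, ⟨?_, hx⟩, hxu ▸ hu, hxu ▸ hmin⟩
    by_contra hxG
    exact hun ⟨x, ⟨hx, hxG⟩, hxu⟩
  obtain ⟨y, hy, hyU, hymin⟩ := hgood (U a) ((U a + U b) / 2) le_rfl (by linarith) (by linarith)
  obtain ⟨z, hz, hzU, hzmin⟩ := hgood ((U a + U b) / 2) (U b) (by linarith) (by linarith) le_rfl
  have hyz : U y < U z := hyU.2.trans hzU.1
  have hle : y ≤ z := by
    by_contra h
    exact absurd (hymin z hz.2 (not_le.1 h)) (not_lt.2 hyz.le)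
  refine ⟨y, hy, z, hz, hyz, fun x hx => ?_⟩
  rw [uIcc_of_le hle] at hx
  rcases hx.2.eq_or_lt with rfl | h
  · exact le_rfl
  · exact (hzmin x ⟨hy.2.1.trans hx.1, hx.2.trans hz.2.2⟩ h).le

/-- The decreasing case reduces to the increasing one by the reflection `x ↦ a + b - x`; `uIcc` in
the conclusion makes the order of `y` and `z` irrelevant. -/
lemma exists_good_pair_of_ne {U : ℝ → ℝ} (hU : Continuous U) {G : Set ℝ} {a b : ℝ} (hab : a < b)
    (hnull : volume (U '' (Icc a b \ G)) = 0) (hne : U a ≠ U b) :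
    ∃ y ∈ G ∩ Icc a b, ∃ z ∈ G ∩ Icc a b, U y < U z ∧ ∀ x ∈ uIcc y z, U x ≤ U z := by
  rcases lt_or_gt_of_ne hne with hlt | hlt
  · exact exists_good_pair_of_lt hU hab hnull hlt
  have hmem : ∀ x, a + b - x ∈ Icc a b ↔ x ∈ Icc a b := fun x => by
    simp only [mem_Icc]; constructor <;> rintro ⟨h1, h2⟩ <;> constructor <;> linarith
  obtain ⟨y, hy, z, hz, hyz, h⟩ := exists_good_pair_of_lt (U := fun x => U (a + b - x))
    (G := {x | a + b - x ∈ G}) (by fun_prop) hab (measure_mono_null (by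
      rintro _ ⟨x, ⟨hx, hxG⟩, rfl⟩
      exact ⟨a + b - x, ⟨(hmem x).2 hx, hxG⟩, rfl⟩) hnull) (by simpa using hlt)
  refine ⟨a + b - y, ⟨hy.1, (hmem y).2 hy.2⟩, a + b - z, ⟨hz.1, (hmem z).2 hz.2⟩, hyz,
    fun x hx => ?_⟩
  have := h (a + b - x) (by
    rw [mem_uIcc] at hx ⊢
    rcases hx with hx | hx
    · right; constructor <;> linarith [hx.1, hx.2]
    · left; constructor <;> linarith [hx.1, hx.2])
  simpa using this

/-! ### Smooth energy shells and estimates for shell averages, uniform over profiles. -/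

/-- A smooth bump function supported in `(0, 1 / (j + 1))`. -/
noncomputable def shellContDiffBump (j : ℕ) : ContDiffBump (1 / (2 * (j + 1)) : ℝ) where
  rIn := 1 / (8 * (j + 1))
  rOut := 1 / (4 * (j + 1))
  rIn_pos := by positivity
  rIn_lt_rOut := one_div_lt_one_div_of_lt (by positivity) (by linarith [j.cast_nonneg (α := ℝ)])

/-- The `i`-th derivative of a normalized bump supported in the energy shell
`(0, 1 / (j + 1))`. -/
noncomputable def shellBump (j i : ℕ) : ℝ → ℝ :=
  iteratedDeriv i ((shellContDiffBump j).normed volume)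

lemma contDiff_shellBump (j i : ℕ) : ContDiff ℝ ∞ (shellBump j i) := by
  have h : ContDiff ℝ ∞ ((shellContDiffBump j).normed volume) :=
    (shellContDiffBump j).contDiff_normed
  rw [shellBump, iteratedDeriv_eq_iterate]
  exact h.iterate_deriv i

lemma deriv_shellBump (j i : ℕ) : deriv (shellBump j i) = shellBump j (i + 1) := by
  rw [shellBump, shellBump, iteratedDeriv_succ]

lemma hasDerivAt_shellBump (j i : ℕ) (s : ℝ) :
    HasDerivAt (shellBump j i) (shellBump j (i + 1) s) s := by
  rw [← deriv_shellBump]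
  exact ((contDiff_shellBump j i).differentiable (by simp) s).hasDerivAt

lemma support_shellBump (j i : ℕ) {s : ℝ} (h : shellBump j i s ≠ 0) :
    s ∈ Ioo 0 (1 / ((j : ℝ) + 1)) := by
  have h1 : tsupport (shellBump j i) ⊆ tsupport ((shellContDiffBump j).normed volume) := by
    clear h; induction i with
    | zero => simp [shellBump]
    | succ i ih =>
      rw [← deriv_shellBump]
      exact (closure_minimal support_deriv_subset (isClosed_tsupport _)).trans ih
  have h2 := h1 (subset_tsupport _ h)
  rw [ContDiffBump.tsupport_normed_eq, Metric.mem_closedBall, Real.dist_eq, abs_le] at h2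
  have hj : (0 : ℝ) < j + 1 := by positivity
  have e1 : (1 : ℝ) / (4 * (j + 1)) = (1 / (j + 1)) / 4 := by field_simp
  have e2 : (1 : ℝ) / (2 * (j + 1)) = (1 / (j + 1)) / 2 := by field_simp
  have hp : (0 : ℝ) < 1 / (j + 1) := by positivity
  simp only [shellContDiffBump, e1, e2] at h2
  constructor <;> linarith

lemma shellBump_nonneg (j : ℕ) (s : ℝ) : 0 ≤ shellBump j 0 s := by
  simpa [shellBump] using (shellContDiffBump j).nonneg_normed s

lemma integral_shellBump (j : ℕ) : ∫ s, shellBump j 0 s = 1 := by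
  simpa [shellBump] using (shellContDiffBump j).integral_normed (μ := volume)

lemma shellBump_eq_zero (j i : ℕ) {s : ℝ} (h : s ≤ 0 ∨ 1 ≤ s) : shellBump j i s = 0 := by
  by_contra hne
  have := support_shellBump j i hne
  have h1 : (1 : ℝ) / (j + 1) ≤ 1 := by
    rw [div_le_one (by positivity)]; linarith [j.cast_nonneg (α := ℝ)]
  rcases h with h | h <;> linarith [this.1, this.2]

lemma hasCompactSupport_shellBump (j i : ℕ) : HasCompactSupport (shellBump j i) :=
  HasCompactSupport.of_support_subset_isCompact (isCompact_Icc (a := (0 : ℝ)) (b := 1)) fun _ hs =>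
    ⟨le_of_lt (not_le.1 fun h => hs (shellBump_eq_zero j i (Or.inl h))),
      le_of_lt (not_le.1 fun h => hs (shellBump_eq_zero j i (Or.inr h)))⟩

lemma exists_bound_shellBump (j i : ℕ) : ∃ A, 0 ≤ A ∧ ∀ s, |shellBump j i s| ≤ A := by
  obtain ⟨A, hA⟩ := (contDiff_shellBump j i).continuous.bounded_above_of_compact_support
    (hasCompactSupport_shellBump j i)
  exact ⟨A, (norm_nonneg _).trans (hA 0), hA⟩

/-- The average of a profile over the energy shell starting at `r`, weighted by `shellBump j i`. -/
noncomputable def shellAverage (Γ : ℝ → ℝ) (j i : ℕ) (r : ℝ) : ℝ :=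
  energyAverage Γ fun s => shellBump j i (s - r)

lemma abs_shellBump_sub_le {j i : ℕ} {A : ℝ} (hA : ∀ s, |shellBump j (i + 1) s| ≤ A) (s s' : ℝ) :
    |shellBump j i s - shellBump j i s'| ≤ A * |s - s'| := by
  have := Convex.norm_image_sub_le_of_norm_hasDerivWithin_le (f := shellBump j i) (s := univ)
    (fun x _ => (hasDerivAt_shellBump j i x).hasDerivWithinAt) (fun x _ => hA x) convex_univ
    (mem_univ s') (mem_univ s)
  simpa using this

lemma abs_shellBump_taylor_le {j i : ℕ} {A : ℝ} (hA : ∀ s, |shellBump j (i + 2) s| ≤ A)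
    (s s' : ℝ) :
    |shellBump j i s' - shellBump j i s - shellBump j (i + 1) s * (s' - s)| ≤ A * (s' - s) ^ 2 := by
  have := Convex.norm_image_sub_le_of_norm_hasDerivWithin_le
    (f := fun x => shellBump j i x - shellBump j (i + 1) s * x)
    (f' := fun x => shellBump j (i + 1) x - shellBump j (i + 1) s) (s := uIcc s s')
    (C := A * |s' - s|)
    (fun x _ => ((hasDerivAt_shellBump j i x).sub
      (by simpa using (hasDerivAt_id x).const_mul _)).hasDerivWithinAt) (fun x hx => ?_)
    (convex_uIcc s s') left_mem_uIcc right_mem_uIcc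
  · rw [Real.norm_eq_abs, Real.norm_eq_abs, mul_assoc, abs_mul_abs_self] at this
    convert this using 2 <;> ring
  · refine (abs_shellBump_sub_le hA x s).trans ?_
    exact mul_le_mul_of_nonneg_left (abs_sub_left_of_mem_uIcc hx) ((abs_nonneg _).trans (hA 0))

section Estimates

variable {Γ : ℝ → ℝ}

lemma IsProfile.integrable_shell (hΓ : IsProfile Γ) (j i : ℕ) (r : ℝ) :
    IntegrableOn (fun w => Γ w * (w * shellBump j i (w ^ 2 / 2 - r))) (Ioi 0) := by
  obtain ⟨A, -, hA⟩ := exists_bound_shellBump j i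
  exact hΓ.integrable_energy (κ := fun s => shellBump j i (s - r)) (R := r + 1)
    ((contDiff_shellBump j i).continuous.comp (by fun_prop)) (fun s => hA _)
    fun s hs => shellBump_eq_zero j i (Or.inr (by linarith))

lemma IsProfile.abs_shellAverage_le (hΓ : IsProfile Γ) {j i : ℕ} {A : ℝ}
    (hA : ∀ s, |shellBump j i s| ≤ A) {r R : ℝ} (hr : r ≤ R) :
    |shellAverage Γ j i r| ≤ A * √(2 * (R + 1)) :=
  hΓ.abs_energyAverage_le (fun s => hA _) fun s hs => shellBump_eq_zero j i (Or.inr (by linarith))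

/-- The regularity in `r` comes entirely from the bump, so the Lipschitz constant does not depend on
`Γ`. -/
lemma IsProfile.abs_shellAverage_sub_le (hΓ : IsProfile Γ) {j i : ℕ} {A : ℝ}
    (hA : ∀ s, |shellBump j (i + 1) s| ≤ A) {r r' R : ℝ} (hr : r ≤ R) (hr' : r' ≤ R) :
    |shellAverage Γ j i r' - shellAverage Γ j i r| ≤ A * |r' - r| * √(2 * (R + 1)) := by
  have h := hΓ.abs_energyAverage_le (κ := fun s => shellBump j i (s - r') - shellBump j i (s - r))
    (A := A * |r' - r|) (R := R + 1) (fun s => ?_) (fun s hs => ?_)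
  · convert h using 2
    rw [shellAverage, shellAverage, energyAverage, energyAverage, energyAverage,
      ← integral_sub (hΓ.integrable_shell j i r') (hΓ.integrable_shell j i r)]
    exact integral_congr_ae (Filter.Eventually.of_forall fun w => by ring)
  · have := abs_shellBump_sub_le hA (s - r') (s - r)
    rwa [show s - r' - (s - r) = -(r' - r) by ring, abs_neg] at this
  · rw [shellBump_eq_zero j i (Or.inr (by linarith)), shellBump_eq_zero j i (Or.inr (by linarith)),
      sub_zero]

/-- Since `r` enters as `s - r`, the `r`-derivative of the `i`-th average is minus the `(i + 1)`-st;
the remainder bound is again independent of `Γ`. -/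
lemma IsProfile.abs_shellAverage_taylor_le (hΓ : IsProfile Γ) {j i : ℕ} {A : ℝ}
    (hA : ∀ s, |shellBump j (i + 2) s| ≤ A) {r r' R : ℝ} (hr : r ≤ R) (hr' : r' ≤ R) :
    |shellAverage Γ j i r' - shellAverage Γ j i r + (r' - r) * shellAverage Γ j (i + 1) r|
      ≤ A * (r' - r) ^ 2 * √(2 * (R + 1)) := by
  have h := hΓ.abs_energyAverage_le (κ := fun s => shellBump j i (s - r') - shellBump j i (s - r)
      + (r' - r) * shellBump j (i + 1) (s - r))
    (A := A * (r' - r) ^ 2) (R := R + 1) (fun s => ?_) (fun s hs => ?_)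
  · convert h using 2
    rw [shellAverage, shellAverage, shellAverage, energyAverage, energyAverage, energyAverage,
      energyAverage, ← integral_sub (hΓ.integrable_shell j i r') (hΓ.integrable_shell j i r),
      ← integral_const_mul]
    refine (integral_add ((hΓ.integrable_shell j i r').sub (hΓ.integrable_shell j i r))
      ((hΓ.integrable_shell j (i + 1) r).const_mul _)).symm.trans ?_
    exact integral_congr_ae (Filter.Eventually.of_forall fun w => by simp only [Pi.sub_apply]; ring)
  · have := abs_shellBump_taylor_le hA (s - r) (s - r')
    rw [show s - r' - (s - r) = -(r' - r) by ring, neg_sq] at this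
    convert this using 2; ring
  · rw [shellBump_eq_zero j i (Or.inr (by linarith)), shellBump_eq_zero j i (Or.inr (by linarith)),
      shellBump_eq_zero j (i + 1) (Or.inr (by linarith))]
    simp

/-- The shell lies at energies below `w² / 2`, where the profile is larger. Together with
`IsProfile.shellAverage_le`, this carries identities between averages back to inequalities between
profiles. The endpoint `r = 0` is allowed here and is needed at a maximum of the potential. -/
lemma IsProfile.le_shellAverage (hΓ : IsProfile Γ) (j : ℕ) {r w : ℝ} (hr : 0 ≤ r) (hw : 0 < w)
    (h : r + 1 / ((j : ℝ) + 1) ≤ w ^ 2 / 2) : Γ w ≤ shellAverage Γ j 0 r := by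
  have hd : (0 : ℝ) < 1 / (j + 1) := by positivity
  refine le_trans ?_ (hΓ.energyAverage_mem (κ := fun s => shellBump j 0 (s - r))
    ((contDiff_shellBump j 0).continuous.comp (by fun_prop)) (fun s => shellBump_nonneg j _)
    (by rw [integral_sub_right_eq_self (shellBump j 0), integral_shellBump]) hr hd
    (fun s hs => ?_)).1
  · exact hΓ.antitone (mem_Ioi.2 (Real.sqrt_pos.2 (by linarith))) hw
      (Real.sqrt_le_iff.2 ⟨hw.le, by linarith⟩)
  · have := support_shellBump j 0 hs
    constructor <;> linarith [this.1, this.2]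

lemma IsProfile.shellAverage_le (hΓ : IsProfile Γ) (j : ℕ) {r w : ℝ} (hr : 0 < r) (hw : 0 < w)
    (h : w ^ 2 / 2 ≤ r) : shellAverage Γ j 0 r ≤ Γ w := by
  have hd : (0 : ℝ) < 1 / (j + 1) := by positivity
  refine le_trans ((hΓ.energyAverage_mem (κ := fun s => shellBump j 0 (s - r))
    ((contDiff_shellBump j 0).continuous.comp (by fun_prop)) (fun s => shellBump_nonneg j _)
    (by rw [integral_sub_right_eq_self (shellBump j 0), integral_shellBump]) hr.le hd
    (fun s hs => ?_)).2 hr) ?_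
  · have := support_shellBump j 0 hs
    constructor <;> linarith [this.1, this.2]
  · exact hΓ.antitone hw (mem_Ioi.2 (Real.sqrt_pos.2 (by linarith)))
      (Real.le_sqrt_of_sq_le (by linarith))

end Estimates

/-! ### The stationary equation at fixed time: characteristics and vanishing of the field. -/

/-- A family of profiles over `(0, 1]` whose energy averages solve `∂ₓ g + E ∂ₛ g = 0`
(in the energy variable `s`, away from `s = 0`). -/
structure IsStationary (E : ℝ → ℝ) (Γ : ℝ → ℝ → ℝ) : Prop where
  integrable : Integrable E
  profile : ∀ᵐ x ∂(volume.restrict (Ioc (0 : ℝ) 1)), IsProfile (Γ x)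
  measurable : ∀ j i r, AEStronglyMeasurable (fun x => shellAverage (Γ x) j i r)
    (volume.restrict (Ioc (0 : ℝ) 1))
  eq_primitive : ∀ j i, ∀ r : ℚ, 0 < r → ∃ C, ∀ᵐ x ∂(volume.restrict (Ioc (0 : ℝ) 1)),
    shellAverage (Γ x) j i r = C + ∫ y in (0 : ℝ)..x, E y * shellAverage (Γ y) j (i + 1) r

section Stationary

variable {E : ℝ → ℝ} {Γ : ℝ → ℝ → ℝ}

lemma IsStationary.integrableOn_mul (h : IsStationary E Γ) (j i : ℕ) (r : ℝ) :
    IntegrableOn (fun y => E y * shellAverage (Γ y) j i r) (Ioc 0 1) := by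
  obtain ⟨A, -, hA⟩ := exists_bound_shellBump j i
  refine Integrable.mul_bdd (c := A * √(2 * (r + 1))) h.integrable.integrableOn
    (h.measurable j i r) ?_
  filter_upwards [h.profile] with x hx
  exact hx.abs_shellAverage_le hA le_rfl

lemma IsStationary.intervalIntegrable_mul (h : IsStationary E Γ) (j i : ℕ) (r : ℝ) {x x' : ℝ}
    (hx : x ∈ Icc (0 : ℝ) 1) (hx' : x' ∈ Icc (0 : ℝ) 1) :
    IntervalIntegrable (fun y => E y * shellAverage (Γ y) j i r) volume x x' := by
  rw [intervalIntegrable_iff]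
  refine (h.integrableOn_mul j i r).mono_set fun y hy => ?_
  rw [uIoc, mem_Ioc] at hy
  exact ⟨(le_min hx.1 hx'.1).trans_lt hy.1, hy.2.trans (max_le hx.2 hx'.2)⟩

/-- The points where the profile is regular and the averages have their continuous values. -/
lemma IsStationary.exists_good_set (h : IsStationary E Γ) : ∃ G ⊆ Ioc (0 : ℝ) 1,
    volume (Ioc (0 : ℝ) 1 \ G) = 0 ∧ (∀ x ∈ G, IsProfile (Γ x)) ∧
    ∀ x ∈ G, ∀ x' ∈ G, ∀ j i, ∀ r : ℝ, 0 ≤ r →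
      shellAverage (Γ x') j i r - shellAverage (Γ x) j i r
        = ∫ y in x..x', E y * shellAverage (Γ y) j (i + 1) r := by
  choose! C hC using h.eq_primitive
  have hae : ∀ᵐ x ∂(volume.restrict (Ioc (0 : ℝ) 1)), x ∈ Ioc (0 : ℝ) 1 ∧ IsProfile (Γ x) ∧
      ∀ j i, ∀ r : ℚ, 0 < r → shellAverage (Γ x) j i r
        = C j i r + ∫ y in (0 : ℝ)..x, E y * shellAverage (Γ y) j (i + 1) r := by
    refine (ae_restrict_mem measurableSet_Ioc).and (h.profile.and ?_)
    refine ae_all_iff.2 fun j => ae_all_iff.2 fun i => ae_all_iff.2 fun r => ?_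
    by_cases hr : 0 < r
    · filter_upwards [hC j i r hr] with x hx _ using hx
    · exact Filter.Eventually.of_forall fun x hr' => absurd hr' hr
  refine ⟨{x | x ∈ Ioc (0 : ℝ) 1 ∧ IsProfile (Γ x) ∧
      ∀ j i, ∀ r : ℚ, 0 < r → shellAverage (Γ x) j i r
        = C j i r + ∫ y in (0 : ℝ)..x, E y * shellAverage (Γ y) j (i + 1) r},
    fun x hx => hx.1, ?_, fun x hx => hx.2.1, ?_⟩
  · have := (ae_restrict_iff' measurableSet_Ioc).1 hae
    rw [ae_iff] at this
    refine measure_mono_null (fun x hx => ?_) this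
    exact fun hcon => hx.2 (hcon hx.1)
  intro x hx x' hx' j i r hr
  have hxI : x ∈ Icc (0 : ℝ) 1 := Ioc_subset_Icc_self hx.1
  have hxI' : x' ∈ Icc (0 : ℝ) 1 := Ioc_subset_Icc_self hx'.1
  have h0 : (0 : ℝ) ∈ Icc (0 : ℝ) 1 := ⟨le_rfl, zero_le_one⟩
  have hrat : ∀ q : ℚ, 0 < q → shellAverage (Γ x') j i q - shellAverage (Γ x) j i q
        = ∫ y in x..x', E y * shellAverage (Γ y) j (i + 1) q := by
    intro q hq
    rw [hx.2.2 j i q hq, hx'.2.2 j i q hq, add_sub_add_left_eq_sub,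
      intervalIntegral.integral_interval_sub_left (h.intervalIntegrable_mul j _ _ h0 hxI')
        (h.intervalIntegrable_mul j _ _ h0 hxI)]
  obtain ⟨A, hA0, hA⟩ := exists_bound_shellBump j (i + 1)
  obtain ⟨B, hB0, hB⟩ := exists_bound_shellBump j (i + 2)
  set S := √(2 * (r + 1 + 1))
  set M := |(∫ y in x..x', |E y|)| with hM
  -- The identity holds for rational `q > 0` outside a single null set. Lipschitz dependence on the
  -- energy carries it to every real `r ≥ 0` from above: `2 * A * S` accounts for the two endpoint
  -- values and `B * S * M` for the integral.
  have hbound : ∀ q : ℚ, r < q → q < r + 1 →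
      |shellAverage (Γ x') j i r - shellAverage (Γ x) j i r
        - ∫ y in x..x', E y * shellAverage (Γ y) j (i + 1) r| ≤ (2 * A * S + B * S * M) * (q - r) := by
    intro q hq hq1
    have hq0 : 0 < q := by exact_mod_cast hr.trans_lt hq
    have e1 := hx.2.1.abs_shellAverage_sub_le hA (r := r) (r' := q) (R := r + 1) (by linarith) hq1.le
    have e2 := hx'.2.1.abs_shellAverage_sub_le hA (r := r) (r' := q) (R := r + 1) (by linarith)
      hq1.le
    rw [abs_of_pos (by linarith : 0 < (q : ℝ) - r)] at e1 e2
    have e3 : |(∫ y in x..x', E y * shellAverage (Γ y) j (i + 1) q)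
        - ∫ y in x..x', E y * shellAverage (Γ y) j (i + 1) r| ≤ B * S * M * (q - r) := by
      rw [← intervalIntegral.integral_sub (h.intervalIntegrable_mul j _ _ hxI hxI')
        (h.intervalIntegrable_mul j _ _ hxI hxI')]
      have : |∫ y in x..x', |E y| * (B * (q - r) * S)| = B * S * M * (q - r) := by
        rw [intervalIntegral.integral_mul_const, abs_mul, abs_of_nonneg (by
          have : 0 ≤ (q : ℝ) - r := by linarith
          positivity : 0 ≤ B * (q - r) * S)]
        ring
      rw [← this]
      refine intervalIntegral.norm_integral_le_abs_of_norm_le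
        (f := fun y => E y * shellAverage (Γ y) j (i + 1) q - E y * shellAverage (Γ y) j (i + 1) r)
        ?_ ((h.integrable.abs.mul_const _).intervalIntegrable)
      have hsub : uIoc x x' ⊆ Ioc (0 : ℝ) 1 := fun y hy => by
        rw [uIoc, mem_Ioc] at hy
        exact ⟨(le_min hxI.1 hxI'.1).trans_lt hy.1, hy.2.trans (max_le hxI.2 hxI'.2)⟩
      filter_upwards [ae_restrict_of_ae_restrict_of_subset hsub h.profile] with y hy
      have e4 := hy.abs_shellAverage_sub_le hB (r := r) (r' := q) (R := r + 1) (by linarith) hq1.le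
      rw [abs_of_pos (by linarith : 0 < (q : ℝ) - r)] at e4
      rw [← mul_sub, norm_mul]
      exact mul_le_mul_of_nonneg_left e4 (abs_nonneg _)
    have e5 := hrat q hq0
    rw [abs_le] at *
    constructor <;> nlinarith [e1.1, e1.2, e2.1, e2.2, e3.1, e3.2]
  by_contra hne
  set D := |shellAverage (Γ x') j i r - shellAverage (Γ x) j i r
        - ∫ y in x..x', E y * shellAverage (Γ y) j (i + 1) r| with hD
  have hDp : 0 < D := abs_pos.2 (sub_ne_zero.2 hne)
  set K := 2 * A * S + B * S * M
  have hK : 0 ≤ K := by positivity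
  obtain ⟨q, hq, hq'⟩ := exists_rat_btwn (show r < r + min 1 (D / (K + 1)) by
    have : 0 < min 1 (D / (K + 1)) := lt_min one_pos (by positivity)
    linarith)
  have h1 := hbound q hq (hq'.trans_le (by linarith [min_le_left 1 (D / (K + 1))]))
  have h2 : (q : ℝ) - r < D / (K + 1) := by linarith [min_le_right 1 (D / (K + 1))]
  rw [lt_div_iff₀ (by linarith)] at h2
  nlinarith

/-- Along a stationary family, averages at constant total energy are constant. -/
lemma IsStationary.shellAverage_eq (h : IsStationary E Γ) {G : Set ℝ} (hG : G ⊆ Ioc (0 : ℝ) 1)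
    (hnull : volume (Ioc (0 : ℝ) 1 \ G) = 0) (hprof : ∀ x ∈ G, IsProfile (Γ x))
    (heq : ∀ x ∈ G, ∀ x' ∈ G, ∀ j i, ∀ r : ℝ, 0 ≤ r →
      shellAverage (Γ x') j i r - shellAverage (Γ x) j i r
        = ∫ y in x..x', E y * shellAverage (Γ y) j (i + 1) r)
    {y z : ℝ} (hy : y ∈ G) (hz : z ∈ G) (j : ℕ) {e : ℝ}
    (hle : ∀ x ∈ uIcc y z, -∫ s in (0 : ℝ)..x, E s ≤ e) :
    shellAverage (Γ y) j 0 (e - -∫ s in (0 : ℝ)..y, E s)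
      = shellAverage (Γ z) j 0 (e - -∫ s in (0 : ℝ)..z, E s) := by
  set U : ℝ → ℝ := fun x => -∫ s in (0 : ℝ)..x, E s with hU
  set ν : ℝ → ℝ := fun x => ∫ s in (0 : ℝ)..x, |E s| with hν
  have hUc : Continuous U :=
    (intervalIntegral.continuous_primitive (fun a b => h.integrable.intervalIntegrable) 0).neg
  have hνc : Continuous ν :=
    intervalIntegral.continuous_primitive (fun a b => h.integrable.abs.intervalIntegrable) 0
  obtain ⟨R, hR⟩ := (isCompact_Icc (a := (0 : ℝ)) (b := 1)).exists_bound_of_continuousOn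
    (f := fun x => e - U x) (by fun_prop)
  obtain ⟨A, hA0, hA⟩ := exists_bound_shellBump j 2
  set S := √(2 * (R + 1))
  -- In `C = A * S * 3`, two units come from freezing the integrand of the transport equation and
  -- one from the Taylor remainder in the energy.
  refine eq_of_sub_le_sq (b := fun x => shellAverage (Γ x) j 0 (e - U x)) (G := G) (ν := ν)
    (C := A * S * 3) hνc ?_ hy hz ?_
  · refine (Measure.dense_of_ae (μ := volume) (p := fun x => x ∈ G ∪ (uIcc y z)ᶜ) ?_)
    rw [ae_iff]
    refine measure_mono_null (fun x hx => ?_) hnull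
    simp only [mem_ofPred_eq, mem_union, mem_compl_iff, not_or, not_not] at hx
    refine ⟨?_, hx.1⟩
    have := hx.2
    rw [mem_uIcc] at this
    have hy1 := hG hy
    have hz1 := hG hz
    rcases this with ⟨h1, h2⟩ | ⟨h1, h2⟩
    exacts [⟨hy1.1.trans_le h1, h2.trans hz1.2⟩, ⟨hz1.1.trans_le h1, h2.trans hy1.2⟩]
  rintro x ⟨hx, hxu⟩ x' ⟨hx', hxu'⟩
  have hxI := Ioc_subset_Icc_self (hG hx)
  have hxI' := Ioc_subset_Icc_self (hG hx')
  set r := e - U x with hr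
  set r' := e - U x' with hr'
  have hr0 : 0 ≤ r := sub_nonneg.2 (hle x hxu)
  have hr0' : 0 ≤ r' := sub_nonneg.2 (hle x' hxu')
  have hrR : r ≤ R := (le_abs_self _).trans (hR x hxI)
  have hrR' : r' ≤ R := (le_abs_self _).trans (hR x' hxI')
  have hdr : r' - r = ∫ s in x..x', E s := by
    have := intervalIntegral.integral_interval_sub_left
      (h.integrable.intervalIntegrable (a := 0) (b := x'))
      (h.integrable.intervalIntegrable (a := 0) (b := x))
    simp only [hr, hr', hU]
    linarith
  set d := |ν x' - ν x| with hd
  have hdrd : |r' - r| ≤ d := by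
    rw [hdr]; exact abs_integral_le_integral_abs_sub h.integrable x x'
  -- The increment along the characteristic is split into a move in `x` at fixed energy `r'`, given
  -- by the equation, and a move from `r` to `r'` at fixed `x`. Since `r' - r = ∫ E`, the two
  -- first-order terms cancel.
  have hT := (hprof x hx).abs_shellAverage_taylor_le (i := 0) hA hrR hrR'
  have hmain : |(∫ s in x..x', E s * shellAverage (Γ s) j 1 r')
      - (r' - r) * shellAverage (Γ x) j 1 r| ≤ (2 * A * S * d) * d := by
    rw [hdr, ← intervalIntegral.integral_mul_const,
      ← intervalIntegral.integral_sub (h.intervalIntegrable_mul j _ _ hxI hxI')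
        (h.integrable.intervalIntegrable.mul_const _)]
    have hdI : |∫ s in x..x', |E s| * (2 * A * S * d)| = (2 * A * S * d) * d := by
      rw [intervalIntegral.integral_mul_const, abs_mul,
        abs_of_nonneg (by positivity : 0 ≤ 2 * A * S * d), mul_comm, hd, hν,
        intervalIntegral.integral_interval_sub_left h.integrable.abs.intervalIntegrable
          h.integrable.abs.intervalIntegrable]
    rw [← hdI]
    refine intervalIntegral.norm_integral_le_abs_of_norm_le
      (f := fun s => E s * shellAverage (Γ s) j 1 r' - E s * shellAverage (Γ x) j 1 r)
      ?_ ((h.integrable.abs.mul_const _).intervalIntegrable)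
    have hsub : uIoc x x' ⊆ Ioc (0 : ℝ) 1 := fun y hy => by
      rw [uIoc, mem_Ioc] at hy
      exact ⟨(le_min hxI.1 hxI'.1).trans_lt hy.1, hy.2.trans (max_le hxI.2 hxI'.2)⟩
    have hGae : ∀ᵐ s ∂(volume.restrict (uIoc x x')), s ∈ G := by
      rw [ae_restrict_iff' measurableSet_uIoc, ae_iff]
      refine measure_mono_null (fun s hs => ?_) hnull
      simp only [mem_ofPred_eq, Classical.not_imp] at hs
      exact ⟨hsub hs.1, hs.2⟩
    filter_upwards [hGae, ae_restrict_mem measurableSet_uIoc] with s hs hsI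
    rw [← mul_sub, norm_mul]
    refine mul_le_mul_of_nonneg_left ?_ (abs_nonneg _)
    -- The equation is used once more, one derivative higher, to control the variation in `x` of the
    -- factor multiplying `E`.
    have e1 : |shellAverage (Γ s) j 1 r' - shellAverage (Γ x) j 1 r'| ≤ A * S * d := by
      rw [heq x hx s hs j 1 r' hr0']
      have hsI' : s ∈ uIcc x x' := uIoc_subset_uIcc hsI
      have : |∫ u in x..s, |E u| * (A * S)| ≤ A * S * d := by
        rw [intervalIntegral.integral_mul_const, abs_mul, abs_of_nonneg (by positivity : 0 ≤ A * S),
          mul_comm, hd, hν,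
        intervalIntegral.integral_interval_sub_left
            h.integrable.abs.intervalIntegrable h.integrable.abs.intervalIntegrable]
        refine mul_le_mul_of_nonneg_left ?_ (by positivity)
        refine intervalIntegral.abs_integral_mono_interval 
          (uIoc_subset_uIoc_of_uIcc_subset_uIcc (uIcc_subset_uIcc_left hsI'))
          (Filter.Eventually.of_forall fun _ => abs_nonneg _) h.integrable.abs.intervalIntegrable
      refine le_trans ?_ this
      refine intervalIntegral.norm_integral_le_abs_of_norm_le
        (f := fun u => E u * shellAverage (Γ u) j (1 + 1) r')
        ?_ ((h.integrable.abs.mul_const _).intervalIntegrable)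
      have hsI2 := Ioc_subset_Icc_self (hG hs)
      have hsub : uIoc x s ⊆ Ioc (0 : ℝ) 1 := fun y hy => by
        rw [uIoc, mem_Ioc] at hy
        exact ⟨(le_min hxI.1 hsI2.1).trans_lt hy.1, hy.2.trans (max_le hxI.2 hsI2.2)⟩
      filter_upwards [ae_restrict_of_ae_restrict_of_subset hsub h.profile] with u hu
      rw [norm_mul]
      exact mul_le_mul_of_nonneg_left (hu.abs_shellAverage_le hA hrR') (abs_nonneg _)
    have e2 := (hprof x hx).abs_shellAverage_sub_le (i := 1) hA hrR hrR'
    have e3 : A * |r' - r| * S ≤ A * S * d := by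
      have := mul_le_mul_of_nonneg_left hdrd (by positivity : 0 ≤ A * S)
      linarith
    calc |shellAverage (Γ s) j 1 r' - shellAverage (Γ x) j 1 r|
        ≤ |shellAverage (Γ s) j 1 r' - shellAverage (Γ x) j 1 r'|
          + |shellAverage (Γ x) j 1 r' - shellAverage (Γ x) j 1 r| := abs_sub_le _ _ _
      _ ≤ 2 * A * S * d := by linarith
  have hsq : (r' - r) ^ 2 ≤ d ^ 2 := by
    rw [← sq_abs (r' - r)]; exact pow_le_pow_left₀ (abs_nonneg _) hdrd 2
  have hsq2 : A * (r' - r) ^ 2 * S ≤ A * S * d ^ 2 := by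
    have := mul_le_mul_of_nonneg_left hsq (by positivity : 0 ≤ A * S)
    linarith
  have hx0 := heq x hx x' hx' j 0 r' hr0'
  rw [← sq_abs (ν x' - ν x), ← hd]
  change |shellAverage (Γ x') j 0 r' - shellAverage (Γ x) j 0 r| ≤ _
  have : shellAverage (Γ x') j 0 r' - shellAverage (Γ x) j 0 r
    = ((∫ s in x..x', E s * shellAverage (Γ s) j 1 r') - (r' - r) * shellAverage (Γ x) j 1 r)
      + (shellAverage (Γ x) j 0 r' - shellAverage (Γ x) j 0 r
        + (r' - r) * shellAverage (Γ x) j (0 + 1) r) := by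
    simp only [zero_add] at hx0 ⊢
    linarith
  rw [this]
  refine (abs_add_le _ _).trans ?_
  nlinarith

/-- The field of a stationary family with constant density vanishes. -/
theorem IsStationary.field_eq_zero (h : IsStationary E Γ) :
    ∀ᵐ x ∂(volume.restrict (Ioc (0 : ℝ) 1)), E x = 0 := by
  obtain ⟨G, hG, hnull, hprof, heq⟩ := h.exists_good_set
  set U : ℝ → ℝ := fun x => -∫ s in (0 : ℝ)..x, E s with hU
  have hUc : Continuous U :=
    (intervalIntegral.continuous_primitive (fun a b => h.integrable.intervalIntegrable) 0).neg
  have hconst : ∀ b ∈ Ioc (0 : ℝ) 1, U b = U 0 := by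
    intro b hb
    by_contra hne
    -- The point `0` is not in `G`, but it is only one more null point.
    have hnull' : volume (Icc 0 b \ G) = 0 := by
      refine measure_mono_null (t := {0} ∪ (Ioc (0 : ℝ) 1 \ G)) (fun x hx => ?_)
        (measure_union_null (by simp) hnull)
      rcases hx.1.1.eq_or_lt with h0 | h0
      · left; exact h0.symm
      · right; exact ⟨⟨h0, hx.1.2.trans hb.2⟩, hx.2⟩
    have himg : volume (U '' (Icc 0 b \ G)) = 0 := by
      have := volume_image_primitive_eq_zero h.integrable.neg hnull'
      simpa only [Pi.neg_apply, intervalIntegral.integral_neg] using this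
    obtain ⟨y, hy, z, hz, hlt, hle⟩ := exists_good_pair_of_ne hUc hb.1 himg (Ne.symm hne)
    have hδ : 0 < U z - U y := sub_pos.2 hlt
    refine (hprof y hy.1).not_shift (hprof z hz.1) hδ fun w hw => ?_
    set δ := U z - U y with hδd
    -- The shell starts within `δ / 2` below the energy of `w` and, for large `j`, ends below it.
    -- Raised by `δ`, it starts at or above `(w² + δ) / 2`. The maximum with `0` keeps the total
    -- energy above the potential along the whole characteristic.
    set r := max 0 (w ^ 2 / 2 - δ / 2)
    have hr : 0 ≤ r := le_max_left _ _
    have hr2 : w ^ 2 / 2 - δ / 2 ≤ r := le_max_right _ _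
    obtain ⟨j, hj⟩ := exists_nat_one_div_lt (show 0 < min (w ^ 2 / 2) (δ / 2) by positivity)
    have hj1 : r + 1 / ((j : ℝ) + 1) ≤ w ^ 2 / 2 := by
      have h1 := min_le_left (w ^ 2 / 2) (δ / 2)
      have h2 := min_le_right (w ^ 2 / 2) (δ / 2)
      have : r ≤ w ^ 2 / 2 - 1 / ((j : ℝ) + 1) := max_le (by linarith) (by linarith)
      linarith
    have key := h.shellAverage_eq hG hnull hprof heq hy.1 hz.1 j (e := U z + r)
      (fun x hx => (hle x hx).trans (by linarith))
    change shellAverage (Γ y) j 0 (U z + r - U y) = shellAverage (Γ z) j 0 (U z + r - U z) at key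
    rw [add_sub_cancel_left, show U z + r - U y = r + δ by rw [hδd]; ring] at key
    calc Γ z w ≤ shellAverage (Γ z) j 0 r := (hprof z hz.1).le_shellAverage j hr hw hj1
      _ = shellAverage (Γ y) j 0 (r + δ) := key.symm
      _ ≤ Γ y √(w ^ 2 + δ) := (hprof y hy.1).shellAverage_le j (by linarith) (by positivity) (by
          rw [Real.sq_sqrt (by positivity)]; linarith)
  have hd := (h.integrable.intervalIntegrable (a := 0) (b := 1)).ae_hasDerivAt_integral
  rw [ae_restrict_iff' measurableSet_Ioc]
  -- The potential is known to be constant only up to `1`, so `1` has no neighbourhood on which to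
  -- differentiate.
  have hne1 : ∀ᵐ x : ℝ, x ≠ 1 := by simp [ae_iff]
  filter_upwards [hd, hne1] with x hx hx1 hxI
  have hder := hx (by rw [uIcc_of_le zero_le_one]; exact Ioc_subset_Icc_self hxI) 0 (by simp)
  have hev : (fun x => ∫ s in (0 : ℝ)..x, E s) =ᶠ[nhds x] fun _ => 0 := by
    filter_upwards [Ioo_mem_nhds hxI.1 (lt_of_le_of_ne hxI.2 hx1)] with b hb
    have := hconst b ⟨hb.1, hb.2.le⟩
    simpa [hU] using this
  exact (hder.congr_of_eventuallyEq hev.symm).unique (hasDerivAt_const x 0)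

end Stationary

/-! ### Weak derivatives on the torus, tested against trigonometric functions. -/

/-- The real trigonometric functions on the torus. -/
noncomputable def trig (k : ℤ × Bool) (x : Torus) : ℝ :=
  if k.2 then (fourier k.1 x).re else (fourier k.1 x).im

/-- The derivative of a function on the torus. -/
noncomputable def torusDeriv (η : Torus → ℝ) (x : Torus) : ℝ :=
  deriv (fun y : ℝ => η (x + (y : Torus))) 0

lemma torusDeriv_coe (η : Torus → ℝ) (x : ℝ) :
    torusDeriv η (x : Torus) = deriv (fun y : ℝ => η (y : Torus)) x := by
  have := deriv_comp_const_add (fun y : ℝ => η (y : Torus)) x 0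
  simpa [torusDeriv] using this

lemma contDiff_trig (k : ℤ × Bool) : ContDiff ℝ ∞ (fun x : ℝ => trig k (x : Torus)) := by
  have h : ContDiff ℝ ∞ (fun x : ℝ => (fourier k.1 (x : Torus) : ℂ)) := by
    simp only [fourier_coe_apply]
    have : ContDiff ℝ ∞ (fun x : ℝ => (x : ℂ)) := Complex.ofRealCLM.contDiff
    exact ((contDiff_const.mul this).div_const _).cexp
  unfold trig
  split_ifs
  · exact Complex.reCLM.contDiff.comp h
  · exact Complex.imCLM.contDiff.comp h

lemma continuous_torus_of_lift {η : Torus → ℝ} (h : Continuous fun x : ℝ => η (x : Torus)) :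
    Continuous η := by
  exact QuotientAddGroup.isOpenQuotientMap_mk.isQuotientMap.continuous_iff.2 h

lemma continuous_torusDeriv {η : Torus → ℝ} (h : ContDiff ℝ ∞ fun x : ℝ => η (x : Torus)) :
    Continuous (torusDeriv η) := by
  refine continuous_torus_of_lift ?_
  simp only [torusDeriv_coe]
  exact h.continuous_deriv (by simp)

lemma integral_torus_eq (u : Torus → ℝ) : ∫ x, u x = ∫ x in (0 : ℝ)..1, u (x : Torus) := by
  rw [← UnitAddCircle.intervalIntegral_preimage 0 u, zero_add]

/-- The quotient map is measure preserving, which gives one direction. For the other, `p` need not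
be measurable: a measurable null superset on `(0, 1]` is pulled back by the measurable section of
the quotient map. -/
lemma ae_torus_iff {p : Torus → Prop} :
    (∀ᵐ x, p x) ↔ ∀ᵐ x : ℝ ∂(volume.restrict (Ioc 0 1)), p (x : Torus) := by
  have h := UnitAddCircle.measurePreserving_mk 0
  rw [zero_add] at h
  constructor
  · intro hp
    exact h.quasiMeasurePreserving.ae hp
  · intro hp
    rw [← h.map_eq]
    rw [ae_iff] at hp ⊢
    let e := AddCircle.measurableEquivIoc (1 : ℝ) 0
    obtain ⟨t, ht, htm, ht0⟩ := exists_measurable_superset_of_null hp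
    have hinj : ∀ x : Torus, ¬ p x → x ∈ (fun y : Torus => (e y : ℝ)) ⁻¹' t := by
      intro x hx
      refine ht ?_
      have : ((e x : ℝ) : Torus) = x := (AddCircle.equivIoc (1 : ℝ) 0).symm_apply_apply x
      simpa [this] using hx
    have hmeas : Measurable (fun y : Torus => (e y : ℝ)) := measurable_subtype_coe.comp e.measurable
    refine measure_mono_null hinj ?_
    rw [Measure.map_apply h.measurable (hmeas htm)]
    refine le_antisymm ((measure_mono_ae ?_).trans_eq ht0) bot_le
    filter_upwards [ae_restrict_mem measurableSet_Ioc] with x hx hxt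
    have hx' : x ∈ Ioc (0 : ℝ) (0 + 1) := by simpa using hx
    have : (e (x : Torus) : ℝ) = x := by
      have := (AddCircle.equivIoc (1 : ℝ) 0).apply_symm_apply ⟨x, hx'⟩
      exact congrArg Subtype.val this
    have hxt' : (e (x : Torus) : ℝ) ∈ t := hxt
    rwa [this] at hxt'

lemma deriv_trig_true (n : ℤ) (x : ℝ) :
    deriv (fun y : ℝ => trig (n, true) (y : Torus)) x
      = (2 * Real.pi * Complex.I * n * fourier n (x : Torus)).re := by
  have h := hasDerivAt_fourier (1 : ℝ) n x
  have h2 := (Complex.reCLM.hasFDerivAt.comp_hasDerivAt x h).deriv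
  simpa [trig, Function.comp_def] using h2

lemma deriv_trig_false (n : ℤ) (x : ℝ) :
    deriv (fun y : ℝ => trig (n, false) (y : Torus)) x
      = (2 * Real.pi * Complex.I * n * fourier n (x : Torus)).im := by
  have h := hasDerivAt_fourier (1 : ℝ) n x
  have h2 := (Complex.imCLM.hasFDerivAt.comp_hasDerivAt x h).deriv
  simpa [trig, Function.comp_def] using h2

/-- A bounded function on `(0, 1]` orthogonal to the derivatives of all trigonometric functions
is constant. -/
lemma ae_eq_const_of_integral_deriv_trig {u : ℝ → ℝ} {C : ℝ}
    (hu : AEStronglyMeasurable u (volume.restrict (Ioc 0 1)))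
    (hC : ∀ᵐ x ∂(volume.restrict (Ioc (0 : ℝ) 1)), |u x| ≤ C)
    (h : ∀ k, ∫ x in (0 : ℝ)..1, u x * deriv (fun y : ℝ => trig k (y : Torus)) x = 0) :
    ∀ᵐ x ∂(volume.restrict (Ioc (0 : ℝ) 1)), u x = ∫ y in (0 : ℝ)..1, u y := by
  have hui : IntegrableOn u (Ioc 0 1) :=
    Integrable.of_bound hu C hC
  have huc : IntervalIntegrable (fun x => (u x : ℂ)) volume 0 1 := by
    rw [intervalIntegrable_iff_integrableOn_Ioc_of_le zero_le_one]
    exact hui.ofReal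
  have hcont : ∀ n : ℤ, Continuous fun x : ℝ => (fourier n (x : Torus) : ℂ) := fun n =>
    (fourier n).continuous.comp (AddCircle.continuous_mk' 1)
  have hmulint : ∀ n : ℤ, IntervalIntegrable (fun x : ℝ => (u x : ℂ) * fourier n (x : Torus))
      volume 0 1 := fun n => huc.mul_continuousOn (hcont n).continuousOn
  -- Differentiating a character multiplies it by `2πin`, which is nonzero for `n ≠ 0`; the real and
  -- imaginary parts are the two real test functions.
  have hcoef : ∀ n : ℤ, n ≠ 0 → ∫ x in (0 : ℝ)..1, (u x : ℂ) * fourier n (x : Torus) = 0 := by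
    intro n hn
    have h1 : ∫ x in (0 : ℝ)..1, (u x : ℂ) * (2 * Real.pi * Complex.I * n * fourier n (x : Torus))
        = 0 := by
      have hint : IntervalIntegrable (fun x : ℝ => (u x : ℂ) *
          (2 * Real.pi * Complex.I * n * fourier n (x : Torus))) volume 0 1 :=
        huc.mul_continuousOn (continuous_const.mul (hcont n)).continuousOn
      rw [intervalIntegral.integral_of_le zero_le_one]
      rw [intervalIntegrable_iff_integrableOn_Ioc_of_le zero_le_one] at hint
      apply Complex.ext
      · have := integral_re hint
        simp only [Complex.re_ofReal_mul, RCLike.re_eq_complex_re] at this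
        have h0 := h (n, true)
        rw [intervalIntegral.integral_of_le zero_le_one] at h0
        simp only [deriv_trig_true] at h0
        rw [← this, h0, Complex.zero_re]
      · have := integral_im hint
        simp only [Complex.im_ofReal_mul, RCLike.im_eq_complex_im] at this
        have h0 := h (n, false)
        rw [intervalIntegral.integral_of_le zero_le_one] at h0
        simp only [deriv_trig_false] at h0
        rw [← this, h0, Complex.zero_im]
    have h2 : ∀ x : ℝ, (u x : ℂ) * (2 * Real.pi * Complex.I * n * fourier n (x : Torus))
        = (2 * Real.pi * Complex.I * n) * ((u x : ℂ) * fourier n (x : Torus)) := fun x => by ring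
    simp_rw [h2] at h1
    rw [intervalIntegral.integral_const_mul] at h1
    refine (mul_eq_zero.1 h1).resolve_left ?_
    have : (n : ℂ) ≠ 0 := by exact_mod_cast hn
    have := Real.pi_ne_zero
    simp [*]
  set c := ∫ y in (0 : ℝ)..1, u y with hc
  set f : ℝ → ℂ := fun x => (u x : ℂ) - c with hf
  have hfm : MemLp f 2 (volume.restrict (Ioc 0 1)) := by
    refine MemLp.of_bound (C := C + |c|) ?_ ?_
    · exact (Complex.continuous_ofReal.comp_aestronglyMeasurable hu).sub aestronglyMeasurable_const
    · filter_upwards [hC] with x hx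
      refine (norm_sub_le _ _).trans ?_
      rw [Complex.norm_real, Complex.norm_real]
      exact add_le_add hx le_rfl
  have hfc : ∀ n, fourierCoeffOn zero_lt_one f n = 0 := by
    intro n
    rw [fourierCoeffOn_eq_integral]
    have e : ∀ x : ℝ, fourier (-n) (x : AddCircle ((1 : ℝ) - 0)) • f x
        = (u x : ℂ) * fourier (-n) (x : Torus) - c * fourier (-n) (x : Torus) := by
      intro x
      have : fourier (-n) (x : AddCircle ((1 : ℝ) - 0)) = fourier (-n) (x : Torus) := by
        simp
      rw [smul_eq_mul, this, hf]; ring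
    simp_rw [e]
    have hci : IntervalIntegrable (fun x : ℝ => (c : ℂ) * fourier (-n) (x : Torus)) volume 0 1 :=
      (continuous_const.mul (hcont _)).intervalIntegrable _ _
    rw [intervalIntegral.integral_sub (hmulint _) hci, intervalIntegral.integral_const_mul]
    rcases eq_or_ne n 0 with rfl | hn
    · simp [hc, intervalIntegral.integral_ofReal]
    · rw [hcoef (-n) (neg_ne_zero.2 hn)]
      have : ∫ x in (0 : ℝ)..1, (fourier (-n) (x : Torus) : ℂ) = 0 := by
        have e1 := UnitAddCircle.intervalIntegral_preimage 0
          (fun x : Torus => (fourier (-n) x : ℂ))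
        rw [zero_add] at e1
        have e2 : fourierCoeff (T := 1) (fun _ : Torus => (1 : ℂ)) n
            = ∫ x in (0 : ℝ)..1, (fourier (-n) (x : Torus) : ℂ) := by
          rw [fourierCoeff_eq_intervalIntegral _ _ 0]; simp
        have e3 := fourierCoeff_fourier (T := 1) 0
        have e4 : ⇑(fourier 0 : C(AddCircle (1 : ℝ), ℂ)) = fun _ => (1 : ℂ) := by
          funext x; simp
        rw [← e2, ← e4, e3]
        simp [hn]
      rw [this]; simp
  -- By Parseval, `u - c` has zero `L²` norm because all its Fourier coefficients vanish.
  have hs := hasSum_sq_fourierCoeffOn zero_lt_one hfm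
  simp only [hfc] at hs
  have hz := hs.unique (a₂ := 0) (by simp)
  rw [intervalIntegral.integral_of_le zero_le_one] at hz
  simp only [sub_zero, inv_one, one_smul] at hz
  have hz2 := (integral_eq_zero_iff_of_nonneg (fun x => by positivity)
    (hfm.integrable_norm_pow (by norm_num))).1 hz
  filter_upwards [hz2] with x hx
  have : f x = 0 := by simpa using hx
  have h3 : (u x : ℂ) = (c : ℂ) := sub_eq_zero.1 this
  exact_mod_cast h3

/-- Integration by parts for absolutely continuous functions; the primitive has derivative `φ` only
almost everywhere. -/
lemma integral_primitive_mul_deriv {φ η : ℝ → ℝ} (hφ : IntervalIntegrable φ volume 0 1)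
    (hη : ContDiff ℝ ∞ η) :
    ∫ x in (0 : ℝ)..1, (∫ y in (0 : ℝ)..x, φ y) * deriv η x
      = (∫ y in (0 : ℝ)..1, φ y) * η 1 - ∫ x in (0 : ℝ)..1, φ x * η x := by
  have hP := hφ.absolutelyContinuousOnInterval_intervalIntegral (c := 0) (by simp)
  have hA : AbsolutelyContinuousOnInterval η 0 1 :=
    ContDiffOn.absolutelyContinuousOnInterval (hη.of_le (by simp)).contDiffOn
  rw [hP.integral_mul_deriv_eq_deriv_mul hA]
  simp only [intervalIntegral.integral_same, zero_mul, sub_zero]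
  congr 1
  refine intervalIntegral.integral_congr_ae ?_
  filter_upwards [hφ.ae_hasDerivAt_integral] with x hx hxI
  rw [(hx (uIoc_subset_uIcc hxI) 0 (by simp)).deriv]

/-- A weak derivative on the torus is a derivative almost everywhere in the integrated sense. -/
lemma ae_eq_primitive_of_trig {u φ : ℝ → ℝ} {C : ℝ}
    (hu : AEStronglyMeasurable u (volume.restrict (Ioc 0 1)))
    (hC : ∀ᵐ x ∂(volume.restrict (Ioc (0 : ℝ) 1)), |u x| ≤ C)
    (hφ : IntegrableOn φ (Ioc 0 1))
    (h : ∀ k, ∫ x in (0 : ℝ)..1, (u x * deriv (fun y : ℝ => trig k (y : Torus)) x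
      + φ x * trig k (x : Torus)) = 0) :
    ∃ c, ∀ᵐ x ∂(volume.restrict (Ioc (0 : ℝ) 1)), u x = c + ∫ y in (0 : ℝ)..x, φ y := by
  have hφ' : IntervalIntegrable φ volume 0 1 :=
    (intervalIntegrable_iff_integrableOn_Ioc_of_le zero_le_one).2 hφ
  have hui : IntervalIntegrable u volume 0 1 :=
    (intervalIntegrable_iff_integrableOn_Ioc_of_le zero_le_one).2 (Integrable.of_bound hu C hC)
  have hd : ∀ k, Continuous (deriv fun y : ℝ => trig k (y : Torus)) := fun k =>
    (contDiff_trig k).continuous_deriv (by simp)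
  -- The constant test function is among the trigonometric ones. It shows that the primitive of `φ`
  -- is periodic, which removes the boundary term below.
  have htot : ∫ y in (0 : ℝ)..1, φ y = 0 := by
    have := h (0, true)
    have e : (fun y : ℝ => trig (0, true) (y : Torus)) = fun _ => 1 := by
      ext y; simp [trig]
    simp only [e] at this
    simpa [trig] using this
  have hPc : ContinuousOn (fun x => ∫ y in (0 : ℝ)..x, φ y) (uIcc 0 1) :=
    (hφ'.absolutelyContinuousOnInterval_intervalIntegral (c := 0) (by simp)).continuousOn
  have hPc' : ContinuousOn (fun x => ∫ y in (0 : ℝ)..x, φ y) (Icc 0 1) := by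
    rwa [uIcc_of_le zero_le_one] at hPc
  obtain ⟨B, hB⟩ := isCompact_Icc.exists_bound_of_continuousOn hPc'
  refine ⟨_, (ae_eq_const_of_integral_deriv_trig (u := fun x => u x - ∫ y in (0 : ℝ)..x, φ y)
    (C := C + B) (hu.sub ((hPc'.mono Ioc_subset_Icc_self).aestronglyMeasurable measurableSet_Ioc))
    ?_ fun k => ?_).mono fun x hx => sub_eq_iff_eq_add.1 hx⟩
  · filter_upwards [hC, ae_restrict_mem measurableSet_Ioc] with x hx hxI
    exact (abs_sub _ _).trans (add_le_add hx (hB x (Ioc_subset_Icc_self hxI)))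
  · simp_rw [sub_mul]
    have hPi : IntervalIntegrable (fun x => (∫ y in (0 : ℝ)..x, φ y)
        * deriv (fun y : ℝ => trig k (y : Torus)) x) volume 0 1 :=
      (hPc.mul (hd k).continuousOn).intervalIntegrable
    rw [intervalIntegral.integral_sub (hui.mul_continuousOn (hd k).continuousOn) hPi,
      integral_primitive_mul_deriv hφ' (contDiff_trig k), htot]
    have := h k
    rw [intervalIntegral.integral_add (hui.mul_continuousOn (hd k).continuousOn)
      (hφ'.mul_continuousOn (contDiff_trig k).continuous.continuousOn)] at this
    linarith

/-! ### Time slices and functions with vanishing weak derivatives. -/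

/-- Test functions in `C_c^∞((0, ∞))`. -/
structure IsTimeTest (χ : ℝ → ℝ) : Prop where
  smooth : ContDiff ℝ ∞ χ
  compact : HasCompactSupport χ
  support : tsupport χ ⊆ Ioi 0

lemma IsTimeTest.deriv {χ : ℝ → ℝ} (h : IsTimeTest χ) : IsTimeTest (deriv χ) where
  smooth := h.smooth.iterate_deriv 1
  compact := h.compact.deriv
  support := (closure_minimal support_deriv_subset (isClosed_tsupport _)).trans h.support

lemma volume_restrict_spaceTime : (volume : Measure (ℝ × Torus)).restrict spaceTime
    = (volume.restrict (Ioi 0)).prod volume := by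
  rw [spaceTime, Measure.volume_eq_prod, ← Measure.prod_restrict, Measure.restrict_univ]

lemma isOpen_spaceTime : IsOpen spaceTime := isOpen_Ioi.prod isOpen_univ

section Slices

variable {Q : ℝ × Torus → ℝ} (hQ : LocallyIntegrableOn Q spaceTime volume)
include hQ

lemma integrableOn_slab {K : Set ℝ} (hK : IsCompact K) (hK0 : K ⊆ Ioi 0) :
    IntegrableOn Q (K ×ˢ univ) volume :=
  hQ.integrableOn_compact_subset (prod_mono hK0 le_rfl) (hK.prod isCompact_univ)

lemma integrable_time_mul {χ : ℝ → ℝ} (hχ : IsTimeTest χ) :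
    Integrable (fun p : ℝ × Torus => χ p.1 * Q p) volume := by
  obtain ⟨A, hA⟩ := hχ.smooth.continuous.bounded_above_of_compact_support hχ.compact
  have h1 : IntegrableOn (fun p : ℝ × Torus => χ p.1 * Q p) (tsupport χ ×ˢ univ) volume :=
    Integrable.bdd_mul (c := A) (integrableOn_slab hQ hχ.compact hχ.support)
      (hχ.smooth.continuous.comp continuous_fst).aestronglyMeasurable
      (Filter.Eventually.of_forall fun p => hA p.1)
  refine (integrableOn_iff_integrable_of_support_subset fun p hp => ?_).1 h1
  refine ⟨subset_tsupport _ fun h => hp ?_, mem_univ _⟩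
  simp [h]

lemma integral_time_mul {χ : ℝ → ℝ} (hχ : IsTimeTest χ) :
    ∫ p in spaceTime, χ p.1 * Q p = ∫ t in Ioi (0 : ℝ), χ t * ∫ x, Q (t, x) := by
  have h := (integrable_time_mul hQ hχ).restrict (s := spaceTime)
  rw [volume_restrict_spaceTime] at h ⊢
  rw [integral_prod _ h]
  simp only [integral_const_mul]

lemma locallyIntegrableOn_integral_torus :
    LocallyIntegrableOn (fun t => ∫ x, Q (t, x)) (Ioi 0) volume := by
  rw [locallyIntegrableOn_iff isOpen_Ioi.isLocallyClosed]
  intro K hK hKc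
  have h := integrableOn_slab hQ hKc hK
  rw [IntegrableOn, Measure.volume_eq_prod, ← Measure.prod_restrict, Measure.restrict_univ] at h
  exact h.integral_prod_left

/-- Arbitrary time weights localise a space-time identity to almost every time; this is how time
becomes a mere parameter. -/
lemma ae_integral_torus_eq_zero
    (h : ∀ χ, IsTimeTest χ → ∫ p in spaceTime, χ p.1 * Q p = 0) :
    ∀ᵐ t ∂(volume.restrict (Ioi (0 : ℝ))), ∫ x, Q (t, x) = 0 := by
  rw [ae_restrict_iff' measurableSet_Ioi]
  refine isOpen_Ioi.ae_eq_zero_of_integral_contDiff_smul_eq_zero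
    (locallyIntegrableOn_integral_torus hQ) fun χ h1 h2 h3 => ?_
  have hχ : IsTimeTest χ := ⟨h1, h2, h3⟩
  rw [← h χ hχ, integral_time_mul hQ hχ]
  refine (setIntegral_eq_integral_of_forall_compl_eq_zero fun t ht => ?_).symm
  rw [image_eq_zero_of_notMem_tsupport fun h => ht (h3 h)]
  simp

end Slices

lemma exists_isTimeTest_integral_eq_one : ∃ θ : ℝ → ℝ, IsTimeTest θ ∧ ∫ t, θ t = 1 := by
  let b : ContDiffBump (2 : ℝ) := ⟨1 / 2, 1, by norm_num, by norm_num⟩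
  refine ⟨b.normed volume, ⟨b.contDiff_normed, b.hasCompactSupport_normed, ?_⟩, b.integral_normed⟩
  rw [b.tsupport_normed_eq]
  intro t ht
  rw [Metric.mem_closedBall, Real.dist_eq, abs_le] at ht
  have : (-1 : ℝ) ≤ t - 2 := ht.1
  exact mem_Ioi.2 (by linarith)

/-- The primitive from `0` vanishes before the support of `ζ`, and after it because the mean is
zero. -/
lemma IsTimeTest.exists_deriv_eq {ζ : ℝ → ℝ} (hζ : IsTimeTest ζ) (h0 : ∫ t, ζ t = 0) :
    ∃ χ, IsTimeTest χ ∧ _root_.deriv χ = ζ := by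
  have hc := hζ.smooth.continuous
  obtain ⟨a, b, ha, hab⟩ : ∃ a b : ℝ, 0 < a ∧ tsupport ζ ⊆ Icc a b := by
    rcases (tsupport ζ).eq_empty_or_nonempty with he | hne
    · exact ⟨1, 1, one_pos, by simp [he]⟩
    · obtain ⟨a, ha, hamin⟩ := hζ.compact.exists_isLeast hne
      obtain ⟨b, hb, hbmax⟩ := hζ.compact.exists_isGreatest hne
      exact ⟨a, b, hζ.support ha, fun t ht => ⟨hamin ht, hbmax ht⟩⟩
  have hz : ∀ t, t ∉ Icc a b → ζ t = 0 := fun t ht =>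
    image_eq_zero_of_notMem_tsupport fun h => ht (hab h)
  have hder : ∀ t, HasDerivAt (fun t => ∫ s in (0 : ℝ)..t, ζ s) (ζ t) t := fun t =>
    (hc.integral_hasStrictDerivAt 0 t).hasDerivAt
  have hd : _root_.deriv (fun t => ∫ s in (0 : ℝ)..t, ζ s) = ζ := funext fun t => (hder t).deriv
  have hsupp : ∀ t, t ∉ Icc a b → ∫ s in (0 : ℝ)..t, ζ s = 0 := by
    intro t ht
    rcases lt_or_ge t a with hta | hta
    · rw [intervalIntegral.integral_zero_ae]
      refine Filter.Eventually.of_forall fun s hs => hz s fun hs' => ?_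
      rw [uIoc, mem_Ioc] at hs
      have := hs.2.trans (max_le ha.le hta.le)
      have h2 : s = a := le_antisymm this hs'.1
      rcases max_choice 0 t with h | h <;> rw [h] at hs <;> linarith [hs.2]
    · have htb : b < t := by
        by_contra h
        exact ht ⟨hta, not_lt.1 h⟩
      rw [intervalIntegral.integral_of_le (ha.le.trans hta)]
      refine Eq.trans ?_ h0
      refine setIntegral_eq_integral_of_forall_compl_eq_zero fun s hs => hz s fun hs' => hs ?_
      exact ⟨ha.trans_le hs'.1, hs'.2.trans htb.le⟩
  have hts : tsupport (fun t => ∫ s in (0 : ℝ)..t, ζ s) ⊆ Icc a b := by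
    refine closure_minimal (fun t ht => ?_) isClosed_Icc
    by_contra h
    exact ht (hsupp t h)
  refine ⟨_, ⟨?_, ?_, ?_⟩, hd⟩
  · rw [contDiff_infty_iff_deriv, hd]
    exact ⟨fun t => (hder t).differentiableAt, hζ.smooth⟩
  · exact isCompact_Icc.of_isClosed_subset (isClosed_tsupport _) hts
  · exact hts.trans fun t ht => ha.trans_le ht.1

/-- The du Bois-Reymond lemma on `(0, ∞)`. -/
lemma ae_eq_const_of_integral_deriv {q : ℝ → ℝ} (hq : LocallyIntegrableOn q (Ioi 0) volume)
    (h : ∀ χ, IsTimeTest χ → ∫ t in Ioi (0 : ℝ), deriv χ t * q t = 0) :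
    ∃ c, ∀ᵐ t ∂(volume.restrict (Ioi (0 : ℝ))), q t = c := by
  obtain ⟨θ, hθ, hθ1⟩ := exists_isTimeTest_integral_eq_one
  have hint : ∀ χ, IsTimeTest χ → IntegrableOn (fun t => χ t * q t) (Ioi 0) := by
    intro χ hχ
    obtain ⟨A, hA⟩ := hχ.smooth.continuous.bounded_above_of_compact_support hχ.compact
    have h1 : IntegrableOn (fun t => χ t * q t) (tsupport χ) volume :=
      Integrable.bdd_mul (c := A) (hq.integrableOn_compact_subset hχ.support hχ.compact)
        hχ.smooth.continuous.aestronglyMeasurable (Filter.Eventually.of_forall fun p => hA p)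
    refine ((integrableOn_iff_integrable_of_support_subset fun p hp => ?_).1 h1).integrableOn
    refine subset_tsupport _ fun h => hp ?_
    simp [h]
  set c := ∫ t in Ioi (0 : ℝ), θ t * q t with hc
  refine ⟨c, ?_⟩
  rw [ae_restrict_iff' measurableSet_Ioi]
  have hloc : LocallyIntegrableOn (fun t => q t - c) (Ioi 0) volume :=
    hq.sub ((locallyIntegrable_const c).locallyIntegrableOn _)
  have hmain := isOpen_Ioi.ae_eq_zero_of_integral_contDiff_smul_eq_zero hloc
    fun χ h1 h2 h3 => ?_
  · filter_upwards [hmain] with t ht hpos using sub_eq_zero.1 (ht hpos)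
  have hχ : IsTimeTest χ := ⟨h1, h2, h3⟩
  -- Subtracting `m * θ` makes the mean zero, so `χ - m * θ` is the derivative of a test function
  -- and the hypothesis applies to it.
  set m := ∫ t, χ t with hm
  have hts : tsupport (fun t => χ t - m * θ t) ⊆ tsupport χ ∪ tsupport θ := by
    refine closure_minimal (fun t ht => ?_) ((isClosed_tsupport _).union (isClosed_tsupport _))
    by_contra hcon
    rw [mem_union, not_or] at hcon
    exact ht (by simp [image_eq_zero_of_notMem_tsupport hcon.1,
      image_eq_zero_of_notMem_tsupport hcon.2])
  have hζ : IsTimeTest fun t => χ t - m * θ t :=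
    ⟨h1.sub (contDiff_const.mul hθ.smooth),
      (h2.isCompact.union hθ.compact.isCompact).of_isClosed_subset (isClosed_tsupport _) hts,
      hts.trans (union_subset h3 hθ.support)⟩
  have hχi : Integrable χ := h1.continuous.integrable_of_hasCompactSupport h2
  have hθi : Integrable θ := hθ.smooth.continuous.integrable_of_hasCompactSupport hθ.compact
  obtain ⟨Z, hZ, hZd⟩ := hζ.exists_deriv_eq (by
    rw [integral_sub hχi (hθi.const_mul m), integral_const_mul, hθ1, mul_one, sub_self])
  have h0 := h Z hZ
  rw [hZd] at h0
  simp only [sub_mul, mul_assoc] at h0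
  rw [integral_sub (hint χ hχ) ((hint θ hθ).const_mul m), integral_const_mul, ← hc] at h0
  have hres : ∫ t, χ t • (q t - c) = ∫ t in Ioi (0 : ℝ), (χ t * q t - χ t * c) := by
    rw [← setIntegral_eq_integral_of_forall_compl_eq_zero (s := Ioi (0 : ℝ)) fun t ht => ?_]
    · simp only [smul_eq_mul, mul_sub]
    · rw [image_eq_zero_of_notMem_tsupport fun h => ht (h3 h), zero_smul]
  have hm' : ∫ t in Ioi (0 : ℝ), χ t = m :=
    setIntegral_eq_integral_of_forall_compl_eq_zero fun t ht =>
      image_eq_zero_of_notMem_tsupport fun h => ht (h3 h)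
  rw [hres, integral_sub (hint χ hχ) (hχi.integrableOn.mul_const c), integral_mul_const, hm']
  linarith

lemma ae_torus_eq_const {u : Torus → ℝ} {C : ℝ} (hu : AEStronglyMeasurable u volume)
    (hC : ∀ᵐ x, |u x| ≤ C) (h : ∀ k, ∫ x, torusDeriv (trig k) x * u x = 0) :
    ∀ᵐ x, u x = ∫ y, u y := by
  have hmp := UnitAddCircle.measurePreserving_mk 0
  rw [zero_add] at hmp
  rw [integral_torus_eq, ae_torus_iff]
  refine ae_eq_const_of_integral_deriv_trig (u := fun x : ℝ => u (x : Torus)) (C := C)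
    (hu.comp_measurePreserving hmp) (ae_torus_iff.1 hC) fun k => ?_
  have := h k
  rw [integral_torus_eq] at this
  simpa only [torusDeriv_coe, mul_comm] using this

/-- Slicewise almost everywhere statements assemble on the product only for measurable sets, hence
the passage to measurable representatives. -/
lemma ae_eq_prod_of_ae_ae {α β : Type*} [MeasurableSpace α] [MeasurableSpace β] {μ : Measure α}
    {ν : Measure β} [SFinite μ] [SFinite ν] {f g : α × β → ℝ}
    (hf : AEStronglyMeasurable f (μ.prod ν)) (hg : AEStronglyMeasurable g (μ.prod ν))
    (h : ∀ᵐ x ∂μ, ∀ᵐ y ∂ν, f (x, y) = g (x, y)) : ∀ᵐ p ∂(μ.prod ν), f p = g p := by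
  have hms : MeasurableSet {p | hf.mk f p = hg.mk g p} :=
    measurableSet_eq_fun hf.stronglyMeasurable_mk.measurable hg.stronglyMeasurable_mk.measurable
  have h3 : ∀ᵐ p ∂(μ.prod ν), hf.mk f p = hg.mk g p := by
    rw [Measure.ae_prod_iff_ae_ae hms]
    filter_upwards [Measure.ae_ae_of_ae_prod hf.ae_eq_mk, Measure.ae_ae_of_ae_prod hg.ae_eq_mk, h]
      with x h1 h2 h3
    filter_upwards [h1, h2, h3] with y e1 e2 e3
    rw [← e1, ← e2, e3]
  filter_upwards [hf.ae_eq_mk, hg.ae_eq_mk, h3] with p e1 e2 e3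
  rw [e1, e2, e3]

/-- A function on `(0, ∞) × 𝕋` with vanishing distributional derivatives is constant. -/
lemma ae_eq_const_of_weak_deriv {Q : ℝ × Torus → ℝ} (hQ : LocallyIntegrableOn Q spaceTime volume)
    (hb : ∀ᵐ t ∂(volume.restrict (Ioi (0 : ℝ))), ∃ C, ∀ᵐ x, |Q (t, x)| ≤ C)
    (hx : ∀ χ k, IsTimeTest χ →
      ∫ p in spaceTime, χ p.1 * (torusDeriv (trig k) p.2 * Q p) = 0)
    (ht : ∀ χ, IsTimeTest χ → ∫ p in spaceTime, deriv χ p.1 * Q p = 0) :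
    ∃ c, ∀ᵐ p ∂(volume.restrict spaceTime), Q p = c := by
  have hQm : AEStronglyMeasurable Q (volume.restrict spaceTime) := hQ.aestronglyMeasurable
  have hQm' := hQm
  rw [volume_restrict_spaceTime] at hQm'
  have hloc : ∀ k, LocallyIntegrableOn (fun p => torusDeriv (trig k) p.2 * Q p) spaceTime volume :=
    fun k => hQ.continuousOn_mul
      ((continuous_torusDeriv (contDiff_trig k)).comp continuous_snd).continuousOn
      isOpen_spaceTime.isLocallyClosed
  have h1 : ∀ᵐ t ∂(volume.restrict (Ioi (0 : ℝ))), ∀ k,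
      ∫ x, torusDeriv (trig k) x * Q (t, x) = 0 :=
    ae_all_iff.2 fun k => ae_integral_torus_eq_zero (hloc k) fun χ hχ => hx χ k hχ
  obtain ⟨c, hc⟩ := ae_eq_const_of_integral_deriv (locallyIntegrableOn_integral_torus hQ)
    fun χ hχ => by rw [← integral_time_mul hQ hχ.deriv]; exact ht χ hχ
  refine ⟨c, ?_⟩
  have h2 : ∀ᵐ t ∂(volume.restrict (Ioi (0 : ℝ))), ∀ᵐ x, Q (t, x) = c := by
    filter_upwards [h1, hb, hc, hQm'.prodMk_left] with t h1 hb hc hm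
    obtain ⟨C, hC⟩ := hb
    filter_upwards [ae_torus_eq_const hm hC h1] with x hx
    rw [hx, hc]
  rw [volume_restrict_spaceTime]
  exact ae_eq_prod_of_ae_ae hQm' aestronglyMeasurable_const h2

/-! ### Velocity moments and the moment form of the weak equation. -/

/-- The velocity average `∫ f(t, x, v) k(v) dv`. -/
noncomputable def moment (f : ℝ × Torus × ℝ → ℝ) (k : ℝ → ℝ) (p : ℝ × Torus) : ℝ :=
  ∫ v, f (p.1, p.2, v) * k v

lemma measurePreserving_prodAssoc_phaseSpaceTime :
    MeasurePreserving (MeasurableEquiv.prodAssoc : (ℝ × Torus) × ℝ ≃ᵐ ℝ × Torus × ℝ)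
      ((volume.restrict spaceTime).prod volume) (volume.restrict phaseSpaceTime) := by
  have h := (volume_preserving_prodAssoc (α₁ := ℝ) (β₁ := Torus) (γ₁ := ℝ)).restrict_preimage
    (s := phaseSpaceTime) (measurableSet_Ioi.prod MeasurableSet.univ)
  have e : MeasurableEquiv.prodAssoc ⁻¹' phaseSpaceTime = spaceTime ×ˢ (univ : Set ℝ) := by
    ext ⟨⟨t, x⟩, v⟩
    simp [phaseSpaceTime, spaceTime, MeasurableEquiv.prodAssoc]
  rw [e, Measure.volume_eq_prod (ℝ × Torus) ℝ, ← Measure.prod_restrict, Measure.restrict_univ] at h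
  exact h

/-- A probability density. -/
structure IsDensity (F : ℝ → ℝ) : Prop where
  nonneg : ∀ᵐ v, 0 ≤ F v
  integrable : Integrable F
  mass : ∫ v, F v = 1

section Density

variable {F : ℝ → ℝ} (hF : IsDensity F)
include hF

lemma IsDensity.integrable_mul {k : ℝ → ℝ} (hk : Continuous k) {A : ℝ} (hA : ∀ v, |k v| ≤ A) :
    Integrable fun v => F v * k v :=
  hF.integrable.mul_bdd (c := A) hk.aestronglyMeasurable (Filter.Eventually.of_forall hA)

lemma IsDensity.abs_integral_mul_le {k : ℝ → ℝ} {A : ℝ} (hA : ∀ v, |k v| ≤ A) :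
    |∫ v, F v * k v| ≤ A := by
  have h := norm_integral_le_of_norm_le (f := fun v => F v * k v) (hF.integrable.mul_const A) (by
    filter_upwards [hF.nonneg] with v hv
    rw [norm_mul, Real.norm_of_nonneg hv]
    exact mul_le_mul_of_nonneg_left (hA v) hv)
  rwa [integral_mul_const, hF.mass, one_mul] at h

lemma IsDensity.integral_abs_mul_le {k : ℝ → ℝ} (hk : Continuous k) {A : ℝ}
    (hA : ∀ v, |k v| ≤ A) : ∫ v, |F v * k v| ≤ A := by
  calc ∫ v, |F v * k v| ≤ ∫ v, F v * A := by
        refine integral_mono_ae (hF.integrable_mul hk hA).abs (hF.integrable.mul_const A) ?_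
        filter_upwards [hF.nonneg] with v hv
        rw [abs_mul, abs_of_nonneg hv]
        exact mul_le_mul_of_nonneg_left (hA v) hv
    _ = A := by rw [integral_mul_const, hF.mass, one_mul]

lemma IsDensity.tendsto_integral_mul {k : ℕ → ℝ → ℝ} {b A : ℝ} (hk : ∀ n, Continuous (k n))
    (hA : ∀ n v, |k n v| ≤ A) (hlim : ∀ v, Filter.Tendsto (fun n => k n v) Filter.atTop (nhds b)) :
    Filter.Tendsto (fun n => ∫ v, F v * k n v) Filter.atTop (nhds b) := by
  have h := tendsto_integral_of_dominated_convergence (μ := volume) (F := fun n v => F v * k n v)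
    (f := fun v => F v * b) (fun v => |F v| * A)
    (fun n => hF.integrable.aestronglyMeasurable.mul (hk n).aestronglyMeasurable)
    (hF.integrable.abs.mul_const A)
    (fun n => Filter.Eventually.of_forall fun v => by
      rw [norm_mul]; exact mul_le_mul_of_nonneg_left (hA n v) (abs_nonneg _))
    (Filter.Eventually.of_forall fun v => (hlim v).const_mul _)
  rwa [integral_mul_const, hF.mass, one_mul] at h

end Density

section Weak

variable {f : ℝ × Torus × ℝ → ℝ} {V E : ℝ × Torus → ℝ}

lemma IsWeakSolution.ae_isDensity (hf : IsWeakSolution f V E) :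
    ∀ᵐ p ∂(volume.restrict spaceTime), IsDensity fun v => f (p.1, p.2, v) := by
  have h1 := measurePreserving_prodAssoc_phaseSpaceTime.quasiMeasurePreserving.ae hf.nonneg
  filter_upwards [hf.density, Measure.ae_ae_of_ae_prod h1] with p hp1 hp2
  refine ⟨hp2, ?_, hp1⟩
  by_contra hni
  rw [integral_undef hni] at hp1
  exact zero_ne_one hp1

lemma IsWeakSolution.aestronglyMeasurable_prod (hf : IsWeakSolution f V E) :
    AEStronglyMeasurable (fun q : (ℝ × Torus) × ℝ => f (q.1.1, q.1.2, q.2))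
      ((volume.restrict spaceTime).prod volume) :=
  hf.measurable.comp_measurePreserving measurePreserving_prodAssoc_phaseSpaceTime

lemma IsWeakSolution.aestronglyMeasurable_moment (hf : IsWeakSolution f V E) {k : ℝ → ℝ}
    (hk : Continuous k) : AEStronglyMeasurable (moment f k) (volume.restrict spaceTime) :=
  (hf.aestronglyMeasurable_prod.mul
    (hk.comp continuous_snd).aestronglyMeasurable).integral_prod_right'

lemma IsWeakSolution.integrable_mul_moment (hf : IsWeakSolution f V E) {a : ℝ × Torus → ℝ}
    (ha : Integrable a (volume.restrict spaceTime)) {k : ℝ → ℝ} (hk : Continuous k) {A : ℝ}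
    (hA : ∀ v, |k v| ≤ A) :
    Integrable (fun p => a p * moment f k p) (volume.restrict spaceTime) := by
  refine ha.mul_bdd (c := A) (hf.aestronglyMeasurable_moment hk) ?_
  filter_upwards [hf.ae_isDensity] with p hp using hp.abs_integral_mul_le hA

/-- Fubini in `v`. Unit density bounds the velocity integral by `A * |a|`, so an integrable weight
`a` suffices, such as one containing the field. -/
lemma IsWeakSolution.integral_phase (hf : IsWeakSolution f V E) {a : ℝ × Torus → ℝ}
    (ha : Integrable a (volume.restrict spaceTime)) {k : ℝ → ℝ} (hk : Continuous k) {A : ℝ}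
    (hA : ∀ v, |k v| ≤ A) :
    Integrable (fun p : ℝ × Torus × ℝ => f p * (a (p.1, p.2.1) * k p.2.2))
      (volume.restrict phaseSpaceTime) ∧
    ∫ p in phaseSpaceTime, f p * (a (p.1, p.2.1) * k p.2.2)
      = ∫ p in spaceTime, a p * moment f k p := by
  have hmp := measurePreserving_prodAssoc_phaseSpaceTime
  have hae : ∀ᵐ p ∂(volume.restrict spaceTime), IsDensity fun v => f (p.1, p.2, v) :=
    hf.ae_isDensity
  have hA0 : 0 ≤ A := (abs_nonneg _).trans (hA 0)
  have hslice : ∀ (p : ℝ × Torus) (v : ℝ), f (p.1, p.2, v) * (a p * k v)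
      = a p * (f (p.1, p.2, v) * k v) := fun p v => by ring
  have hmeas : AEStronglyMeasurable
      (fun q : (ℝ × Torus) × ℝ => f (q.1.1, q.1.2, q.2) * (a q.1 * k q.2))
      ((volume.restrict spaceTime).prod volume) :=
    hf.aestronglyMeasurable_prod.mul (ha.aestronglyMeasurable.comp_fst.mul
      (hk.comp continuous_snd).aestronglyMeasurable)
  have hint : Integrable (fun q : (ℝ × Torus) × ℝ => f (q.1.1, q.1.2, q.2) * (a q.1 * k q.2))
      ((volume.restrict spaceTime).prod volume) := by
    rw [integrable_prod_iff hmeas]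
    constructor
    · filter_upwards [hae] with p hp
      simp only [hslice]
      exact (hp.integrable_mul hk hA).const_mul _
    · refine (ha.abs.mul_const A).mono' hmeas.norm.integral_prod_right' ?_
      filter_upwards [hae] with p hp
      simp only [hslice, norm_mul (a p), integral_const_mul]
      rw [norm_mul, norm_norm]
      refine mul_le_mul_of_nonneg_left ?_ (abs_nonneg _)
      rw [Real.norm_of_nonneg (integral_nonneg fun v => norm_nonneg _)]
      exact hp.integral_abs_mul_le hk hA
  constructor
  · exact (hmp.integrable_comp_emb MeasurableEquiv.prodAssoc.measurableEmbedding).1 hint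
  · rw [← hmp.integral_comp MeasurableEquiv.prodAssoc.measurableEmbedding]
    change ∫ q : (ℝ × Torus) × ℝ, f (q.1.1, q.1.2, q.2) * (a q.1 * k q.2)
      ∂((volume.restrict spaceTime).prod volume) = _
    rw [integral_prod _ hint]
    refine integral_congr_ae (Filter.Eventually.of_forall fun p => ?_)
    simp only [hslice, integral_const_mul, moment]

lemma isPhaseTest_mul {χ : ℝ → ℝ} {η : Torus → ℝ} {h : ℝ → ℝ} (hχ : IsTimeTest χ)
    (hη : ContDiff ℝ ∞ fun x : ℝ => η (x : Torus)) (hh : ContDiff ℝ ∞ h)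
    (hc : HasCompactSupport h) :
    IsPhaseTest fun p => χ p.1 * (η p.2.1 * h p.2.2) := by
  have hsub : tsupport (fun p : ℝ × Torus × ℝ => χ p.1 * (η p.2.1 * h p.2.2))
      ⊆ tsupport χ ×ˢ (univ ×ˢ tsupport h) := by
    refine closure_minimal (fun p hp => ?_)
      ((isClosed_tsupport _).prod (isClosed_univ.prod (isClosed_tsupport _)))
    refine ⟨subset_tsupport _ fun h0 => hp ?_, mem_univ _, subset_tsupport _ fun h0 => hp ?_⟩ <;>
    simp [h0]
  refine ⟨?_, ?_, ?_⟩
  · have h2 : ContDiff ℝ ∞ fun p : ℝ × ℝ × ℝ => η (p.2.1 : Torus) :=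
      hη.comp (contDiff_fst.comp contDiff_snd)
    have h3 : ContDiff ℝ ∞ fun p : ℝ × ℝ × ℝ => h p.2.2 := hh.comp (contDiff_snd.comp contDiff_snd)
    exact (hχ.smooth.comp contDiff_fst).mul (h2.mul h3)
  · exact (hχ.compact.isCompact.prod (isCompact_univ.prod hc.isCompact)).of_isClosed_subset
      (isClosed_tsupport _) hsub
  · exact hsub.trans (prod_mono hχ.support (subset_univ _))

lemma isSpaceTest_time {χ : ℝ → ℝ} (hχ : IsTimeTest χ) :
    IsSpaceTest fun p => χ p.1 := by
  have hsub : tsupport (fun p : ℝ × Torus => χ p.1) ⊆ tsupport χ ×ˢ univ := by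
    refine closure_minimal (fun p hp => ?_) ((isClosed_tsupport _).prod isClosed_univ)
    exact ⟨subset_tsupport _ hp, mem_univ _⟩
  refine ⟨hχ.smooth.comp contDiff_fst, ?_, hsub.trans (prod_mono hχ.support (subset_univ _))⟩
  exact (hχ.compact.isCompact.prod isCompact_univ).of_isClosed_subset (isClosed_tsupport _) hsub

lemma integrable_time_torus {χ : ℝ → ℝ} {η : Torus → ℝ} {Q : ℝ × Torus → ℝ} (hχ : IsTimeTest χ)
    (hη : Continuous η) (hQ : LocallyIntegrableOn Q spaceTime volume) :
    Integrable (fun p => χ p.1 * (η p.2 * Q p)) (volume.restrict spaceTime) :=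
  (integrable_time_mul (hQ.continuousOn_mul (hη.comp continuous_snd).continuousOn
    isOpen_spaceTime.isLocallyClosed) hχ).restrict

lemma locallyIntegrableOn_one : LocallyIntegrableOn (fun _ : ℝ × Torus => (1 : ℝ)) spaceTime volume :=
  (locallyIntegrable_const 1).locallyIntegrableOn _

lemma integral_add_add {α : Type*} [MeasurableSpace α] {μ : Measure α} {u v w : α → ℝ}
    (hu : Integrable u μ) (hv : Integrable v μ) (hw : Integrable w μ) :
    ∫ x, (u x + v x + w x) ∂μ = (∫ x, u x ∂μ) + (∫ x, v x ∂μ) + ∫ x, w x ∂μ := by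
  rw [← integral_add hu hv]
  exact integral_add (hu.add hv) hw

/-- The weak formulation against product test functions, in terms of velocity averages. -/
lemma IsWeakSolution.moment_equation (hf : IsWeakSolution f V E) {χ : ℝ → ℝ} {η : Torus → ℝ}
    {h : ℝ → ℝ} (hχ : IsTimeTest χ) (hη : ContDiff ℝ ∞ fun x : ℝ => η (x : Torus))
    (hh : ContDiff ℝ ∞ h) (hc : HasCompactSupport h) :
    ∫ p in spaceTime, (deriv χ p.1 * η p.2 * moment f h p
      + χ p.1 * torusDeriv η p.2 * moment f (fun v => v * h v) p
      + χ p.1 * (η p.2 * E p) * moment f (deriv h) p) = 0 := by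
  have hηc := continuous_torus_of_lift hη.continuous
  have hE := hf.field.field_locInt
  have i1 : Integrable (fun p : ℝ × Torus => deriv χ p.1 * η p.2) (volume.restrict spaceTime) := by
    simpa using integrable_time_torus hχ.deriv hηc locallyIntegrableOn_one
  have i2 : Integrable (fun p : ℝ × Torus => χ p.1 * torusDeriv η p.2)
      (volume.restrict spaceTime) := by
    simpa using integrable_time_torus hχ (continuous_torusDeriv hη) locallyIntegrableOn_one
  have i3 := integrable_time_torus hχ hηc hE
  have c2 : Continuous fun v => v * h v := continuous_id.mul hh.continuous
  have c3 : Continuous (deriv h) := hh.continuous_deriv (by simp)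
  obtain ⟨A1, hA1⟩ := hh.continuous.bounded_above_of_compact_support hc
  obtain ⟨A2, hA2⟩ := c2.bounded_above_of_compact_support (hc.mul_left (f := fun v => v))
  obtain ⟨A3, hA3⟩ := c3.bounded_above_of_compact_support hc.deriv
  obtain ⟨j1, e1⟩ := hf.integral_phase i1 hh.continuous hA1
  obtain ⟨j2, e2⟩ := hf.integral_phase i2 c2 hA2
  obtain ⟨j3, e3⟩ := hf.integral_phase i3 c3 hA3
  have m1 := hf.integrable_mul_moment i1 hh.continuous hA1
  have m2 := hf.integrable_mul_moment i2 c2 hA2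
  have m3 := hf.integrable_mul_moment i3 c3 hA3
  have ht := hf.transport _ (isPhaseTest_mul hχ hη hh hc)
  have hψ : ∀ p : ℝ × Torus × ℝ,
      f p * (phaseDt (fun p => χ p.1 * (η p.2.1 * h p.2.2)) p
        + p.2.2 * phaseDx (fun p => χ p.1 * (η p.2.1 * h p.2.2)) p
        + E (p.1, p.2.1) * phaseDv (fun p => χ p.1 * (η p.2.1 * h p.2.2)) p)
      = f p * (deriv χ p.1 * η p.2.1 * h p.2.2)
        + f p * (χ p.1 * torusDeriv η p.2.1 * (p.2.2 * h p.2.2))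
        + f p * (χ p.1 * (η p.2.1 * E (p.1, p.2.1)) * deriv h p.2.2) := by
    intro p
    simp only [phaseDt, phaseDx, phaseDv, torusDeriv, deriv_mul_const_field, deriv_const_mul_field]
    ring
  simp only [hψ] at ht
  rw [integral_add_add m1 m2 m3, ← e1, ← e2, ← e3]
  exact (integral_add_add j1 j2 j3).symm.trans ht

/-- A function of time alone is an admissible test function on the torus and has zero
`x`-derivative. -/
lemma IsWeakSolution.integral_field (hf : IsWeakSolution f V E) {χ : ℝ → ℝ} (hχ : IsTimeTest χ) :
    ∫ p in spaceTime, χ p.1 * E p = 0 := by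
  have h := hf.field.weak_deriv _ (isSpaceTest_time hχ)
  simp only [spaceDx, deriv_const, mul_zero, integral_zero] at h
  rw [h]
  simp only [mul_comm]

end Weak

/-! ### Velocity cutoffs and the mean velocity of a symmetric density. -/

/-- A smooth even cutoff function, equal to `1` on `[-1, 1]`. -/
noncomputable def cutoff : ContDiffBump (0 : ℝ) := ⟨1, 2, one_pos, one_lt_two⟩

/-- The cutoff at velocities of order `n`. -/
noncomputable def velocityCutoff (n : ℕ) (v : ℝ) : ℝ := cutoff (v / (n + 1))

/-- The velocity, cut off at order `n`. -/
noncomputable def cutVelocity (n : ℕ) (v : ℝ) : ℝ := v * velocityCutoff n v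

lemma contDiff_velocityCutoff (n : ℕ) : ContDiff ℝ ∞ (velocityCutoff n) :=
  (cutoff.contDiff (n := ⊤)).comp (contDiff_id.div_const _)

lemma contDiff_cutVelocity (n : ℕ) : ContDiff ℝ ∞ (cutVelocity n) :=
  contDiff_id.mul (contDiff_velocityCutoff n)

lemma hasCompactSupport_velocityCutoff (n : ℕ) : HasCompactSupport (velocityCutoff n) := by
  have hn : ((n : ℝ) + 1)⁻¹ ≠ 0 := by positivity
  have := cutoff.hasCompactSupport.comp_homeomorph (Homeomorph.mulRight₀ _ hn)
  exact this

lemma hasCompactSupport_cutVelocity (n : ℕ) : HasCompactSupport (cutVelocity n) :=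
  (hasCompactSupport_velocityCutoff n).mul_left (f := fun v => v)

lemma abs_velocityCutoff_le (n : ℕ) (v : ℝ) : |velocityCutoff n v| ≤ 1 := by
  rw [velocityCutoff, abs_of_nonneg cutoff.nonneg]
  exact cutoff.le_one

lemma velocityCutoff_eventually_eq_one (v : ℝ) :
    ∀ᶠ n : ℕ in Filter.atTop, velocityCutoff n v = 1 := by
  filter_upwards [Filter.eventually_ge_atTop ⌈|v|⌉₊] with n hn
  refine cutoff.one_of_mem_closedBall ?_
  rw [Metric.mem_closedBall, Real.dist_eq, sub_zero, abs_div,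
    abs_of_pos (by positivity : (0 : ℝ) < n + 1)]
  change _ ≤ (1 : ℝ)
  rw [div_le_one (by positivity)]
  have := Nat.ceil_le.1 hn
  linarith

lemma tendsto_velocityCutoff (v : ℝ) :
    Filter.Tendsto (fun n => velocityCutoff n v) Filter.atTop (nhds 1) :=
  tendsto_const_nhds.congr' ((velocityCutoff_eventually_eq_one v).mono fun _ h => h.symm)

lemma tendsto_cutVelocity (v : ℝ) :
    Filter.Tendsto (fun n => cutVelocity n v) Filter.atTop (nhds v) := by
  simpa [cutVelocity] using (tendsto_velocityCutoff v).const_mul v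

lemma cutVelocity_eq (n : ℕ) (v : ℝ) :
    cutVelocity n v = (n + 1) * (fun y => y * cutoff y) (v / (n + 1)) := by
  have : (n : ℝ) + 1 ≠ 0 := by positivity
  simp only [cutVelocity, velocityCutoff]
  field_simp

lemma deriv_velocityCutoff (n : ℕ) (v : ℝ) :
    deriv (velocityCutoff n) v = deriv cutoff (v / (n + 1)) / (n + 1) := by
  have h : HasDerivAt cutoff (deriv cutoff (v / (n + 1))) (v / (n + 1)) :=
    ((cutoff.contDiff (n := 1)).differentiable (by simp) _).hasDerivAt
  have := h.comp v ((hasDerivAt_id v).div_const ((n : ℝ) + 1))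
  rw [show velocityCutoff n = cutoff ∘ fun v => id v / ((n : ℝ) + 1) from rfl, this.deriv]
  ring

lemma contDiff_mul_cutoff : ContDiff ℝ ∞ fun y : ℝ => y * cutoff y :=
  contDiff_id.mul cutoff.contDiff

lemma deriv_cutVelocity (n : ℕ) (v : ℝ) :
    deriv (cutVelocity n) v = deriv (fun y => y * cutoff y) (v / (n + 1)) := by
  have h : HasDerivAt (fun y => y * cutoff y) (deriv (fun y => y * cutoff y) (v / (n + 1)))
      (v / (n + 1)) := (contDiff_mul_cutoff.differentiable (by simp) _).hasDerivAt
  have := (h.comp v ((hasDerivAt_id v).div_const ((n : ℝ) + 1))).const_mul ((n : ℝ) + 1)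
  have e : cutVelocity n
      = fun v => ((n : ℝ) + 1) * ((fun y => y * cutoff y) ∘ fun v => id v / ((n : ℝ) + 1)) v :=
    funext fun v => cutVelocity_eq n v
  rw [e, this.deriv]
  have : (n : ℝ) + 1 ≠ 0 := by positivity
  field_simp

lemma tendsto_div_succ (v : ℝ) :
    Filter.Tendsto (fun n : ℕ => v / ((n : ℝ) + 1)) Filter.atTop (nhds 0) :=
  tendsto_const_nhds.div_atTop
    (Filter.tendsto_atTop_add_const_right _ _ tendsto_natCast_atTop_atTop)

lemma tendsto_deriv_velocityCutoff (v : ℝ) :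
    Filter.Tendsto (fun n => deriv (velocityCutoff n) v) Filter.atTop (nhds 0) := by
  simp only [deriv_velocityCutoff]
  have hc : Continuous (deriv cutoff) := (cutoff.contDiff (n := 1)).continuous_deriv le_rfl
  exact ((hc.tendsto 0).comp (tendsto_div_succ v)).div_atTop
    (Filter.tendsto_atTop_add_const_right _ _ tendsto_natCast_atTop_atTop)

lemma tendsto_deriv_cutVelocity (v : ℝ) :
    Filter.Tendsto (fun n => deriv (cutVelocity n) v) Filter.atTop (nhds 1) := by
  simp only [deriv_cutVelocity]
  have hc : Continuous (deriv fun y : ℝ => y * cutoff y) :=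
    contDiff_mul_cutoff.continuous_deriv (by simp)
  have h0 : deriv (fun y : ℝ => y * cutoff y) 0 = 1 := by
    have h : HasDerivAt cutoff (deriv cutoff 0) 0 :=
      ((cutoff.contDiff (n := 1)).differentiable (by simp) _).hasDerivAt
    have h1 : cutoff 0 = 1 := cutoff.one_of_mem_closedBall (by simp [cutoff])
    simpa [h1] using ((hasDerivAt_id' (0 : ℝ)).fun_mul h).deriv
  have := (hc.tendsto 0).comp (tendsto_div_succ v)
  rwa [h0] at this

/-- The bounds are uniform in `n` by scaling: `cutVelocity n` is `(n + 1) g(v / (n + 1))` for a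
fixed `g`, so its derivatives take values of `g'` only. -/
lemma exists_bound_deriv_cutoff : ∃ L, 0 ≤ L ∧ (∀ n v, |deriv (velocityCutoff n) v| ≤ L) ∧
    (∀ n v, |deriv (cutVelocity n) v| ≤ L) ∧
    ∀ n v w, |cutVelocity n v - cutVelocity n w| ≤ L * |v - w| := by
  have hc : Continuous (deriv cutoff) := (cutoff.contDiff (n := 1)).continuous_deriv le_rfl
  have hc' : Continuous (deriv fun y : ℝ => y * cutoff y) :=
    contDiff_mul_cutoff.continuous_deriv (by simp)
  obtain ⟨A, hA⟩ := hc.bounded_above_of_compact_support cutoff.hasCompactSupport.deriv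
  obtain ⟨B, hB⟩ := hc'.bounded_above_of_compact_support
    (cutoff.hasCompactSupport.mul_left (f := fun y => y)).deriv
  have hA0 : 0 ≤ A := (norm_nonneg _).trans (hA 0)
  have hder : ∀ n v, |deriv (cutVelocity n) v| ≤ max A B := fun n v => by
    rw [deriv_cutVelocity]
    exact (hB _).trans (le_max_right _ _)
  refine ⟨max A B, hA0.trans (le_max_left _ _), fun n v => ?_, hder, fun n v w => ?_⟩
  · rw [deriv_velocityCutoff, abs_div, abs_of_pos (by positivity : (0 : ℝ) < n + 1)]
    refine (div_le_self (abs_nonneg _) (by linarith [n.cast_nonneg (α := ℝ)])).trans ?_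
    exact (hA _).trans (le_max_left _ _)
  · have := Convex.norm_image_sub_le_of_norm_deriv_le (f := cutVelocity n) (s := univ)
      (fun x _ => (contDiff_cutVelocity n).differentiable (by simp) x) (fun x _ => hder n x)
      convex_univ (mem_univ w) (mem_univ v)
    simpa using this

/-- The mean velocity of a symmetric density, as a limit of truncated averages. -/
lemma IsDensity.cutVelocity_symm {F : ℝ → ℝ} (hF : IsDensity F) {a L : ℝ}
    (hs : ∀ v, F (2 * a - v) = F v)
    (hL : ∀ n v w, |cutVelocity n v - cutVelocity n w| ≤ L * |v - w|) :
    (∀ n, |∫ v, F v * cutVelocity n v| ≤ L * |a|) ∧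
    Filter.Tendsto (fun n => ∫ v, F v * cutVelocity n v) Filter.atTop (nhds a) := by
  have hc : ∀ n, Continuous (cutVelocity n) := fun n => (contDiff_cutVelocity n).continuous
  have hodd : ∀ n v, cutVelocity n (-v) = -cutVelocity n v := fun n v => by
    simp only [cutVelocity, velocityCutoff, neg_div, cutoff.neg, neg_mul]
  -- Symmetry allows the truncated velocity to be averaged with its reflection. By oddness this is
  -- half a difference of values at distance `2|a|`, so it is bounded by `L * |a|` and dominated
  -- convergence works without a finite first moment.
  set k : ℕ → ℝ → ℝ := fun n v => (cutVelocity n v + cutVelocity n (2 * a - v)) / 2 with hk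
  have hkc : ∀ n, Continuous (k n) := fun n => by
    have := hc n
    simp only [hk]; fun_prop
  have hkb : ∀ n v, |k n v| ≤ L * |a| := by
    intro n v
    have h1 := hL n v (v - 2 * a)
    simp only [hk]
    rw [show 2 * a - v = -(v - 2 * a) by ring, hodd, abs_div, ← sub_eq_add_neg, abs_two]
    rw [show v - (v - 2 * a) = 2 * a by ring, abs_mul, abs_two] at h1
    linarith
  have hkt : ∀ v, Filter.Tendsto (fun n => k n v) Filter.atTop (nhds a) := by
    intro v
    have := ((tendsto_cutVelocity v).add (tendsto_cutVelocity (2 * a - v))).div_const 2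
    convert this using 2; ring
  have heq : ∀ n, ∫ v, F v * cutVelocity n v = ∫ v, F v * k n v := by
    intro n
    obtain ⟨A, hA⟩ := (hc n).bounded_above_of_compact_support (hasCompactSupport_cutVelocity n)
    have h1 : ∫ v, F v * cutVelocity n (2 * a - v) = ∫ v, F v * cutVelocity n v := by
      rw [← integral_sub_left_eq_self (fun v => F v * cutVelocity n v) volume (2 * a)]
      simp only [hs]
    have i1 := hF.integrable_mul (hc n) hA
    have i2 := hF.integrable_mul (k := fun v => cutVelocity n (2 * a - v))
      ((hc n).comp (by fun_prop)) (fun v => hA _)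
    have h2 : ∀ v, F v * k n v
        = (F v * cutVelocity n v + F v * cutVelocity n (2 * a - v)) / 2 := fun v => by
      simp only [hk]; ring
    simp only [h2]
    rw [integral_div, integral_add i1 i2, h1]; ring
  constructor
  · intro n; rw [heq]; exact hF.abs_integral_mul_le (hkb n)
  · simp only [heq]; exact hF.tendsto_integral_mul hkc hkb hkt

lemma IsC1.continuousOn_lift {u : ℝ × Torus → ℝ} (hu : IsC1 u) :
    ContinuousOn (fun p : ℝ × ℝ => u (p.1, (p.2 : Torus))) (Ici 0 ×ˢ univ) :=
  ContDiffOn.continuousOn hu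

lemma IsC1.continuousOn {u : ℝ × Torus → ℝ} (hu : IsC1 u) : ContinuousOn u spaceTime := by
  rintro ⟨t, x⟩ ⟨ht, -⟩
  induction x using QuotientAddGroup.induction_on with
  | H x =>
  refine ContinuousAt.continuousWithinAt ?_
  have hq : IsOpenQuotientMap (Prod.map id ((↑) : ℝ → Torus) : ℝ × ℝ → ℝ × Torus) :=
    IsOpenQuotientMap.id.prodMap QuotientAddGroup.isOpenQuotientMap_mk
  have h1 : ContinuousAt (fun p : ℝ × ℝ => u (p.1, (p.2 : Torus))) (t, x) :=
    hu.continuousOn_lift.continuousAt (prod_mem_nhds (Ici_mem_nhds ht) Filter.univ_mem)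
  exact (hq.continuousAt_comp_iff (f := Prod.map id ((↑) : ℝ → Torus)) (g := u)).1 h1

/-- Continuity turns an almost everywhere identity into one on the open domain, and then at `t = 0`
by a one-sided limit. -/
lemma IsC1.const_of_ae {u : ℝ × Torus → ℝ} (hu : IsC1 u) {c : ℝ}
    (h : ∀ᵐ p ∂(volume.restrict spaceTime), u p = c) (t : ℝ) (ht : 0 ≤ t) (x : Torus) :
    u (t, x) = c := by
  have hpos : ∀ p ∈ spaceTime, u p = c := by
    have := Measure.eqOn_open_of_ae_eq (f := u) (g := fun _ => c) h isOpen_spaceTime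
      hu.continuousOn continuousOn_const
    exact this
  rcases ht.eq_or_lt with rfl | ht
  · induction x using QuotientAddGroup.induction_on with
    | H x =>
    have h1 : ContinuousWithinAt (fun s : ℝ => u (s, (x : Torus))) (Ici 0) 0 := by
      have h0 := hu.continuousOn_lift (0, x) ⟨self_mem_Ici, mem_univ _⟩
      exact h0.comp (f := fun s : ℝ => (s, x)) (s := Ici 0) (x := 0)
        (by fun_prop) fun s hs => ⟨hs, mem_univ _⟩
    have h2 : Filter.Tendsto (fun s : ℝ => u (s, (x : Torus))) (nhdsWithin 0 (Ioi 0))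
        (nhds (u (0, (x : Torus)))) := h1.mono_left (nhdsWithin_mono _ Ioi_subset_Ici_self)
    refine tendsto_nhds_unique h2 (tendsto_const_nhds.congr' ?_)
    filter_upwards [self_mem_nhdsWithin] with s hs using (hpos _ ⟨hs, mem_univ _⟩).symm
  · exact hpos _ ⟨ht, mem_univ _⟩

/-! ### Continuity and momentum equations, and constancy of the mean velocity. -/

section MeanVelocity

variable {f : ℝ × Torus × ℝ → ℝ} {V E vbar : ℝ × Torus → ℝ}

/-- The test function in velocity is a cutoff tending to `1`: its moment tends to the density `1`,
the flux to `vbar`, and the field term to `0`. -/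
lemma IsWeakSolution.continuity_equation (hf : IsWeakSolution f V E)
    (hv : ContinuousOn vbar spaceTime)
    (hsymm : ∀ᵐ p ∂(volume.restrict spaceTime),
      ∀ v : ℝ, f (p.1, p.2, 2 * vbar p - v) = f (p.1, p.2, v))
    {χ : ℝ → ℝ} {η : Torus → ℝ} (hχ : IsTimeTest χ)
    (hη : ContDiff ℝ ∞ fun x : ℝ => η (x : Torus)) :
    ∫ p in spaceTime, (deriv χ p.1 * η p.2 + χ p.1 * (torusDeriv η p.2 * vbar p)) = 0 := by
  obtain ⟨L, hL0, hL1, -, hL3⟩ := exists_bound_deriv_cutoff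
  have hηc := continuous_torus_of_lift hη.continuous
  have hvl : LocallyIntegrableOn vbar spaceTime volume :=
    hv.locallyIntegrableOn isOpen_spaceTime.measurableSet
  have i1 : Integrable (fun p : ℝ × Torus => deriv χ p.1 * η p.2) (volume.restrict spaceTime) := by
    simpa using integrable_time_torus hχ.deriv hηc locallyIntegrableOn_one
  have i2 : Integrable (fun p : ℝ × Torus => χ p.1 * torusDeriv η p.2)
      (volume.restrict spaceTime) := by
    simpa using integrable_time_torus hχ (continuous_torusDeriv hη) locallyIntegrableOn_one
  have i2v := integrable_time_torus hχ (continuous_torusDeriv hη) hvl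
  have i3 := integrable_time_torus hχ hηc hf.field.field_locInt
  have c1 : ∀ n, Continuous (velocityCutoff n) := fun n => (contDiff_velocityCutoff n).continuous
  have c2 : ∀ n, Continuous (cutVelocity n) := fun n => (contDiff_cutVelocity n).continuous
  have c3 : ∀ n, Continuous (deriv (velocityCutoff n)) := fun n =>
    (contDiff_velocityCutoff n).continuous_deriv (by simp)
  have key := tendsto_integral_of_dominated_convergence (μ := volume.restrict spaceTime)
    (F := fun (n : ℕ) (p : ℝ × Torus) => deriv χ p.1 * η p.2 * moment f (velocityCutoff n) p
      + χ p.1 * torusDeriv η p.2 * moment f (cutVelocity n) p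
      + χ p.1 * (η p.2 * E p) * moment f (deriv (velocityCutoff n)) p)
    (f := fun p => deriv χ p.1 * η p.2 * 1 + χ p.1 * torusDeriv η p.2 * vbar p
      + χ p.1 * (η p.2 * E p) * 0)
    (fun p => |deriv χ p.1 * η p.2| * 1 + L * |χ p.1 * (torusDeriv η p.2 * vbar p)|
      + |χ p.1 * (η p.2 * E p)| * L)
    (fun n => ((i1.aestronglyMeasurable.mul (hf.aestronglyMeasurable_moment (c1 n))).add
      (i2.aestronglyMeasurable.mul (hf.aestronglyMeasurable_moment (c2 n)))).add
      (i3.aestronglyMeasurable.mul (hf.aestronglyMeasurable_moment (c3 n))))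
    (((i1.abs.mul_const 1).add (i2v.abs.const_mul L)).add (i3.abs.mul_const L)) ?_ ?_
  · have hzero : ∀ n : ℕ, ∫ p in spaceTime, (deriv χ p.1 * η p.2 * moment f (velocityCutoff n) p
      + χ p.1 * torusDeriv η p.2 * moment f (cutVelocity n) p
      + χ p.1 * (η p.2 * E p) * moment f (deriv (velocityCutoff n)) p) = 0 := fun n =>
      hf.moment_equation hχ hη (contDiff_velocityCutoff n) (hasCompactSupport_velocityCutoff n)
    simp only [hzero] at key
    have := tendsto_nhds_unique key tendsto_const_nhds
    rw [← this]
    refine integral_congr_ae (Filter.Eventually.of_forall fun p => ?_)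
    simp only
    ring
  · intro n
    filter_upwards [hf.ae_isDensity, hsymm] with p hp hs
    have b1 : |moment f (velocityCutoff n) p| ≤ 1 :=
      hp.abs_integral_mul_le (abs_velocityCutoff_le n)
    have b2 : |moment f (cutVelocity n) p| ≤ L * |vbar p| := (hp.cutVelocity_symm hs hL3).1 n
    have b3 : |moment f (deriv (velocityCutoff n)) p| ≤ L := hp.abs_integral_mul_le (hL1 n)
    refine (norm_add₃_le).trans (add_le_add (add_le_add ?_ ?_) ?_)
    · rw [norm_mul]; exact mul_le_mul_of_nonneg_left b1 (abs_nonneg _)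
    · rw [norm_mul]
      refine (mul_le_mul_of_nonneg_left b2 (norm_nonneg _)).trans (le_of_eq ?_)
      rw [Real.norm_eq_abs, ← mul_assoc (χ p.1), abs_mul _ (vbar p)]; ring
    · rw [norm_mul]; exact mul_le_mul_of_nonneg_left b3 (abs_nonneg _)
  · filter_upwards [hf.ae_isDensity, hsymm] with p hp hs
    refine (Filter.Tendsto.add ?_ ?_).add ?_
    · exact (hp.tendsto_integral_mul c1 abs_velocityCutoff_le tendsto_velocityCutoff).const_mul _
    · exact (hp.cutVelocity_symm hs hL3).2.const_mul _
    · exact (hp.tendsto_integral_mul c3 hL1 tendsto_deriv_velocityCutoff).const_mul _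

/-- Only space-independent test functions are used, so the flux of momentum, which contains a second
moment that may be infinite, never appears. -/
lemma IsWeakSolution.momentum_equation (hf : IsWeakSolution f V E)
    (hv : ContinuousOn vbar spaceTime)
    (hsymm : ∀ᵐ p ∂(volume.restrict spaceTime),
      ∀ v : ℝ, f (p.1, p.2, 2 * vbar p - v) = f (p.1, p.2, v))
    {χ : ℝ → ℝ} (hχ : IsTimeTest χ) :
    ∫ p in spaceTime, (deriv χ p.1 * vbar p + χ p.1 * E p) = 0 := by
  obtain ⟨L, hL0, -, hL2, hL3⟩ := exists_bound_deriv_cutoff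
  have hvl : LocallyIntegrableOn vbar spaceTime volume :=
    hv.locallyIntegrableOn isOpen_spaceTime.measurableSet
  have i1 : Integrable (fun p : ℝ × Torus => deriv χ p.1 * 1) (volume.restrict spaceTime) :=
    (integrable_time_mul locallyIntegrableOn_one hχ.deriv).restrict
  have i1v := (integrable_time_mul hvl hχ.deriv).restrict (s := spaceTime)
  have i3 := (integrable_time_mul hf.field.field_locInt hχ).restrict (s := spaceTime)
  have c2 : ∀ n, Continuous (cutVelocity n) := fun n => (contDiff_cutVelocity n).continuous
  have c3 : ∀ n, Continuous (deriv (cutVelocity n)) := fun n =>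
    (contDiff_cutVelocity n).continuous_deriv (by simp)
  have key := tendsto_integral_of_dominated_convergence (μ := volume.restrict spaceTime)
    (F := fun (n : ℕ) (p : ℝ × Torus) => deriv χ p.1 * 1 * moment f (cutVelocity n) p
      + χ p.1 * E p * moment f (deriv (cutVelocity n)) p)
    (f := fun p => deriv χ p.1 * 1 * vbar p + χ p.1 * E p * 1)
    (fun p => L * |deriv χ p.1 * vbar p| + |χ p.1 * E p| * L)
    (fun n => (i1.aestronglyMeasurable.mul (hf.aestronglyMeasurable_moment (c2 n))).add
      (i3.aestronglyMeasurable.mul (hf.aestronglyMeasurable_moment (c3 n))))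
    ((i1v.abs.const_mul L).add (i3.abs.mul_const L)) ?_ ?_
  · have hzero : ∀ n : ℕ, ∫ p in spaceTime, (deriv χ p.1 * 1 * moment f (cutVelocity n) p
      + χ p.1 * E p * moment f (deriv (cutVelocity n)) p) = 0 := fun n => by
      have := hf.moment_equation (η := fun _ => 1) hχ contDiff_const (contDiff_cutVelocity n)
        (hasCompactSupport_cutVelocity n)
      simpa [torusDeriv] using this
    simp only [hzero] at key
    have := tendsto_nhds_unique key tendsto_const_nhds
    simpa using this
  · intro n
    filter_upwards [hf.ae_isDensity, hsymm] with p hp hs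
    have b2 : |moment f (cutVelocity n) p| ≤ L * |vbar p| := (hp.cutVelocity_symm hs hL3).1 n
    have b3 : |moment f (deriv (cutVelocity n)) p| ≤ L := hp.abs_integral_mul_le (hL2 n)
    refine (norm_add_le _ _).trans (add_le_add ?_ ?_)
    · rw [norm_mul]
      refine (mul_le_mul_of_nonneg_left b2 (norm_nonneg _)).trans (le_of_eq ?_)
      rw [Real.norm_eq_abs, mul_one, abs_mul _ (vbar p)]; ring
    · rw [norm_mul]; exact mul_le_mul_of_nonneg_left b3 (abs_nonneg _)
  · filter_upwards [hf.ae_isDensity, hsymm] with p hp hs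
    refine Filter.Tendsto.add ?_ ?_
    · exact (hp.cutVelocity_symm hs hL3).2.const_mul _
    · exact (hp.tendsto_integral_mul c3 hL2 tendsto_deriv_cutVelocity).const_mul _

/-- The mean velocity is constant. -/
theorem IsWeakSolution.exists_mean_velocity_eq (hf : IsWeakSolution f V E) (hv : IsC1 vbar)
    (hsymm : ∀ᵐ p ∂(volume.restrict spaceTime),
      ∀ v : ℝ, f (p.1, p.2, 2 * vbar p - v) = f (p.1, p.2, v)) :
    ∃ c, ∀ t : ℝ, 0 ≤ t → ∀ x : Torus, vbar (t, x) = c := by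
  have hvc := hv.continuousOn
  have hvl : LocallyIntegrableOn vbar spaceTime volume :=
    hvc.locallyIntegrableOn isOpen_spaceTime.measurableSet
  suffices h : ∃ c, ∀ᵐ p ∂(volume.restrict spaceTime), vbar p = c by
    obtain ⟨c, hc⟩ := h
    exact ⟨c, hv.const_of_ae hc⟩
  refine ae_eq_const_of_weak_deriv hvl ?_ (fun χ k hχ => ?_) (fun χ hχ => ?_)
  · filter_upwards [ae_restrict_mem measurableSet_Ioi] with t ht
    have : Continuous fun x => vbar (t, x) := by
      rw [← continuousOn_univ]
      exact hvc.comp (by fun_prop) fun x _ => ⟨ht, mem_univ _⟩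
    obtain ⟨C, hC⟩ := isCompact_univ.exists_bound_of_continuousOn this.continuousOn
    exact ⟨C, Filter.Eventually.of_forall fun x => hC x (mem_univ x)⟩
  · have h := hf.continuity_equation hvc hsymm hχ (contDiff_trig k)
    have i1 : Integrable (fun p : ℝ × Torus => deriv χ p.1 * trig k p.2)
        (volume.restrict spaceTime) := by
      simpa using integrable_time_torus hχ.deriv
        (continuous_torus_of_lift (contDiff_trig k).continuous) locallyIntegrableOn_one
    rw [integral_add i1 (integrable_time_torus hχ (continuous_torusDeriv (contDiff_trig k)) hvl)]
      at h
    -- The density is constant in time, so its time derivative drops out and the continuity equation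
    -- reduces to `∂ₓ vbar = 0`.
    have h0 : ∫ p in spaceTime, deriv χ p.1 * trig k p.2 = 0 := by
      have hd : ∫ t, deriv χ t = 0 := by
        refine integral_eq_zero_of_hasDerivAt_of_integrable (f := χ)
          (fun t => (hχ.smooth.differentiable (by simp) t).hasDerivAt)
          (hχ.deriv.smooth.continuous.integrable_of_hasCompactSupport hχ.deriv.compact)
          (hχ.smooth.continuous.integrable_of_hasCompactSupport hχ.compact)
      have hd' : ∫ t in Ioi (0 : ℝ), deriv χ t = 0 := by
        refine Eq.trans ?_ hd
        exact setIntegral_eq_integral_of_forall_compl_eq_zero fun t ht =>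
          image_eq_zero_of_notMem_tsupport fun h => ht (hχ.deriv.support h)
      rw [volume_restrict_spaceTime, integral_prod_mul, hd', zero_mul]
    rw [h0, zero_add] at h
    exact h
  · have h := hf.momentum_equation hvc hsymm hχ
    rw [integral_add (integrable_time_mul hvl hχ.deriv).restrict
      (integrable_time_mul hf.field.field_locInt hχ).restrict, hf.integral_field hχ, add_zero] at h
    exact h

end MeanVelocity

/-! ### Odd and even shell test functions, and the equations for shell averages. -/

/-- The odd extension to negative velocities of an energy shell function. -/
noncomputable def oddShell (j i : ℕ) (r w : ℝ) : ℝ :=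
  if 0 < w then shellBump j i (w ^ 2 / 2 - r) else -shellBump j i (w ^ 2 / 2 - r)

lemma oddShell_neg (j i : ℕ) {r : ℝ} (hr : 0 < r) (w : ℝ) :
    oddShell j i r (-w) = -oddShell j i r w := by
  unfold oddShell
  rcases lt_trichotomy w 0 with h | rfl | h
  · rw [if_pos (by linarith), if_neg (by linarith), neg_neg, neg_sq]
  · simp [shellBump_eq_zero j i (Or.inl (by linarith : -r ≤ 0))]
  · rw [if_neg (by linarith), if_pos h, neg_sq]

lemma mul_oddShell (j i : ℕ) (r w : ℝ) :
    w * oddShell j i r w = |w| * shellBump j i (|w| ^ 2 / 2 - r) := by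
  unfold oddShell
  rw [sq_abs]
  split_ifs with h
  · rw [abs_of_pos h]
  · rw [abs_of_nonpos (not_lt.1 h)]; ring

lemma oddShell_eventuallyEq_zero (j i : ℕ) {r : ℝ} (hr : 0 < r) :
    oddShell j i r =ᶠ[nhds 0] fun _ => 0 := by
  have : ∀ᶠ w : ℝ in nhds 0, w ^ 2 / 2 < r := by
    have hc : Continuous fun w : ℝ => w ^ 2 / 2 := by fun_prop
    exact hc.continuousAt.eventually_lt continuousAt_const (by simpa using hr)
  filter_upwards [this] with w hw
  simp [oddShell, shellBump_eq_zero j i (Or.inl (by linarith : w ^ 2 / 2 - r ≤ 0))]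

/-- For `r > 0` the shell stays away from `w = 0`, so the change of sign there does no harm. -/
lemma contDiff_oddShell (j i : ℕ) {r : ℝ} (hr : 0 < r) : ContDiff ℝ ∞ (oddShell j i r) := by
  have hs : ContDiff ℝ ∞ fun w : ℝ => shellBump j i (w ^ 2 / 2 - r) :=
    (contDiff_shellBump j i).comp (by fun_prop)
  rw [contDiff_iff_contDiffAt]
  intro w
  rcases lt_trichotomy w 0 with h | rfl | h
  · refine hs.neg.contDiffAt.congr_of_eventuallyEq ?_
    filter_upwards [Iio_mem_nhds h] with y hy
    rw [oddShell, if_neg (not_lt.2 (le_of_lt hy))]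
  · exact contDiffAt_const.congr_of_eventuallyEq (oddShell_eventuallyEq_zero j i hr)
  · refine hs.contDiffAt.congr_of_eventuallyEq ?_
    filter_upwards [Ioi_mem_nhds h] with y hy
    rw [oddShell, if_pos (mem_Ioi.1 hy)]

lemma deriv_oddShell (j i : ℕ) {r : ℝ} (hr : 0 < r) (w : ℝ) :
    deriv (oddShell j i r) w = |w| * shellBump j (i + 1) (|w| ^ 2 / 2 - r) := by
  have hs : HasDerivAt (fun w : ℝ => shellBump j i (w ^ 2 / 2 - r))
      (shellBump j (i + 1) (w ^ 2 / 2 - r) * w) w := by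
    have h1 : HasDerivAt (fun w : ℝ => w ^ 2 / 2 - r) w w := by
      have := ((hasDerivAt_pow 2 w).div_const 2).sub_const r
      simpa using this
    exact (hasDerivAt_shellBump j i (w ^ 2 / 2 - r)).comp w h1
  rw [sq_abs]
  rcases lt_trichotomy w 0 with h | rfl | h
  · have e : oddShell j i r =ᶠ[nhds w] fun w => -shellBump j i (w ^ 2 / 2 - r) := by
      filter_upwards [Iio_mem_nhds h] with y hy
      rw [oddShell, if_neg (not_lt.2 (le_of_lt hy))]
    rw [e.deriv_eq, hs.fun_neg.deriv, abs_of_neg h]; ring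
  · rw [(oddShell_eventuallyEq_zero j i hr).deriv_eq]; simp
  · have e : oddShell j i r =ᶠ[nhds w] fun w => shellBump j i (w ^ 2 / 2 - r) := by
      filter_upwards [Ioi_mem_nhds h] with y hy
      rw [oddShell, if_pos (mem_Ioi.1 hy)]
    rw [e.deriv_eq, hs.deriv, abs_of_pos h]; ring

lemma hasCompactSupport_oddShell (j i : ℕ) (r : ℝ) : HasCompactSupport (oddShell j i r) := by
  refine HasCompactSupport.of_support_subset_isCompact
    (isCompact_closedBall (0 : ℝ) (√(2 * (r + 1)))) fun w hw => ?_
  rw [Metric.mem_closedBall, Real.dist_eq, sub_zero]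
  apply Real.abs_le_sqrt
  by_contra hcon
  refine hw ?_
  simp [oddShell, shellBump_eq_zero j i (Or.inr (by linarith : 1 ≤ w ^ 2 / 2 - r))]

/-- A probability density which is even and unimodal about `c`. -/
structure IsUnimodal (c : ℝ) (F : ℝ → ℝ) : Prop where
  density : IsDensity F
  symm : ∀ v, F (2 * c - v) = F v
  antitone : AntitoneOn F (Ioi c)
  le_max : ∀ v, F v ≤ F c

section Unimodal

variable {c : ℝ} {F : ℝ → ℝ} (hF : IsUnimodal c F)
include hF

lemma IsUnimodal.abs_eq (w : ℝ) : F (c + |w|) = F (c + w) := by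
  rcases abs_choice w with h | h <;> rw [h]
  rw [← hF.symm (c + w)]; congr 1; ring

/-- Nonnegativity is given only almost everywhere; monotonicity spreads it, since `F` is nonnegative
at some point slightly farther from the centre. -/
lemma IsUnimodal.nonneg {v : ℝ} (hv : v ≠ c) : 0 ≤ F v := by
  have hpos : ∀ w, 0 < w → 0 ≤ F (c + w) := by
    intro w hw
    have hne : volume (Ioo (c + w) (c + w + 1)) ≠ 0 := by simp
    obtain ⟨v', hv', h0⟩ := Measure.exists_mem_of_measure_ne_zero_of_ae hne
      (ae_restrict_of_ae hF.density.nonneg)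
    exact h0.trans (hF.antitone (mem_Ioi.2 (by linarith)) (mem_Ioi.2 (by linarith [hv'.1]))
      hv'.1.le)
  have := hpos |v - c| (abs_pos.2 (sub_ne_zero.2 hv))
  rwa [hF.abs_eq, add_sub_cancel] at this

lemma IsUnimodal.integral_even {k : ℝ → ℝ} :
    ∫ v, F v * k |v - c| = 2 * ∫ w in Ioi (0 : ℝ), F (c + w) * k w := by
  rw [← integral_add_left_eq_self _ c, ← integral_comp_abs (f := fun w => F (c + w) * k w)]
  simp only [add_sub_cancel_left, hF.abs_eq]

lemma IsUnimodal.isProfile : IsProfile fun w => F (c + w) where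
  antitone := fun w hw w' hw' h => hF.antitone (mem_Ioi.2 (by linarith [mem_Ioi.1 hw]))
    (mem_Ioi.2 (by linarith [mem_Ioi.1 hw'])) (by linarith)
  nonneg := fun w hw => hF.nonneg (by linarith)
  integrable := (hF.density.integrable.comp_add_left c).integrableOn
  mass := by
    have h := hF.integral_even (k := fun _ => 1)
    simp only [mul_one] at h
    rw [hF.density.mass] at h
    linarith

lemma IsUnimodal.integral_odd {k : ℝ → ℝ} (hk : ∀ w, k (-w) = -k w) :
    ∫ v, F v * k (v - c) = 0 := by
  have h := integral_sub_left_eq_self (fun v => F v * k (v - c)) volume (2 * c)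
  have e : ∀ v, F (2 * c - v) * k (2 * c - v - c) = -(F v * k (v - c)) := fun v => by
    rw [hF.symm, show 2 * c - v - c = -(v - c) by ring, hk]; ring
  simp only [e, integral_neg] at h
  linarith

lemma IsUnimodal.integral_shell (j i : ℕ) (r : ℝ) :
    ∫ v, F v * (|v - c| * shellBump j i (|v - c| ^ 2 / 2 - r))
      = 2 * shellAverage (fun w => F (c + w)) j i r :=
  hF.integral_even (k := fun w => w * shellBump j i (w ^ 2 / 2 - r))

end Unimodal

lemma LocallyIntegrableOn.mul_bdd_spaceTime {Q N : ℝ × Torus → ℝ} {A : ℝ}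
    (hQ : LocallyIntegrableOn Q spaceTime volume)
    (hN : AEStronglyMeasurable N (volume.restrict spaceTime))
    (hA : ∀ᵐ p ∂(volume.restrict spaceTime), |N p| ≤ A) :
    LocallyIntegrableOn (fun p => Q p * N p) spaceTime volume := by
  rw [locallyIntegrableOn_iff isOpen_spaceTime.isLocallyClosed] at hQ ⊢
  intro K hK hKc
  exact (hQ K hK hKc).mul_bdd (c := A) (hN.mono_measure (Measure.restrict_mono hK le_rfl))
    (ae_restrict_of_ae_restrict_of_subset hK hA)

section Shells

variable {f : ℝ × Torus × ℝ → ℝ} {V E : ℝ × Torus → ℝ} {c : ℝ}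

/-- The average over an energy shell, as a function of `(t, x)`. -/
noncomputable def shellField (f : ℝ × Torus × ℝ → ℝ) (c : ℝ) (j i : ℕ) (r : ℝ) (p : ℝ × Torus) : ℝ :=
  shellAverage (fun w => f (p.1, p.2, c + w)) j i r

variable (hf : IsWeakSolution f V E)
  (hu : ∀ᵐ p ∂(volume.restrict spaceTime), IsUnimodal c fun v => f (p.1, p.2, v))
include hf hu

lemma IsWeakSolution.aestronglyMeasurable_shellField (j i : ℕ) (r : ℝ) :
    AEStronglyMeasurable (shellField f c j i r) (volume.restrict spaceTime) := by
  have hk : Continuous fun v : ℝ => |v - c| * shellBump j i (|v - c| ^ 2 / 2 - r) := by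
    have := (contDiff_shellBump j i).continuous
    fun_prop
  refine ((hf.aestronglyMeasurable_moment hk).mul_const (1 / 2)).congr ?_
  filter_upwards [hu] with p hp
  rw [moment, hp.integral_shell, shellField]; ring

omit hf in
lemma exists_bound_shellField (j i : ℕ) (r : ℝ) :
    ∃ A, ∀ᵐ p ∂(volume.restrict spaceTime), |shellField f c j i r p| ≤ A := by
  obtain ⟨A, -, hA⟩ := exists_bound_shellBump j i
  exact ⟨_, hu.mono fun p hp => hp.isProfile.abs_shellAverage_le hA le_rfl⟩

lemma IsWeakSolution.locallyIntegrableOn_mul_shellField {Q : ℝ × Torus → ℝ}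
    (hQ : LocallyIntegrableOn Q spaceTime volume) (j i : ℕ) (r : ℝ) :
    LocallyIntegrableOn (fun p => Q p * shellField f c j i r p) spaceTime volume := by
  obtain ⟨A, hA⟩ := exists_bound_shellField hu j i r
  exact LocallyIntegrableOn.mul_bdd_spaceTime hQ (hf.aestronglyMeasurable_shellField hu j i r) hA

/-- With the odd shell as test function, evenness of `f` about `c` annihilates the time-derivative
term and the part `c ∂ₓ` of the transport. Multiplication by `v - c` and differentiation in `v` both
return even shells, of orders `i` and `i + 1`, which closes the equation on shell averages. -/
lemma IsWeakSolution.shell_equation {χ : ℝ → ℝ} {η : Torus → ℝ} (hχ : IsTimeTest χ)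
    (hη : ContDiff ℝ ∞ fun x : ℝ => η (x : Torus)) (j i : ℕ) {r : ℝ} (hr : 0 < r) :
    ∫ p in spaceTime, χ p.1 * (torusDeriv η p.2 * shellField f c j i r p
      + η p.2 * (E p * shellField f c j (i + 1) r p)) = 0 := by
  have hh : ContDiff ℝ ∞ fun v => oddShell j i r (v - c) :=
    (contDiff_oddShell j i hr).comp (contDiff_id.sub contDiff_const)
  have hc : HasCompactSupport fun v => oddShell j i r (v - c) :=
    (hasCompactSupport_oddShell j i r).comp_homeomorph (Homeomorph.subRight c)
  have h := hf.moment_equation hχ hη hh hc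
  have e : ∫ p in spaceTime, (deriv χ p.1 * η p.2 * moment f (fun v => oddShell j i r (v - c)) p
      + χ p.1 * torusDeriv η p.2 * moment f (fun v => v * oddShell j i r (v - c)) p
      + χ p.1 * (η p.2 * E p) * moment f (deriv fun v => oddShell j i r (v - c)) p)
      = ∫ p in spaceTime, 2 * (χ p.1 * (torusDeriv η p.2 * shellField f c j i r p
      + η p.2 * (E p * shellField f c j (i + 1) r p))) := by
    refine integral_congr_ae ?_
    filter_upwards [hu] with p hp
    have m1 : moment f (fun v => oddShell j i r (v - c)) p = 0 :=
      hp.integral_odd (oddShell_neg j i hr)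
    have m2 : moment f (fun v => v * oddShell j i r (v - c)) p = 2 * shellField f c j i r p := by
      obtain ⟨A, hA⟩ := hh.continuous.bounded_above_of_compact_support hc
      obtain ⟨B, hB⟩ := (continuous_id.mul hh.continuous).bounded_above_of_compact_support
        (hc.mul_left (f := fun v => v))
      have i1 := hp.density.integrable_mul hh.continuous hA
      have i2 := hp.density.integrable_mul (k := fun v => v * oddShell j i r (v - c))
        (continuous_id.mul hh.continuous) hB
      have h3 := hp.integral_shell j i r
      simp only [← mul_oddShell, sub_mul, mul_sub] at h3
      rw [integral_sub i2 (by simpa only [mul_left_comm] using i1.const_mul c)] at h3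
      simp only [mul_left_comm _ c] at h3
      rw [integral_const_mul] at h3
      have h4 : ∫ v, f (p.1, p.2, v) * oddShell j i r (v - c) = 0 := m1
      rw [h4] at h3
      simpa [moment, shellField] using h3
    have m3 : moment f (deriv fun v => oddShell j i r (v - c)) p
        = 2 * shellField f c j (i + 1) r p := by
      have hd : (deriv fun v => oddShell j i r (v - c))
          = fun v => |v - c| * shellBump j (i + 1) (|v - c| ^ 2 / 2 - r) := by
        funext v
        rw [deriv_comp_sub_const, deriv_oddShell j i hr]
      rw [hd]
      exact hp.integral_shell j (i + 1) r
    rw [m1, m2, m3]; ring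
  rw [e, integral_const_mul] at h
  exact (mul_eq_zero.1 h).resolve_left two_ne_zero

/-- An even shell as test function now sees the time derivative; the flux vanishes since the space
factor is `1`, and the field term since `E = 0`. -/
lemma IsWeakSolution.shell_time_equation (hE0 : ∀ᵐ p ∂(volume.restrict spaceTime), E p = 0)
    {χ : ℝ → ℝ} (hχ : IsTimeTest χ) (j i : ℕ) {r : ℝ} (hr : 0 < r) :
    ∫ p in spaceTime, deriv χ p.1 * shellField f c j i r p = 0 := by
  have hh : ContDiff ℝ ∞ fun v => (v - c) * oddShell j i r (v - c) :=
    (contDiff_id.mul (contDiff_oddShell j i hr)).comp (contDiff_id.sub contDiff_const)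
  have hc : HasCompactSupport fun v => (v - c) * oddShell j i r (v - c) :=
    ((hasCompactSupport_oddShell j i r).comp_homeomorph (Homeomorph.subRight c)).mul_left
  have h := hf.moment_equation (η := fun _ => 1) hχ contDiff_const hh hc
  have e : ∀ᵐ p ∂(volume.restrict spaceTime),
      deriv χ p.1 * 1 * moment f (fun v => (v - c) * oddShell j i r (v - c)) p
      + χ p.1 * torusDeriv (fun _ => 1) p.2
        * moment f (fun v => v * ((v - c) * oddShell j i r (v - c))) p
      + χ p.1 * (1 * E p) * moment f (deriv fun v => (v - c) * oddShell j i r (v - c)) p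
      = 2 * (deriv χ p.1 * shellField f c j i r p) := by
    filter_upwards [hu, hE0] with p hp hE
    have m1 : moment f (fun v => (v - c) * oddShell j i r (v - c)) p
        = 2 * shellField f c j i r p := by
      simp only [mul_oddShell]
      exact hp.integral_shell j i r
    have : torusDeriv (fun _ => 1) p.2 = 0 := by simp [torusDeriv]
    rw [m1, hE, this]; ring
  rw [integral_congr_ae e, integral_const_mul] at h
  exact (mul_eq_zero.1 h).resolve_left two_ne_zero

end Shells

/-! ### Vanishing of the electric field. -/

lemma volume_restrict_phaseSpaceTime : (volume : Measure (ℝ × Torus × ℝ)).restrict phaseSpaceTime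
    = (volume.restrict (Ioi 0)).prod volume := by
  rw [phaseSpaceTime, Measure.volume_eq_prod, ← Measure.prod_restrict, Measure.restrict_univ]

section Field

variable {f : ℝ × Torus × ℝ → ℝ} {V E : ℝ × Torus → ℝ} {c : ℝ}

lemma ae_ae_of_ae_spaceTime {p : ℝ × Torus → Prop} (h : ∀ᵐ q ∂(volume.restrict spaceTime), p q) :
    ∀ᵐ t ∂(volume.restrict (Ioi (0 : ℝ))), ∀ᵐ x, p (t, x) := by
  rw [volume_restrict_spaceTime] at h
  exact Measure.ae_ae_of_ae_prod h

/-- The exceptional times must not depend on the real parameter `r`, so measurability is deduced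
from that of the single slice `f(t, ·, ·)`. -/
lemma IsWeakSolution.ae_aestronglyMeasurable_shell (hf : IsWeakSolution f V E) (c : ℝ) :
    ∀ᵐ t ∂(volume.restrict (Ioi (0 : ℝ))), ∀ j i r,
      AEStronglyMeasurable (fun x => shellField f c j i r (t, x)) volume := by
  have hm := hf.measurable
  rw [volume_restrict_phaseSpaceTime] at hm
  filter_upwards [hm.prodMk_left] with t ht j i r
  have hmp : MeasurePreserving (Prod.map id (fun w => c + w) : Torus × ℝ → Torus × ℝ)
      (volume.prod volume) (volume.prod volume) :=
    (MeasurePreserving.id volume).prod (measurePreserving_add_left volume c)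
  have h1 : AEStronglyMeasurable (fun q : Torus × ℝ => f (t, q.1, c + q.2))
      (volume.prod volume) := ht.comp_measurePreserving hmp
  have h2 : AEStronglyMeasurable (fun q : Torus × ℝ => f (t, q.1, c + q.2))
      (volume.prod (volume.restrict (Ioi 0))) := h1.mono_measure (by
    rw [← Measure.restrict_univ (μ := (volume : Measure Torus)), Measure.prod_restrict]
    rw [Measure.restrict_univ]
    exact Measure.restrict_le_self)
  have hk : Continuous fun w : ℝ => w * shellBump j i (w ^ 2 / 2 - r) := by
    have := (contDiff_shellBump j i).continuous
    fun_prop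
  exact (h2.mul (hk.comp continuous_snd).aestronglyMeasurable).integral_prod_right'

lemma MemLinftyL1.ae_integrable (hE : MemLinftyL1 E) :
    ∀ᵐ t ∂(volume.restrict (Ioi (0 : ℝ))), Integrable fun x => E (t, x) := by
  obtain ⟨hm, C, hC⟩ := hE
  rw [volume_restrict_spaceTime] at hm
  filter_upwards [hm.prodMk_left, hC] with t ht1 ht2
  exact ⟨ht1, ht2.trans_lt ENNReal.coe_lt_top⟩

/-- Countably many test functions and rational energies give one null set of times; outside it the
sliced identities integrate to the primitive form. The indicator makes the periodic field integrable
on the whole line. -/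
lemma IsWeakSolution.ae_isStationary (hf : IsWeakSolution f V E) (hE : MemLinftyL1 E)
    (hu : ∀ᵐ p ∂(volume.restrict spaceTime), IsUnimodal c fun v => f (p.1, p.2, v)) :
    ∀ᵐ t ∂(volume.restrict (Ioi (0 : ℝ))),
      IsStationary ((Ioc (0 : ℝ) 1).indicator fun x => E (t, (x : Torus)))
        (fun x w => f (t, (x : Torus), c + w)) := by
  have hslice : ∀ᵐ t ∂(volume.restrict (Ioi (0 : ℝ))), ∀ j i, ∀ r : ℚ, ∀ k, 0 < r →
      ∫ x, (torusDeriv (trig k) x * shellField f c j i r (t, x)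
        + trig k x * (E (t, x) * shellField f c j (i + 1) r (t, x))) = 0 := by
    refine ae_all_iff.2 fun j => ae_all_iff.2 fun i => ae_all_iff.2 fun r => ae_all_iff.2 fun k => ?_
    by_cases hr : 0 < r
    swap
    · exact Filter.Eventually.of_forall fun t h => absurd h hr
    have hloc : LocallyIntegrableOn (fun p : ℝ × Torus =>
        torusDeriv (trig k) p.2 * shellField f c j i r p
        + trig k p.2 * (E p * shellField f c j (i + 1) r p)) spaceTime volume := by
      refine LocallyIntegrableOn.add ?_ ?_
      · refine hf.locallyIntegrableOn_mul_shellField hu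
          (Q := fun p => torusDeriv (trig k) p.2) ?_ j i r
        exact ((continuous_torusDeriv (contDiff_trig k)).comp continuous_snd).locallyIntegrable
          |>.locallyIntegrableOn _
      · exact (hf.locallyIntegrableOn_mul_shellField hu hf.field.field_locInt j (i + 1)
          r).continuousOn_mul ((continuous_torus_of_lift
            (contDiff_trig k).continuous).comp continuous_snd).continuousOn
            isOpen_spaceTime.isLocallyClosed
    filter_upwards [ae_integral_torus_eq_zero hloc fun χ hχ =>
      hf.shell_equation hu hχ (contDiff_trig k) j i (by exact_mod_cast hr)] with t ht _ using ht
  have hmp := UnitAddCircle.measurePreserving_mk 0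
  rw [zero_add] at hmp
  filter_upwards [hslice, hE.ae_integrable, hf.ae_aestronglyMeasurable_shell c,
    ae_ae_of_ae_spaceTime hu] with t hslice hEt hmt hut
  have hEi : IntegrableOn (fun x : ℝ => E (t, (x : Torus))) (Ioc 0 1) :=
    hmp.integrable_comp_of_integrable hEt
  have hmeas : ∀ j i r, AEStronglyMeasurable
      (fun x : ℝ => shellField f c j i r (t, (x : Torus))) (volume.restrict (Ioc 0 1)) :=
    fun j i r => (hmt j i r).comp_measurePreserving hmp
  have hprof : ∀ᵐ x : ℝ ∂(volume.restrict (Ioc (0 : ℝ) 1)),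
      IsProfile fun w => f (t, (x : Torus), c + w) :=
    (ae_torus_iff.1 hut).mono fun x hx => hx.isProfile
  refine ⟨hEi.integrable_indicator measurableSet_Ioc, hprof, hmeas, fun j i r hr => ?_⟩
  obtain ⟨A, -, hA⟩ := exists_bound_shellBump j i
  obtain ⟨B, -, hB⟩ := exists_bound_shellBump j (i + 1)
  refine ae_eq_primitive_of_trig (u := fun x : ℝ => shellField f c j i r (t, (x : Torus)))
    (φ := fun x : ℝ => (Ioc (0 : ℝ) 1).indicator (fun x => E (t, (x : Torus))) x
      * shellField f c j (i + 1) r (t, (x : Torus)))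
    (hmeas j i r) (hprof.mono fun x hx => hx.abs_shellAverage_le hA le_rfl) ?_ fun k => ?_
  · exact Integrable.mul_bdd (hEi.integrable_indicator measurableSet_Ioc).integrableOn
      (hmeas j (i + 1) r) (hprof.mono fun x hx => hx.abs_shellAverage_le hB le_rfl)
  · have h := hslice j i r k hr
    rw [integral_torus_eq] at h
    refine Eq.trans ?_ h
    rw [intervalIntegral.integral_of_le zero_le_one, intervalIntegral.integral_of_le zero_le_one]
    refine setIntegral_congr_fun measurableSet_Ioc fun x hx => ?_
    simp only [torusDeriv_coe, indicator_of_mem hx]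
    ring

/-- The electric field vanishes. -/
theorem IsWeakSolution.field_ae_eq_zero (hf : IsWeakSolution f V E) (hE : MemLinftyL1 E)
    (hu : ∀ᵐ p ∂(volume.restrict spaceTime), IsUnimodal c fun v => f (p.1, p.2, v)) :
    ∀ᵐ p ∂(volume.restrict spaceTime), E p = 0 := by
  have hm := hE.1
  rw [volume_restrict_spaceTime] at hm ⊢
  refine ae_eq_prod_of_ae_ae hm aestronglyMeasurable_const (g := fun _ => 0) ?_
  filter_upwards [hf.ae_isStationary hE hu] with t ht
  rw [ae_torus_iff]
  filter_upwards [ht.field_eq_zero, ae_restrict_mem measurableSet_Ioc] with x hx hxI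
  rwa [indicator_of_mem hxI] at hx

/-! ### Rigidity of the profile once the field vanishes. -/

lemma IsWeakSolution.exists_shellField_eq (hf : IsWeakSolution f V E) (hE : MemLinftyL1 E)
    (hu : ∀ᵐ p ∂(volume.restrict spaceTime), IsUnimodal c fun v => f (p.1, p.2, v))
    (j i : ℕ) {r : ℝ} (hr : 0 < r) :
    ∃ C, ∀ᵐ p ∂(volume.restrict spaceTime), shellField f c j i r p = C := by
  have hE0 := hf.field_ae_eq_zero hE hu
  obtain ⟨A, hA⟩ := exists_bound_shellField hu j i r
  refine ae_eq_const_of_weak_deriv ?_ ?_ (fun χ k hχ => ?_) (fun χ hχ => ?_)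
  · simpa using hf.locallyIntegrableOn_mul_shellField hu locallyIntegrableOn_one j i r
  · filter_upwards [ae_ae_of_ae_spaceTime hA] with t ht using ⟨A, ht⟩
  · rw [← hf.shell_equation hu hχ (contDiff_trig k) j i hr]
    refine integral_congr_ae ?_
    filter_upwards [hE0] with p hp
    rw [hp]; ring
  · exact hf.shell_time_equation hu hE0 hχ j i hr

/-- A thin shell with rational start fits between the energies of `w` and `w'`, and its common
average separates the two values. -/
lemma IsProfile.le_of_shellAverage_eq {Γ Γ' : ℝ → ℝ} (hΓ : IsProfile Γ) (hΓ' : IsProfile Γ')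
    (h : ∀ j, ∀ r : ℚ, 0 < r → shellAverage Γ j 0 r = shellAverage Γ' j 0 r) {w w' : ℝ}
    (hw : 0 < w) (hww' : w < w') : Γ w' ≤ Γ' w := by
  have hlt : w ^ 2 / 2 < w' ^ 2 / 2 := by nlinarith
  obtain ⟨r, hr1, hr2⟩ := exists_rat_btwn hlt
  have hr0 : (0 : ℝ) < r := lt_trans (by positivity) hr1
  obtain ⟨j, hj⟩ := exists_nat_one_div_lt (sub_pos.2 hr2)
  calc Γ w' ≤ shellAverage Γ j 0 r :=
        hΓ.le_shellAverage j hr0.le (hw.trans hww') (by linarith)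
    _ = shellAverage Γ' j 0 r := h j r (by exact_mod_cast hr0)
    _ ≤ Γ' w := hΓ'.shellAverage_le j hr0 hw hr1.le

/-- The profiles interlace, so they agree wherever `Γ'` is continuous, which fails at most on a
countable set. Composing with `exp` turns `Γ'` into an antitone function on the whole line. -/
lemma IsProfile.ae_eq_of_shellAverage_eq {Γ Γ' : ℝ → ℝ} (hΓ : IsProfile Γ) (hΓ' : IsProfile Γ')
    (h : ∀ j, ∀ r : ℚ, 0 < r → shellAverage Γ j 0 r = shellAverage Γ' j 0 r) :
    ∀ᵐ w : ℝ, 0 < w → Γ w = Γ' w := by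
  have hanti : Antitone fun s : ℝ => Γ' (Real.exp s) := fun s s' hs =>
    hΓ'.antitone (mem_Ioi.2 (Real.exp_pos _)) (mem_Ioi.2 (Real.exp_pos _)) (Real.exp_le_exp.2 hs)
  have hcount := (hanti.countable_not_continuousAt).image Real.exp
  refine (hcount.ae_notMem volume).mono fun w hw hw0 => ?_
  have hcont : ContinuousAt (fun s : ℝ => Γ' (Real.exp s)) (Real.log w) := by
    by_contra hcon
    exact hw ⟨Real.log w, hcon, Real.exp_log hw0⟩
  have hc : Filter.Tendsto (fun s : ℝ => Γ' (Real.exp s)) (nhds (Real.log w)) (nhds (Γ' w)) := by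
    have := hcont.tendsto
    rwa [Real.exp_log hw0] at this
  refine le_antisymm ?_ ?_
  · refine ge_of_tendsto (hc.mono_left (nhdsWithin_le_nhds (s := Iio (Real.log w)))) ?_
    filter_upwards [self_mem_nhdsWithin] with s hs
    exact hΓ.le_of_shellAverage_eq hΓ' h (Real.exp_pos s) ((Real.lt_log_iff_exp_lt hw0).1 hs)
  · refine le_of_tendsto (hc.mono_left (nhdsWithin_le_nhds (s := Ioi (Real.log w)))) ?_
    filter_upwards [self_mem_nhdsWithin] with s hs
    exact hΓ'.le_of_shellAverage_eq hΓ (fun j r hr => (h j r hr).symm) hw0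
      ((Real.log_lt_iff_lt_exp hw0).1 hs)

/-- The distribution function is, almost everywhere, a fixed unimodal function of `v`. -/
theorem IsWeakSolution.exists_unimodal_ae_eq (hf : IsWeakSolution f V E) (hE : MemLinftyL1 E)
    (hu : ∀ᵐ p ∂(volume.restrict spaceTime), IsUnimodal c fun v => f (p.1, p.2, v)) :
    ∃ F, IsUnimodal c F ∧ ∀ᵐ p ∂(volume.restrict spaceTime), ∀ᵐ v, f (p.1, p.2, v) = F v := by
  have hC : ∀ j, ∀ r : ℚ, ∃ C, 0 < r →
      ∀ᵐ p ∂(volume.restrict spaceTime), shellField f c j 0 r p = C := by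
    intro j r
    by_cases hr : 0 < r
    · obtain ⟨C, hC⟩ := hf.exists_shellField_eq hE hu j 0 (r := r) (by exact_mod_cast hr)
      exact ⟨C, fun _ => hC⟩
    · exact ⟨0, fun h => absurd h hr⟩
  choose C hC using hC
  have hall : ∀ᵐ p ∂(volume.restrict spaceTime), (IsUnimodal c fun v => f (p.1, p.2, v)) ∧
      ∀ j, ∀ r : ℚ, 0 < r → shellField f c j 0 r p = C j r := by
    refine hu.and (ae_all_iff.2 fun j => ae_all_iff.2 fun r => ?_)
    by_cases hr : 0 < r
    · filter_upwards [hC j r hr] with p hp _ using hp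
    · exact Filter.Eventually.of_forall fun p h => absurd h hr
  have hne : (volume.restrict spaceTime) ≠ (0 : Measure (ℝ × Torus)) := fun h0 =>
    isOpen_spaceTime.measure_ne_zero volume ⟨(1, 0), by simp [spaceTime]⟩
      (Measure.restrict_eq_zero.1 h0)
  have : (ae (volume.restrict spaceTime)).NeBot := ae_neBot.2 hne
  -- The fixed profile is the slice of `f` at any one generic point.
  obtain ⟨p₀, hp₀, hC₀⟩ := hall.exists
  refine ⟨fun v => f (p₀.1, p₀.2, v), hp₀, ?_⟩
  filter_upwards [hall] with p ⟨hp, hCp⟩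
  have hae := hp.isProfile.ae_eq_of_shellAverage_eq hp₀.isProfile fun j r hr =>
    (hCp j r hr).trans (hC₀ j r hr).symm
  have habs : ∀ᵐ w : ℝ, f (p.1, p.2, c + w) = f (p₀.1, p₀.2, c + w) := by
    have hneg : ∀ᵐ w : ℝ, 0 < -w → f (p.1, p.2, c + -w) = f (p₀.1, p₀.2, c + -w) :=
      (Measure.measurePreserving_neg (volume : Measure ℝ)).quasiMeasurePreserving.ae hae
    have hne0 : ∀ᵐ w : ℝ, w ≠ 0 := by simp [ae_iff]
    filter_upwards [hae, hneg, hne0] with w h1 h2 h3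
    rw [← hp.abs_eq, ← hp₀.abs_eq]
    rcases lt_or_gt_of_ne h3 with h | h
    · rw [abs_of_neg h]; exact h2 (by linarith)
    · rw [abs_of_pos h]; exact h1 h
  have := (measurePreserving_add_left (volume : Measure ℝ) (-c)).quasiMeasurePreserving.ae habs
  filter_upwards [this] with v hv
  simpa using hv

end Field

/-! ### The profile as a function of the energy, and its normalisation. -/

/-- The profile `φ` with `F v = φ (-|v - c|² / 2)` for `v ≠ c`, continued to `u ≥ 0` by its limit
from the left at `0`. -/
noncomputable def energyProfile (c : ℝ) (F : ℝ → ℝ) (u : ℝ) : ℝ :=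
  if u < 0 then F (c + √(-2 * u)) else sSup ((fun w => F (c + w)) '' Ioi 0)

namespace IsUnimodal

variable {c : ℝ} {F : ℝ → ℝ}

lemma le_sSup (h : IsUnimodal c F) {w : ℝ} (hw : 0 < w) :
    F (c + w) ≤ sSup ((fun w => F (c + w)) '' Ioi 0) :=
  le_csSup ⟨F c, by rintro _ ⟨w, -, rfl⟩; exact h.le_max _⟩ ⟨w, hw, rfl⟩

lemma sSup_le {M : ℝ} (h : ∀ w, 0 < w → F (c + w) ≤ M) :
    sSup ((fun w => F (c + w)) '' Ioi 0) ≤ M :=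
  csSup_le (nonempty_Ioi.image _) (by rintro _ ⟨w, hw, rfl⟩; exact h w hw)

lemma energyProfile_nonneg (h : IsUnimodal c F) (u : ℝ) : 0 ≤ energyProfile c F u := by
  rw [energyProfile]
  split_ifs with hu
  · have : 0 < √(-2 * u) := Real.sqrt_pos.2 (by linarith)
    exact h.nonneg (by linarith)
  · exact (h.nonneg (by linarith : c + 1 ≠ c)).trans (h.le_sSup one_pos)

lemma monotone_energyProfile (h : IsUnimodal c F) : Monotone (energyProfile c F) := by
  intro u u' huu'
  have hpos : ∀ {u : ℝ}, u < 0 → 0 < √(-2 * u) := fun hu => Real.sqrt_pos.2 (by linarith)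
  rw [energyProfile, energyProfile]
  split_ifs with hu hu' hu'
  · exact h.antitone (lt_add_of_pos_right c (hpos hu')) (lt_add_of_pos_right c (hpos hu))
      (by have := Real.sqrt_le_sqrt (show -2 * u' ≤ -2 * u by linarith); linarith)
  · exact h.le_sSup (hpos hu)
  · exact absurd (huu'.trans_lt hu') hu
  · exact le_rfl

lemma energyProfile_eq (h : IsUnimodal c F) {v : ℝ} (hv : v ≠ c) :
    energyProfile c F (-(|v - c| ^ 2 / 2)) = F v := by
  have h0 : 0 < |v - c| := abs_pos.2 (sub_ne_zero.2 hv)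
  rw [energyProfile, if_pos (by have := sq_pos_of_pos h0; linarith),
    show -2 * -(|v - c| ^ 2 / 2) = |v - c| ^ 2 by ring, Real.sqrt_sq h0.le, h.abs_eq]
  congr 1
  ring

lemma energyProfile_zero : energyProfile c F 0 = sSup ((fun w => F (c + w)) '' Ioi 0) := by
  rw [energyProfile, if_neg (lt_irrefl _)]

lemma image_neg_sq_half : (fun w : ℝ => -(w ^ 2 / 2)) '' Ioi 0 = Iio 0 := by
  ext u
  constructor
  · rintro ⟨w, hw, rfl⟩
    have := sq_pos_of_pos (mem_Ioi.1 hw)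
    simp only [mem_Iio]; linarith
  · intro hu
    have hu' : u < 0 := hu
    refine ⟨√(-2 * u), Real.sqrt_pos.2 (by linarith), ?_⟩
    simp only
    rw [Real.sq_sqrt (by linarith)]
    ring

lemma injOn_neg_sq_half : InjOn (fun w : ℝ => -(w ^ 2 / 2)) (Ioi 0) := by
  intro a ha b hb hab
  have ha' : 0 < a := ha
  have hb' : 0 < b := hb
  have : a ^ 2 = b ^ 2 := by simp only at hab; linarith
  exact (sq_eq_sq₀ ha'.le hb'.le).1 this

lemma hasDerivAt_neg_sq_half (w : ℝ) : HasDerivAt (fun w : ℝ => -(w ^ 2 / 2)) (-w) w :=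
  ((hasDerivAt_pow 2 w).div_const 2).neg.congr_deriv (by norm_num)

/-- Under `u = -w² / 2` the Jacobian `w` meets `√(-u) = w / √2`, leaving the factor `√2`; with the
half-mass `1 / 2` this produces the value `1 / √2`. -/
lemma abs_deriv_smul_energyProfile (h : IsUnimodal c F) {w : ℝ} (hw : 0 < w) :
    |(-w)| • (energyProfile c F (-(w ^ 2 / 2)) / √(-(-(w ^ 2 / 2)))) = √2 * F (c + w) := by
  have h1 := h.energyProfile_eq (v := c + w) (by linarith)
  rw [add_sub_cancel_left, abs_of_pos hw] at h1
  have h2 : √2 * √2 = 2 := Real.mul_self_sqrt (by norm_num)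
  have h3 : 0 < √(2 : ℝ) := Real.sqrt_pos.2 (by norm_num)
  rw [h1, abs_neg, abs_of_pos hw, neg_neg, Real.sqrt_div (sq_nonneg w), Real.sqrt_sq hw.le,
    smul_eq_mul]
  field_simp

lemma integrableOn_energyProfile (h : IsUnimodal c F) :
    IntegrableOn (fun u => energyProfile c F u / √(-u)) (Iio 0) := by
  rw [← image_neg_sq_half, integrableOn_image_iff_integrableOn_abs_deriv_smul measurableSet_Ioi
    (fun w _ => (hasDerivAt_neg_sq_half w).hasDerivWithinAt) injOn_neg_sq_half]
  exact IntegrableOn.congr_fun (h.isProfile.integrable.const_mul √2)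
    (fun w hw => (h.abs_deriv_smul_energyProfile hw).symm) measurableSet_Ioi

lemma integral_energyProfile (h : IsUnimodal c F) :
    ∫ u in Iio (0 : ℝ), energyProfile c F u / √(-u) = 1 / √2 := by
  rw [← image_neg_sq_half, integral_image_eq_integral_abs_deriv_smul measurableSet_Ioi
    (fun w _ => (hasDerivAt_neg_sq_half w).hasDerivWithinAt) injOn_neg_sq_half,
    setIntegral_congr_fun measurableSet_Ioi fun w hw => h.abs_deriv_smul_energyProfile hw,
    integral_const_mul, h.isProfile.mass, mul_one_div, Real.sqrt_div_self']

end IsUnimodal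

/-! ### Values at points of continuity, including `t = 0`. -/

section PointwiseValues

variable {f : ℝ × Torus × ℝ → ℝ} {c : ℝ} {φ : ℝ → ℝ}

/-- Every neighbourhood of the point meets the open set `{t > 0, v ∈ U}` in a nonempty open set,
which has positive measure and so contains a point satisfying `P`. -/
lemma frequently_of_ae_phaseSpaceTime {P : ℝ × Torus × ℝ → Prop}
    (h : ∀ᵐ p ∂(volume.restrict phaseSpaceTime), P p) {t : ℝ} (ht : 0 ≤ t) (x : Torus) (v : ℝ)
    {U : Set ℝ} (hU : IsOpen U) (hv : v ∈ closure U) :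
    ∃ᶠ q in nhdsWithin (t, x, v) (Ici 0 ×ˢ univ), q.2.2 ∈ U ∧ P q := by
  rw [Filter.frequently_iff]
  intro N hN
  obtain ⟨W, hW, hWm, hWN⟩ := mem_nhdsWithin.1 hN
  set O : Set (ℝ × Torus × ℝ) := Ioi 0 ×ˢ univ ×ˢ U with hO
  have hOo : IsOpen O := isOpen_Ioi.prod (isOpen_univ.prod hU)
  have hcl : (t, x, v) ∈ closure O := by
    rw [hO, closure_prod_eq, closure_prod_eq, closure_Ioi, closure_univ]
    exact ⟨ht, mem_univ _, hv⟩
  have hne : (W ∩ O).Nonempty := mem_closure_iff.1 hcl W hW hWm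
  have hsub : W ∩ O ⊆ phaseSpaceTime := fun q hq => ⟨hq.2.1, mem_univ _⟩
  have hpos : volume (W ∩ O) ≠ 0 := (hW.inter hOo).measure_ne_zero volume hne
  have h' : ∀ᵐ p ∂(volume.restrict (W ∩ O)), P p :=
    ae_restrict_of_ae_restrict_of_subset hsub h
  have : (ae (volume.restrict (W ∩ O))).NeBot :=
    ae_neBot.2 fun h0 => hpos (Measure.restrict_eq_zero.1 h0)
  obtain ⟨q, hq, hqm⟩ := (h'.and (ae_restrict_mem (hW.inter hOo).measurableSet)).exists
  exact ⟨q, hWN ⟨hqm.1, Ioi_subset_Ici_self hqm.2.1, mem_univ _⟩, hqm.2.2.2, hq⟩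

/-- The point is approached through velocities farther from `c`, where the almost everywhere formula
and monotonicity bound `f` above by the value of `φ` at the limiting energy. The companion
`energy_le_of_continuousWithinAt` approaches from closer velocities. -/
lemma le_energy_of_continuousWithinAt (hφ : Monotone φ)
    (h : ∀ᵐ p ∂(volume.restrict phaseSpaceTime), f p = φ (-(|p.2.2 - c| ^ 2 / 2)))
    {t : ℝ} (ht : 0 ≤ t) {x : Torus} {v : ℝ}
    (hc : ContinuousWithinAt f (Ici 0 ×ˢ univ) (t, x, v)) :
    f (t, x, v) ≤ φ (-(|v - c| ^ 2 / 2)) := by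
  have hO : IsOpen {v' : ℝ | |v - c| < |v' - c|} := isOpen_lt (by fun_prop) (by fun_prop)
  have hcl : v ∈ closure {v' : ℝ | |v - c| < |v' - c|} := by
    rw [Metric.mem_closure_iff]
    intro ε hε
    rcases le_or_gt c v with hcv | hcv
    · refine ⟨v + ε / 2, ?_, by rw [Real.dist_eq, abs_lt]; constructor <;> linarith⟩
      rw [mem_ofPred_eq, abs_of_nonneg (by linarith), abs_of_nonneg (by linarith)]; linarith
    · refine ⟨v - ε / 2, ?_, by rw [Real.dist_eq, abs_lt]; constructor <;> linarith⟩
      rw [mem_ofPred_eq, abs_of_neg (by linarith), abs_of_neg (by linarith)]; linarith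
  refine le_of_tendsto_of_frequently hc ((frequently_of_ae_phaseSpaceTime h ht x v hO hcl).mono ?_)
  rintro q ⟨hq1, hq2⟩
  rw [hq2]
  have hq1' : |v - c| < |q.2.2 - c| := hq1
  exact hφ (by gcongr)

lemma energy_le_of_continuousWithinAt (hφ : Monotone φ)
    (h : ∀ᵐ p ∂(volume.restrict phaseSpaceTime), f p = φ (-(|p.2.2 - c| ^ 2 / 2)))
    {t : ℝ} (ht : 0 ≤ t) {x : Torus} {v r : ℝ} (hr : 0 < r) (hv : |v - c| ≤ r)
    (hc : ContinuousWithinAt f (Ici 0 ×ˢ univ) (t, x, v)) :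
    φ (-(r ^ 2 / 2)) ≤ f (t, x, v) := by
  have hcl : v ∈ closure (Metric.ball c r) := by
    rw [closure_ball c hr.ne', Metric.mem_closedBall, Real.dist_eq]
    exact hv
  refine ge_of_tendsto_of_frequently hc
    ((frequently_of_ae_phaseSpaceTime h ht x v Metric.isOpen_ball hcl).mono ?_)
  rintro q ⟨hq1, hq2⟩
  rw [hq2]
  rw [Metric.mem_ball, Real.dist_eq] at hq1
  exact hφ (by gcongr)

lemma IsUnimodal.eq_energyProfile_of_continuousWithinAt {F : ℝ → ℝ} (hF : IsUnimodal c F)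
    (h : ∀ᵐ p ∂(volume.restrict phaseSpaceTime),
      f p = energyProfile c F (-(|p.2.2 - c| ^ 2 / 2)))
    {t : ℝ} (ht : 0 ≤ t) {x : Torus} {v : ℝ}
    (hc : ContinuousWithinAt f (Ici 0 ×ˢ univ) (t, x, v)) :
    f (t, x, v) = energyProfile c F (-(|v - c| ^ 2 / 2)) := by
  have hφ := hF.monotone_energyProfile
  refine le_antisymm (le_energy_of_continuousWithinAt hφ h ht hc) ?_
  -- At `v = c` no velocity is strictly closer, so the lower bound is taken over all `r > 0`. Their
  -- supremum is exactly the value given to the profile at energy `0`; the value `F c` of the chosen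
  -- slice plays no role.
  by_cases hv : v = c
  · subst hv
    rw [show -(|v - v| ^ 2 / 2) = (0 : ℝ) by simp, energyProfile_zero]
    refine sSup_le fun w hw => ?_
    have h1 := hF.energyProfile_eq (v := v + w) (by linarith)
    rw [add_sub_cancel_left, abs_of_pos hw] at h1
    rw [← h1]
    exact energy_le_of_continuousWithinAt hφ h ht hw (by simpa using hw.le) hc
  · exact energy_le_of_continuousWithinAt hφ h ht (abs_pos.2 (sub_ne_zero.2 hv)) le_rfl hc

end PointwiseValues

lemma IsWeakSolution.ae_eq_energyProfile {f : ℝ × Torus × ℝ → ℝ} {V E : ℝ × Torus → ℝ} {c : ℝ}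
    (hf : IsWeakSolution f V E) {F : ℝ → ℝ} (hF : IsUnimodal c F)
    (h : ∀ᵐ p ∂(volume.restrict spaceTime), ∀ᵐ v, f (p.1, p.2, v) = F v) :
    ∀ᵐ p ∂(volume.restrict phaseSpaceTime),
      f p = energyProfile c F (-(|p.2.2 - c| ^ 2 / 2)) := by
  have hm : Measurable fun q : (ℝ × Torus) × ℝ => energyProfile c F (-(|q.2 - c| ^ 2 / 2)) :=
    hF.monotone_energyProfile.measurable.comp (by fun_prop)
  have h1 := ae_eq_prod_of_ae_ae hf.aestronglyMeasurable_prod hm.aestronglyMeasurable (by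
    filter_upwards [h] with p hp
    have hne : ∀ᵐ v : ℝ, v ≠ c := by simp [ae_iff]
    filter_upwards [hp, hne] with v hv hvc
    rw [hv, hF.energyProfile_eq hvc])
  exact (measurePreserving_prodAssoc_phaseSpaceTime.symm _).quasiMeasurePreserving.ae h1

end QuasineutralVlasov

/-! ### Assembly of the main theorem. -/

theorem mainTheorem5
    (f : ℝ × QuasineutralVlasov.Torus × ℝ → ℝ)
    (V E vbar : ℝ × QuasineutralVlasov.Torus → ℝ)
    (hf : QuasineutralVlasov.IsWeakSolution f V E)
    (hE : QuasineutralVlasov.MemLinftyL1 E)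
    (hvbar : QuasineutralVlasov.IsC1 vbar)
    (hmono : ∀ᵐ p ∂(volume.restrict QuasineutralVlasov.spaceTime),
      MonotoneOn (fun v : ℝ => f (p.1, p.2, v)) (Iio (vbar p)) ∧
      AntitoneOn (fun v : ℝ => f (p.1, p.2, v)) (Ioi (vbar p)) ∧
      ∀ v : ℝ, f (p.1, p.2, v) ≤ f (p.1, p.2, vbar p))
    (hsymm : ∀ᵐ p ∂(volume.restrict QuasineutralVlasov.spaceTime),
      ∀ v : ℝ, f (p.1, p.2, 2 * vbar p - v) = f (p.1, p.2, v)) :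
    ∃ (c : ℝ) (φ : ℝ → ℝ),
      (∀ t : ℝ, 0 ≤ t → ∀ x : QuasineutralVlasov.Torus, vbar (t, x) = c) ∧
      MonotoneOn φ (Iic 0) ∧
      (∀ u ≤ 0, 0 ≤ φ u) ∧
      IntegrableOn (fun u : ℝ => φ u / √(-u)) (Iio 0) volume ∧
      ∫ u in Iio (0 : ℝ), φ u / √(-u) = 1 / √2 ∧
      (∀ᵐ p ∂(volume.restrict QuasineutralVlasov.phaseSpaceTime),
        f p = φ (-(|p.2.2 - c| ^ 2 / 2))) ∧
      (∀ (t : ℝ) (x : QuasineutralVlasov.Torus) (v : ℝ), 0 ≤ t →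
        ContinuousWithinAt f (Ici 0 ×ˢ univ) (t, x, v) →
        f (t, x, v) = φ (-(|v - c| ^ 2 / 2))) := by
  obtain ⟨c, hc⟩ := hf.exists_mean_velocity_eq hvbar hsymm
  have hu : ∀ᵐ p ∂(volume.restrict QuasineutralVlasov.spaceTime),
      QuasineutralVlasov.IsUnimodal c fun v => f (p.1, p.2, v) := by
    filter_upwards [hf.ae_isDensity, hmono, hsymm,
      ae_restrict_mem QuasineutralVlasov.isOpen_spaceTime.measurableSet] with p hd hm hs hp
    have hpc : vbar p = c := hc p.1 (le_of_lt hp.1) p.2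
    rw [hpc] at hm hs
    exact ⟨hd, hs, hm.2.1, hm.2.2⟩
  obtain ⟨F, hF, hfF⟩ := hf.exists_unimodal_ae_eq hE hu
  have hae := hf.ae_eq_energyProfile hF hfF
  exact ⟨c, QuasineutralVlasov.energyProfile c F, hc, hF.monotone_energyProfile.monotoneOn _,
    fun u _ => hF.energyProfile_nonneg u, hF.integrableOn_energyProfile,
    hF.integral_energyProfile, hae,
    fun _ _ _ ht hcont => hF.eq_energyProfile_of_continuousWithinAt hae ht hcont⟩
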